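/- Let $k$ be a field, $A=k[t]$, $K=k(t)$, and let $|a|$ be the degree of $a\in K$ ($|f/g|=\deg f-\deg g$, $|0|=-\infty$). A norm on a $K$-vector space $E$ is a map $\|\cdot\|:E\to\{-\infty\}\cup\mathbb R$ with $\|x+y\|\le\max\{\|x\|,\|y\|\}$, $\|ax\|=|a|+\|x\|$ for $a\in K$, and $\|x\|=-\infty$ iff $x=0$. A normed space is a finite dimensional $K$-vector space $E$ with a norm such that some finitely generated $A$-submodule $L\subset E$ of full rank satisfies $\dim_k\{x\in L:\|x\|\le r\}<\infty$ for all $r\in\mathbb R$. Let $n=\dim_K E$ and let $\mathrm{Sig}(E)=\{\|x\|+\mathbb Z : 0\ne x\in E\}\subset\mathbb R/\mathbb Z$. A family $(b_1,\dots,b_m)$ of nonzero vectors is reduced if $\|\sum a_ib_i\|=\max_i\|a_ib_i\|$ for all $a_i\in K$. An orthonormal basis of $E$ is a reduced basis with $-1<\|b_1\|\le\dots\le\|b_n\|\le0$. The transition matrix $T(\mathcal B\to\mathcal B')$ is defined by $b_i=\sum_jT_{ij}b'_j$. For a basis $\mathcal B$ of $E$ let $\mathrm{OD}(\mathcal B)=\sum_i\|b_i\|-\sum_i\|b'_i\|-|\det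 T(\mathcal B\to\mathcal B')|$, where $\mathcal B'$ is any orthonormal basis of $E$ (one exists, and the value does not depend on it). A reduction step replaces some $b_i$ by $b_i+\alpha$ with $\|b_i+\alpha\|<\|b_i\|$, where $\alpha$ is an $A$-linear combination of the other $b_j$. The height of $f/g\in K$ in lowest terms is $\max\{|f|,|g|\}$, with the value $0$ for $f=0$; the height $h(T)$ of a matrix is the maximum of the heights of its entries. **Algorithms.** The rows $T_1,\dots,T_n$ of a matrix $T\in\mathrm{GL}_n(K)\cap A^{n\times n}$ are regarded as vectors of $K^n$ with the norm $\|(a_j)\|=\max_j(|a_j|+r_j)$, where $-1<r_1\le\dots\le r_n\le0$. To *process* a set of rows $e_1<\dots<e_f$ of $T$ (with the rows of $T$ sorted by increasing length) and a set $J$ of columns means: form the $f\times\#J$ matrix $M$ over $k$ whose entry at $(i,j)$ is the coefficient of $t^{\lceil\|T_{e_i}\|\rceil}$ in $T_{e_i,j}$; by Gaussian elimination (columns from left to right, in each column the first remaining row with a nonzero entry is taken as the pivot row, and its multiples are subtracted from the later remaining rows) find $P$, which is lower unitriangular up to a permutation of rows, such that $PM$ is in row echelon form; let $s$ be the rank of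 $M$; for $i=s+1,\dots,f$ let $u$ be the largest index with $p_{i,u}\neq0$ and replace $T_{e_u}$ by $T_{e_u}+\sum_{j<u}p_{i,j}\,t^{\lceil\|T_{e_u}\|\rceil-\lceil\|T_{e_j}\|\rceil}T_{e_j}$. *Algorithm 0* (all $r_j$ equal). Put $s=1$. While $s<n$: sort the rows by increasing length and process all rows and all columns; $s$ becomes the rank found. *Algorithm 1* (arbitrary $r_j$). Let $\mathrm{vals}$ be the list of the different values among $r_1,\dots,r_n$ in increasing order. Run through the positions $\iota=1,2,\dots$ of $\mathrm{vals}$ (to which entries may be appended on the way) until its end; at position $\iota$ let $\rho=\mathrm{vals}[\iota]$, sort the rows of $T$ by increasing length, and process the $f$ rows with $\|T_i\|\equiv\rho\pmod{\mathbb Z}$ and the $m$ columns with $r_j=\rho$. If $s=f$, no row changes, and if moreover $f<m$ and $\rho$ does not occur in $\mathrm{vals}$ after position $\iota$, append $\rho$. If $s<f$, then for every changed row $T_{e_u}$ append $\|T_{e_u}\|-\lceil\|T_{e_u}\|\rceil$ (its new length) to $\mathrm{vals}$ unless this value occurs after position $\iota$. *Algorithm 2.* First run Algorithm 0 with all $r_j$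 replaced by $0$ (that is, for the norm $\lceil\|\cdot\|\rceil$), then run Algorithm 1 with the given $r_j$ on the result. Complexity is measured by the number of additions, multiplications, negations, inversions and zero tests in $k$; multiplication of a polynomial by a power of $t$ is a shift and costs nothing. **Statement.** 1. Let $\mathcal B$ be a basis of the $n$-dimensional normed space $E$. Every sequence of consecutive reduction steps starting from $\mathcal B$ has at most $$\#\mathrm{Sig}(E)\cdot\lfloor \mathrm{OD}(\mathcal B)\rfloor+(\#\mathrm{Sig}(E)-1)\,n$$ members. A family $\mathcal C$ reached by such a sequence admits no further reduction step if and only if it is a reduced $A$-basis of $\langle\mathcal B\rangle_A$, and some sequence of reduction steps from $\mathcal B$ does reach a reduced $A$-basis of $\langle\mathcal B\rangle_A$. 2. There is a constant $C$, independent of $k$, $E$, $n$ and the bases, such that the following holds. Let $\mathcal B'$ be an orthonormal basis and $\mathcal B$ a basis of an $n$-dimensional normed space $E$, such that $T=T(\mathcal B\to\mathcal B')$ has polynomial entries, and put $H=\max\{1,h(T)\}$. Then Algorithm 1, run on $T$ with $r_j=\|b'_j\|$, stops after at most $$C\cdot\#\mathrm{Sig}(E)\,\bigl(n^4H+n^3H^2\bigr)$$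 operations in $k$ with a matrix whose rows are the coordinate vectors with respect to $\mathcal B'$ of a reduced $A$-basis of $\langle\mathcal B\rangle_A$. 3. There is a constant $C$, independent of $k$, $E$, $n$ and the bases, such that under the same assumptions Algorithm 2 stops after at most $C\,(n^4H+n^3H^2)$ operations in $k$ with a matrix whose rows are the coordinate vectors with respect to $\mathcal B'$ of a reduced $A$-basis of $\langle\mathcal B\rangle_A$. If $h(T)\ge n$, the number of operations is at most $C\,n^3h(T)^2$. -/

import Mathlib

open Polynomial

universe u v w

noncomputable section

/-! ### Norms, normed spaces, reduced bases over `K = k(t)`, `A = k[t]` -/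

section Spaces

variable {k : Type u} [Field k]

open Classical in
/-- The degree function `|a|` on `k(t)`, with `|0| = -∞`. -/
def ratDegree (a : RatFunc k) : WithBot ℝ :=
  if a = 0 then ⊥ else (((a.intDegree : ℤ) : ℝ) : WithBot ℝ)

/-- The height `max (deg f) (deg g)` of a rational function `f / g` in lowest terms. -/
def ratHeight (a : RatFunc k) : ℕ := max a.num.natDegree a.denom.natDegree

/-- The height of a matrix: the maximum of the heights of its entries. -/
def matrixHeight {n : ℕ} (T : Matrix (Fin n) (Fin n) (RatFunc k)) : ℕ :=
  Finset.univ.sup fun i => Finset.univ.sup fun j => ratHeight (T i j)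

variable {E : Type v} [AddCommGroup E] [Module k E] [Module k[X] E] [Module (RatFunc k) E]

/-- `N` is a norm on the `K`-vector space `E`, with values in `{-∞} ∪ ℝ`. -/
structure IsLengthFunction (k : Type u) [Field k] {E : Type v} [AddCommGroup E]
    [Module (RatFunc k) E] (N : E → WithBot ℝ) : Prop where
  add_le : ∀ x y : E, N (x + y) ≤ max (N x) (N y)
  smul_eq : ∀ (a : RatFunc k) (x : E), N (a • x) = ratDegree a + N x
  eq_bot_iff : ∀ x : E, N x = ⊥ ↔ x = 0

/-- `(L, N)` satisfies the finiteness condition of a lattice: `L` is finitely generated over `A`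
and `{x ∈ L | N x ≤ r}` (a `k`-subspace, hence equal to its span) is finite dimensional over `k`
for every real `r`. -/
structure IsLatticeIn (N : E → WithBot ℝ) (L : Submodule k[X] E) : Prop where
  fg : L.FG
  finite_le : ∀ r : ℝ, Module.Finite k (Submodule.span k {x : E | x ∈ L ∧ N x ≤ (r : WithBot ℝ)})

/-- `(E, N)` is a normed space over `K = k(t)`. -/
structure IsNormedSpaceOver (k : Type u) [Field k] {E : Type v} [AddCommGroup E] [Module k E]
    [Module k[X] E] [Module (RatFunc k) E] (N : E → WithBot ℝ) : Prop where
  finite : Module.Finite (RatFunc k) E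
  norm : IsLengthFunction k N
  exists_lattice : ∃ L : Submodule k[X] E,
    Submodule.span (RatFunc k) (L : Set E) = ⊤ ∧ IsLatticeIn N L

/-- A family of nonzero vectors is reduced if `‖∑ aᵢ bᵢ‖ = max ‖aᵢ bᵢ‖` for all `aᵢ ∈ K`. -/
def IsReducedFamily (k : Type u) [Field k] {E : Type v} [AddCommGroup E] [Module (RatFunc k) E]
    (N : E → WithBot ℝ) {ι : Type w} [Fintype ι] (b : ι → E) : Prop :=
  (∀ i, b i ≠ 0) ∧
    ∀ a : ι → RatFunc k, N (∑ i, a i • b i) = Finset.univ.sup fun i => N (a i • b i)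

/-- An orthonormal basis: reduced, with `-1 < ‖b₁‖ ≤ ⋯ ≤ ‖bₙ‖ ≤ 0`. -/
structure IsOrthonormalBasis (N : E → WithBot ℝ) {n : ℕ}
    (b : Module.Basis (Fin n) (RatFunc k) E) : Prop where
  reduced : IsReducedFamily k N b
  mono : Monotone fun i => N (b i)
  lower : ∀ i, ((-1 : ℝ) : WithBot ℝ) < N (b i)
  upper : ∀ i, N (b i) ≤ ((0 : ℝ) : WithBot ℝ)

/-- The length of a nonzero vector as a real number. -/
def realLength (N : E → WithBot ℝ) (x : E) : ℝ := (N x).unbotD 0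

/-- The signature of `E`: the lengths of the nonzero vectors modulo `ℤ`. -/
def signature (N : E → WithBot ℝ) : Set UnitAddCircle :=
  {ρ | ∃ x : E, x ≠ 0 ∧ ρ = ((realLength N x : ℝ) : UnitAddCircle)}

/-- The transition matrix `T(b → b')`: `bᵢ = ∑ⱼ Tᵢⱼ b'ⱼ`. -/
def transitionMatrix {n : ℕ} (b b' : Module.Basis (Fin n) (RatFunc k) E) :
    Matrix (Fin n) (Fin n) (RatFunc k) :=
  Matrix.of fun i j => b'.repr (b i) j

/-- The volume of a basis: the sum of the lengths of its vectors. -/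
def basisVolume (N : E → WithBot ℝ) {n : ℕ} (b : Module.Basis (Fin n) (RatFunc k) E) : ℝ :=
  ∑ i, realLength N (b i)

open Classical in
/-- The volume of the `n`-dimensional space `E`: the volume of any orthonormal basis. -/
def spaceVolume (k : Type u) [Field k] {E : Type v} [AddCommGroup E] [Module (RatFunc k) E]
    (N : E → WithBot ℝ) (n : ℕ) : ℝ :=
  if h : ∃ b' : Module.Basis (Fin n) (RatFunc k) E, IsOrthonormalBasis N b' then
    basisVolume N h.choose
  else 0

open Classical in
/-- `|d(b)|`, the degree of the determinant of the transition matrix from `b` to any orthonormal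
basis of `E`. -/
def detDegree (N : E → WithBot ℝ) {n : ℕ} (b : Module.Basis (Fin n) (RatFunc k) E) : ℝ :=
  if h : ∃ b' : Module.Basis (Fin n) (RatFunc k) E, IsOrthonormalBasis N b' then
    ((transitionMatrix b h.choose).det.intDegree : ℝ)
  else 0

/-- The orthogonal defect `OD(b) = vol(b) - vol(E) - |d(b)|`. -/
def orthogonalDefect (N : E → WithBot ℝ) {n : ℕ}
    (b : Module.Basis (Fin n) (RatFunc k) E) : ℝ :=
  basisVolume N b - spaceVolume k N n - detDegree N b

/-- A reduction step: some `bᵢ` is replaced by `bᵢ + α` of strictly smaller length, where `α` is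
an `A`-linear combination of the other vectors. -/
def IsReductionStep (k : Type u) [Field k] {E : Type v} [AddCommGroup E] [Module k[X] E]
    (N : E → WithBot ℝ) {n : ℕ} (b c : Fin n → E) : Prop :=
  ∃ i, (∀ j, j ≠ i → c j = b j) ∧ N (c i) < N (b i) ∧
    ∃ α ∈ Submodule.span k[X] (b '' {i}ᶜ), c i = b i + α

/-- `c` is obtained from `b` by exactly `m` consecutive reduction steps. -/
inductive ReductionChain (k : Type u) [Field k] {E : Type v} [AddCommGroup E] [Module k[X] E]
    (N : E → WithBot ℝ) {n : ℕ} (b : Fin n → E) : ℕ → (Fin n → E) → Prop where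
  | refl : ReductionChain k N b 0 b
  | step {m : ℕ} {c d : Fin n → E} :
      ReductionChain k N b m c → IsReductionStep k N c d → ReductionChain k N b (m + 1) d

end Spaces

/-! ### Counting operations in `k` -/

/-- A value together with the number of operations in `k` spent to obtain it. -/
structure Counted (α : Type u) : Type u where
  val : α
  ops : ℕ

namespace Counted

/-- A value obtained without operations in `k`. -/
def pure {α : Type u} (a : α) : Counted α := ⟨a, 0⟩

/-- Sequential composition; the numbers of operations are added. -/
def bind {α : Type u} {β : Type v} (x : Counted α) (f : α → Counted β) : Counted β :=
  ⟨(f x.val).val, x.ops + (f x.val).ops⟩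

/-- Run a finite family of independent computations. -/
def pi {ι : Type u} [Fintype ι] {α : Type v} (f : ι → Counted α) : Counted (ι → α) :=
  ⟨fun i => (f i).val, ∑ i, (f i).ops⟩

/-- Run a computation for every entry of a list. -/
def traverse {α : Type u} {β : Type v} (f : α → Counted β) : List α → Counted (List β)
  | [] => pure []
  | a :: l => (f a).bind fun b => (traverse f l).bind fun l' => pure (b :: l')

/-- A `for` loop over a list, with state in `σ`. -/
def forLoop {α : Type u} {σ : Type v} (f : σ → α → Counted σ) : List α → σ → Counted σ
  | [], s => pure s
  | a :: l, s => (f s a).bind fun s' => forLoop f l s'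

end Counted

/-- A `while` loop: started in the first state it stops in the second one, after the given number
of operations in `k`. -/
inductive WhileRuns {σ : Type u} (cond : σ → Prop) (body : σ → Counted σ) : σ → σ → ℕ → Prop where
  | halt {s : σ} : ¬ cond s → WhileRuns cond body s s 0
  | loop {s s' : σ} {c : ℕ} : cond s → WhileRuns cond body (body s).val s' c →
      WhileRuns cond body s s' ((body s).ops + c)

section Operations

variable {k : Type u} [Field k]

/-- Addition in `k`: one operation. -/
def kAdd (a b : k) : Counted k := ⟨a + b, 1⟩

/-- Multiplication in `k`: one operation. -/
def kMul (a b : k) : Counted k := ⟨a * b, 1⟩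

/-- Negation in `k`: one operation. -/
def kNeg (a : k) : Counted k := ⟨-a, 1⟩

/-- Inversion in `k`: one operation. -/
def kInv (a : k) : Counted k := ⟨a⁻¹, 1⟩

open Classical in
/-- Zero test in `k`: one operation. -/
def kIsZero (a : k) : Counted Bool := ⟨decide (a = 0), 1⟩

/-- The polynomial `p + c t^m q`, computed coefficient by coefficient. Multiplication by `t^m` is
a shift of exponents. The zero test on each new coefficient keeps the list of the nonzero
coefficients (hence the degree) of the result up to date. -/
def addScaledShift (p : k[X]) (c : k) (m : ℕ) (q : k[X]) : Counted k[X] :=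
  Counted.forLoop (fun (s : k[X]) (i : ℕ) =>
    (kMul c (q.coeff i)).bind fun x =>
    (kAdd (s.coeff (i + m)) x).bind fun y =>
    (kIsZero y).bind fun z =>
    Counted.pure (if z then s.erase (i + m) else s.update (i + m) y))
    (List.range (q.natDegree + 1)) p

end Operations

/-! ### Row echelon form over `k` -/

section Echelon

variable {k : Type u} [Field k] {ι : Type v} {κ : Type w}

/-- A row of `P M` together with the corresponding row of `P`. -/
structure EchelonRow (k : Type u) (ι : Type v) (κ : Type w) where
  coef : ι → k
  val : κ → k

/-- Find the first row with a nonzero entry in column `c`, and split the list there. -/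
def findPivot (c : κ) : List (EchelonRow k ι κ) →
    Counted (Option (List (EchelonRow k ι κ) × EchelonRow k ι κ × List (EchelonRow k ι κ)))
  | [] => Counted.pure none
  | x :: l => (kIsZero (x.val c)).bind fun z =>
      if z then
        (findPivot c l).bind fun o =>
          Counted.pure (o.map fun s => (x :: s.1, s.2.1, s.2.2))
      else Counted.pure (some ([], x, l))

variable [Fintype ι] [Fintype κ]

/-- Subtract from the row `y` the multiple of the pivot row `x` that clears column `c`; here `d` is
the inverse of the pivot. -/
def clearRow (c : κ) (x : EchelonRow k ι κ) (d : k) (y : EchelonRow k ι κ) :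
    Counted (EchelonRow k ι κ) :=
  (kMul (y.val c) d).bind fun q =>
  (kNeg q).bind fun q' =>
  (Counted.pi fun i => (kMul q' (x.coef i)).bind fun z => kAdd (y.coef i) z).bind fun coef =>
  (Counted.pi fun j => (kMul q' (x.val j)).bind fun z => kAdd (y.val j) z).bind fun val =>
  Counted.pure ⟨coef, val⟩

/-- Gaussian elimination, column by column. `done` are the pivot rows found so far, `rest` the
remaining rows in their original order. -/
def eliminate : List κ → List (EchelonRow k ι κ) → List (EchelonRow k ι κ) →
    Counted (List (EchelonRow k ι κ) × List (EchelonRow k ι κ))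
  | [], done, rest => Counted.pure (done, rest)
  | c :: cs, done, rest => (findPivot c rest).bind fun o =>
      match o with
      | none => eliminate cs done rest
      | some (pre, x, post) =>
          (kInv (x.val c)).bind fun d =>
          (Counted.traverse (clearRow c x d) post).bind fun post' =>
          eliminate cs (done ++ [x]) (pre ++ post')

open Classical in
/-- Transform `M` into row echelon form `P M`, with `P` lower triangular with `1` on the diagonal
up to a permutation of its rows. The first list holds the nonzero rows of `P M`, the second list
the zero rows, each together with its row of `P`. -/
def rowEchelon [LinearOrder ι] [LinearOrder κ] (M : Matrix ι κ k) :
    Counted (List (EchelonRow k ι κ) × List (EchelonRow k ι κ)) :=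
  eliminate ((Finset.univ : Finset κ).sort (· ≤ ·)) []
    (((Finset.univ : Finset ι).sort (· ≤ ·)).map fun i => ⟨Pi.single i 1, M i⟩)

/-- The largest index of a nonzero entry. -/
def lastNonzero [LinearOrder ι] (p : ι → k) : Counted (Option ι) :=
  (Counted.pi fun i => kIsZero (p i)).bind fun z =>
  Counted.pure
    (if h : (Finset.univ.filter fun i => z i = false).Nonempty then some (Finset.max' _ h)
      else none)

end Echelon

/-! ### The reduction algorithms

The normed space is `K(r₁) ⊥ ⋯ ⊥ K(rₙ)`, the input basis is given by the rows of a matrix with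
polynomial entries. -/

section Algorithms

variable {k : Type u} [Field k] {n : ℕ}

/-- The length `max (deg vⱼ + rⱼ)` of a nonzero vector `v` with polynomial coordinates (and `0` for
`v = 0`). -/
def rowLength (r : Fin n → ℝ) (v : Fin n → k[X]) : ℝ :=
  (Finset.univ.sup fun j => (v j).degree.map fun d : ℕ => (d : ℝ) + r j : WithBot ℝ).unbotD 0

/-- Sort the rows by increasing length. -/
def sortRows (r : Fin n → ℝ) (T : Matrix (Fin n) (Fin n) k[X]) : Matrix (Fin n) (Fin n) k[X] :=
  fun i => T (Tuple.sort (fun a => rowLength r (T a)) i)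

/-- The coefficient of `t^⌈ℓ⌉` in the polynomial `p`, that is, the zero coefficient of
`t^(-⌈ℓ⌉) p`. -/
def leadCoeffAt (ℓ : ℝ) (p : k[X]) : k := p.coeff ⌈ℓ⌉.toNat

/-- The row vector `v + c t^m w`. -/
def addScaledShiftRow (v : Fin n → k[X]) (c : k) (m : ℕ) (w : Fin n → k[X]) :
    Counted (Fin n → k[X]) :=
  Counted.pi fun j => addScaledShift (v j) c m (w j)

open Classical in
/-- Replace the row `T_{e u}` by
`T_{e u} + ∑_{j < u} p_j t^(⌈‖T_{e u}‖⌉ - ⌈‖T_{e j}‖⌉) T_{e j}`. -/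
def reduceRow {ι : Type} [Fintype ι] [LinearOrder ι] (r : Fin n → ℝ) (e : ι → Fin n)
    (T : Matrix (Fin n) (Fin n) k[X]) (p : ι → k) (u : ι) :
    Counted (Matrix (Fin n) (Fin n) k[X]) :=
  (Counted.forLoop (fun (v : Fin n → k[X]) (j : ι) =>
      addScaledShiftRow v (p j)
        (⌈rowLength r (T (e u))⌉ - ⌈rowLength r (T (e j))⌉).toNat (T (e j)))
    ((Finset.univ.filter fun j : ι => j < u).sort (· ≤ ·)) (T (e u))).bind fun v =>
  Counted.pure (Function.update T (e u) v)

/-- The algorithm for `K(ρ) ⊥ ⋯ ⊥ K(ρ)`; its state is the matrix and the rank `s`. -/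
structure UniformState (k : Type u) [Field k] (n : ℕ) where
  T : Matrix (Fin n) (Fin n) k[X]
  s : ℕ

/-- The body of the `while` loop of the algorithm for `K(ρ) ⊥ ⋯ ⊥ K(ρ)`. -/
def uniformBody (ρ : ℝ) (σ : UniformState k n) : Counted (UniformState k n) :=
  let r : Fin n → ℝ := fun _ => ρ
  let T := sortRows r σ.T
  let M : Matrix (Fin n) (Fin n) k := fun i j => leadCoeffAt (rowLength r (T i)) (T i j)
  (rowEchelon M).bind fun P =>
  (if P.1.length < n then
    Counted.forLoop (fun (T' : Matrix (Fin n) (Fin n) k[X]) (x : EchelonRow k (Fin n) (Fin n)) =>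
      (lastNonzero x.coef).bind fun o =>
      match o with
      | none => Counted.pure T'
      | some u => reduceRow r id T' x.coef u) P.2 T
  else Counted.pure T).bind fun T' =>
  Counted.pure ⟨T', P.1.length⟩

/-- The reduction algorithm for `K(ρ) ⊥ ⋯ ⊥ K(ρ)` turns `T` into `T'` using `c` operations. -/
def UniformReductionRuns (ρ : ℝ) (T T' : Matrix (Fin n) (Fin n) k[X]) (c : ℕ) : Prop :=
  ∃ s : ℕ, WhileRuns (fun σ : UniformState k n => σ.s < n) (uniformBody ρ) ⟨T, 1⟩ ⟨T', s⟩ c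

/-- Congruence of real numbers modulo `ℤ`. -/
def CongModInt (x y : ℝ) : Prop := ∃ z : ℤ, x = y + z

/-- The state of the general algorithm: the matrix, the list `vals` of classes, and the position
`pos` in this list (counted from `0`). -/
structure GeneralState (k : Type u) [Field k] (n : ℕ) where
  T : Matrix (Fin n) (Fin n) k[X]
  vals : List ℝ
  pos : ℕ

open Classical in
/-- Append `x` to `vals`, unless it already occurs behind position `pos`. -/
def appendPending (pos : ℕ) (vals : List ℝ) (x : ℝ) : List ℝ :=
  if x ∈ vals.drop (pos + 1) then vals else vals ++ [x]

open Classical in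
/-- The body of the `while` loop of the general algorithm. The rows `e₁ < ⋯ < e_f` are those whose
length is congruent to `vals[pos]`, the columns are those of the block with `rⱼ ≡ vals[pos]`. -/
def generalBody (r : Fin n → ℝ) (σ : GeneralState k n) : Counted (GeneralState k n) :=
  let x := σ.vals.getD σ.pos 0
  let T := sortRows r σ.T
  let M : Matrix {i : Fin n // CongModInt (rowLength r (T i)) x} {j : Fin n // CongModInt (r j) x} k
    := fun i j => leadCoeffAt (rowLength r (T i)) (T i j)
  let f := Fintype.card {i : Fin n // CongModInt (rowLength r (T i)) x}
  let m := Fintype.card {j : Fin n // CongModInt (r j) x}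
  (rowEchelon M).bind fun P =>
  if P.1.length = f then
    Counted.pure ⟨T, if f < m then appendPending σ.pos σ.vals x else σ.vals, σ.pos + 1⟩
  else
    (Counted.forLoop
      (fun (τ : Matrix (Fin n) (Fin n) k[X] × List ℝ)
          (y : EchelonRow k {i : Fin n // CongModInt (rowLength r (T i)) x}
            {j : Fin n // CongModInt (r j) x}) =>
        (lastNonzero y.coef).bind fun o =>
        match o with
        | none => Counted.pure τ
        | some u =>
            (reduceRow r Subtype.val τ.1 y.coef u).bind fun T' =>
            Counted.pure (T', appendPending σ.pos τ.2
              (rowLength r (T' u.val) - ⌈rowLength r (T' u.val)⌉)))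
      P.2 (T, σ.vals)).bind fun τ =>
    Counted.pure ⟨τ.1, τ.2, σ.pos + 1⟩

/-- The reduction algorithm for `K(r₁) ⊥ ⋯ ⊥ K(rₙ)` turns `T` into `T'` using `c` operations. It
starts with the list of the different values among `r₁, …, rₙ`, in increasing order. -/
def GeneralReductionRuns (r : Fin n → ℝ) (T T' : Matrix (Fin n) (Fin n) k[X]) (c : ℕ) : Prop :=
  ∃ (vals : List ℝ) (pos : ℕ),
    WhileRuns (fun σ : GeneralState k n => σ.pos < σ.vals.length) (generalBody r)
      ⟨T, (Finset.univ.image r).sort (· ≤ ·), 0⟩ ⟨T', vals, pos⟩ c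

/-- The optimized algorithm: first the algorithm for `K(0) ⊥ ⋯ ⊥ K(0)` (for the norm `⌈‖ ‖⌉`), then
the general one. -/
def OptimizedReductionRuns (r : Fin n → ℝ) (T T' : Matrix (Fin n) (Fin n) k[X]) (c : ℕ) : Prop :=
  ∃ (T₁ : Matrix (Fin n) (Fin n) k[X]) (c₁ c₂ : ℕ),
    UniformReductionRuns 0 T T₁ c₁ ∧ GeneralReductionRuns r T₁ T' c₂ ∧ c = c₁ + c₂

end Algorithms

section Output

variable {k : Type u} [Field k] {E : Type v} [AddCommGroup E] [Module k[X] E]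
  [Module (RatFunc k) E] {n : ℕ}

/-- The vectors of `E` whose coordinates with respect to `b'` are the rows of `T`. -/
def rowVectors (b' : Module.Basis (Fin n) (RatFunc k) E) (T : Matrix (Fin n) (Fin n) k[X]) :
    Fin n → E :=
  fun i => ∑ j, algebraMap k[X] (RatFunc k) (T i j) • b' j

/-- `c` is a reduced `A`-basis of the lattice generated by `b`. -/
def IsReducedBasisOfSpan (N : E → WithBot ℝ) (b c : Fin n → E) : Prop :=
  IsReducedFamily k N c ∧ LinearIndependent k[X] c ∧
    Submodule.span k[X] (Set.range c) = Submodule.span k[X] (Set.range b)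

end Output

end

noncomputable section

/-! The engine is a leading-term relation. If a family is not reduced, clear denominators in a
combination that is too short, keep the leading monomials of the terms of maximal length, and divide
by one of least degree. This gives a relation with monomial coefficients, equal to 1 at some vector,
whose value is shorter than that vector (`exists_leading_relation`). Hence reduced families are
exactly those without a reduction step. Inside a lattice, minimising dimensions of sublevel sets
then yields a reduced basis, and scaling it by powers of `t` an orthonormal one.

A reduction step preserves the span and the determinant, so Hadamard's inequality bounds the total
loss of length by the orthogonal defect. All lengths lie in `R + ℤ`, with `R` the finite set of
orthonormal lengths. Numbering these values (`classIndex`) turns each step into a drop of an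
integer, and comparing index with length (`classIndex_sub_le`) gives the bound on the number of
steps.

For the algorithms, a row of degree `d` has length `d + ρ` for a class `ρ` in `R`, and only the
columns of class `ρ` reach this length. Elimination on these columns expresses each dependent row
through itself and earlier pivot rows; pivot rows never change, so all relations found in one pass
remain usable while rows are replaced (`EliminationInv`, `IsLeadingBlock.reduceRow`). Independence
in every class implies reducedness (`isReducedFamily_rowVectors`).

The cost has two sources. Each shortened row lowers the index sum, so at most `s (δ + n)` rows are
shortened, where `s = #R` and `δ` is the sum of the row degrees minus the degree of the determinant.
Eliminations are grouped into rounds, one round running through the classes pending at its start;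
these are distinct, so a round costs at most `8 n³`. If the degree sum stays constant during a
round, shortened rows only move to smaller classes, so processing the largest dependent class
settles it for good. Hence the pair of degree sum and number of classes below a dependent one
decreases lexicographically, and `roundBound` encodes it in one number. Finally, the uniform
algorithm brings `δ` down to 0, after which only about `s` rounds remain; this removes the factor
`#Sig(E)`. -/

theorem exists_sum_of_mem_span_image_compl {R M : Type*} [Ring R] [AddCommGroup M] [Module R M]
    {ι : Type*} [Fintype ι] [DecidableEq ι] {b : ι → M} {i : ι} {α : M}
    (hα : α ∈ Submodule.span R (b '' {i}ᶜ)) :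
    ∃ a : ι → R, ∑ j ∈ Finset.univ.erase i, a j • b j = α := by
  rw [Finsupp.mem_span_image_iff_linearCombination] at hα
  obtain ⟨l, hl, rfl⟩ := hα
  refine ⟨l, ?_⟩
  rw [Finsupp.linearCombination_apply, Finsupp.sum_fintype _ _ (by simp)]
  refine Finset.sum_subset (Finset.subset_univ _) fun j _ hj => ?_
  have : j = i := by simpa using hj
  subst this
  have : l j = 0 := by
    by_contra hcon
    exact hl (Finsupp.mem_support_iff.2 hcon) rfl
  rw [this, zero_smul]

/-! ### Norms, leading-term relations and the existence of reduction steps. -/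

section Norms

variable {k : Type u} [Field k] {E : Type v} [AddCommGroup E]
  [Module (RatFunc k) E] {N : E → WithBot ℝ}

theorem ratDegree_of_ne_zero {a : RatFunc k} (ha : a ≠ 0) :
    ratDegree a = (((a.intDegree : ℤ) : ℝ) : WithBot ℝ) := by
  simp [ratDegree, ha]

theorem ratDegree_algebraMap {p : k[X]} (hp : p ≠ 0) :
    ratDegree (algebraMap k[X] (RatFunc k) p) = ((p.natDegree : ℝ) : WithBot ℝ) := by
  have h : algebraMap k[X] (RatFunc k) p ≠ 0 :=
    (map_ne_zero_iff _ (RatFunc.algebraMap_injective k)).2 hp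
  rw [ratDegree_of_ne_zero h, RatFunc.intDegree_polynomial]
  simp

namespace IsLengthFunction

variable (hN : IsLengthFunction k N)
include hN

theorem map_zero : N 0 = ⊥ := (hN.eq_bot_iff 0).2 rfl

theorem coe_realLength {x : E} (hx : x ≠ 0) : N x = (realLength N x : WithBot ℝ) := by
  have h : N x ≠ ⊥ := fun h => hx ((hN.eq_bot_iff x).1 h)
  obtain ⟨r, hr⟩ := WithBot.ne_bot_iff_exists.1 h
  simp [realLength, ← hr]

theorem sum_lt {ι : Type*} (s : Finset ι) (f : ι → E) {μ : WithBot ℝ} (hμ : ⊥ < μ)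
    (h : ∀ i ∈ s, N (f i) < μ) : N (∑ i ∈ s, f i) < μ := by
  refine Finset.sum_induction f (fun x => N x < μ) (fun x y hx hy => ?_) ?_ h
  · exact (hN.add_le x y).trans_lt (max_lt hx hy)
  · rwa [hN.map_zero]

theorem sum_le {ι : Type*} (s : Finset ι) (f : ι → E) {μ : WithBot ℝ}
    (h : ∀ i ∈ s, N (f i) ≤ μ) : N (∑ i ∈ s, f i) ≤ μ := by
  refine Finset.sum_induction f (fun x => N x ≤ μ) (fun x y hx hy => ?_) ?_ h
  · exact (hN.add_le x y).trans (max_le hx hy)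
  · rw [hN.map_zero]; exact bot_le

theorem map_neg (x : E) : N (-x) = N x := by
  have h := hN.smul_eq (-1) x
  have h1 : ratDegree (-1 : RatFunc k) = 0 := by
    rw [ratDegree_of_ne_zero (by simp), RatFunc.intDegree_neg, RatFunc.intDegree_one]
    simp
  rwa [h1, zero_add, neg_smul, one_smul] at h

theorem sub_lt {x y : E} {μ : WithBot ℝ} (hx : N x < μ) (hy : N y < μ) : N (x - y) < μ := by
  rw [sub_eq_add_neg]
  exact (hN.add_le _ _).trans_lt (max_lt hx (by rwa [hN.map_neg]))

theorem smul_coe {a : RatFunc k} (ha : a ≠ 0) {x : E} (hx : x ≠ 0) :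
    N (a • x) = ((a.intDegree + realLength N x : ℝ) : WithBot ℝ) := by
  rw [hN.smul_eq, ratDegree_of_ne_zero ha, hN.coe_realLength hx]; rfl

variable [Module k[X] E] [IsScalarTower k[X] (RatFunc k) E]

theorem poly_smul (p : k[X]) (x : E) :
    N (p • x) = ratDegree (algebraMap k[X] (RatFunc k) p) + N x := by
  rw [← hN.smul_eq, algebraMap_smul]

theorem poly_smul_coe {p : k[X]} (hp : p ≠ 0) {x : E} (hx : x ≠ 0) :
    N (p • x) = ((p.natDegree + realLength N x : ℝ) : WithBot ℝ) := by
  rw [hN.poly_smul, ratDegree_algebraMap hp, hN.coe_realLength hx]; rfl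

theorem poly_smul_lt {p : k[X]} {x : E} (hx : x ≠ 0) {μ : ℝ}
    (h : p ≠ 0 → p.natDegree + realLength N x < μ) : N (p • x) < (μ : WithBot ℝ) := by
  by_cases hp : p = 0
  · rw [hp, zero_smul, hN.map_zero]; exact WithBot.bot_lt_coe _
  · rw [hN.poly_smul_coe hp hx]; exact_mod_cast h hp

/-- Multiplication by a common denominator shifts all lengths by the same amount, so a failing
identity over `K` may be taken with polynomial coefficients. The index `i₁` is one where the maximum
is attained. -/
theorem exists_poly_of_not_reduced {ι : Type w} [Fintype ι] {c : ι → E} (hc : ∀ i, c i ≠ 0)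
    (h : ¬ IsReducedFamily k N c) :
    ∃ (p : ι → k[X]) (i₁ : ι), p i₁ ≠ 0 ∧ N (∑ i, p i • c i) < N (p i₁ • c i₁) ∧
      ∀ i, N (p i • c i) ≤ N (p i₁ • c i₁) := by
  classical
  have h2 : ∃ a : ι → RatFunc k,
      N (∑ i, a i • c i) ≠ Finset.univ.sup fun i => N (a i • c i) := by
    by_contra! hcon
    exact h ⟨hc, hcon⟩
  obtain ⟨a, ha⟩ := h2
  have hle : N (∑ i, a i • c i) ≤ Finset.univ.sup fun i => N (a i • c i) :=
    hN.sum_le _ _ fun i _ => Finset.le_sup (f := fun i => N (a i • c i)) (Finset.mem_univ i)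
  have hlt := lt_of_le_of_ne hle ha
  have hne : (Finset.univ : Finset ι).Nonempty := by
    by_contra hcon
    rw [Finset.not_nonempty_iff_eq_empty] at hcon
    rw [hcon] at hlt
    simp at hlt
  obtain ⟨i₁, -, hi₁⟩ := Finset.exists_mem_eq_sup _ hne fun i => N (a i • c i)
  obtain ⟨q, hq⟩ := IsLocalization.exist_integer_multiples_of_finite (nonZeroDivisors k[X]) a
  choose p hp using hq
  have hq0 : algebraMap k[X] (RatFunc k) q ≠ 0 :=
    (map_ne_zero_iff _ (RatFunc.algebraMap_injective k)).2 (nonZeroDivisors.coe_ne_zero q)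
  have hps : ∀ i, p i • c i = algebraMap k[X] (RatFunc k) q • (a i • c i) := fun i => by
    rw [← algebraMap_smul (RatFunc k) (p i), hp i, smul_smul, Algebra.smul_def]
  have hai : a i₁ ≠ 0 := by
    intro h0
    rw [hi₁, h0, zero_smul, hN.map_zero] at hlt
    simp at hlt
  have hshift : ∀ x y : E, N x < N y →
      N (algebraMap k[X] (RatFunc k) q • x) < N (algebraMap k[X] (RatFunc k) q • y) := by
    intro x y hxy
    have hy : y ≠ 0 := by rintro rfl; rw [hN.map_zero] at hxy; simp at hxy
    by_cases hx : x = 0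
    · subst hx
      rw [smul_zero, hN.map_zero, hN.smul_coe hq0 hy]; exact WithBot.bot_lt_coe _
    · rw [hN.smul_coe hq0 hy, hN.smul_coe hq0 hx]
      rw [hN.coe_realLength hx, hN.coe_realLength hy, WithBot.coe_lt_coe] at hxy
      rw [WithBot.coe_lt_coe]; linarith
  refine ⟨p, i₁, ?_, ?_, fun i => ?_⟩
  · intro h0
    have := hp i₁
    rw [h0, _root_.map_zero, Algebra.smul_def] at this
    exact mul_ne_zero hq0 hai this.symm
  · simp_rw [hps, ← Finset.smul_sum]
    exact hshift _ _ (hi₁ ▸ hlt)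
  · rw [hps, hps, hN.smul_eq, hN.smul_eq _ (a i₁ • c i₁)]
    exact add_le_add le_rfl
      (hi₁ ▸ Finset.le_sup (f := fun i => N (a i • c i)) (Finset.mem_univ i))

/-- A family that is not reduced has a `k`-linear relation between its leading terms. -/
theorem exists_leading_relation {ι : Type w} [Fintype ι] {c : ι → E} (hc : ∀ i, c i ≠ 0)
    (h : ¬ IsReducedFamily k N c) :
    ∃ (i₀ : ι) (α : ι → k) (d : ι → ℕ), α i₀ = 1 ∧ d i₀ = 0 ∧
      (∀ i, α i ≠ 0 → realLength N (c i₀) = realLength N (c i) + d i) ∧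
      N (∑ i, (C (α i) * X ^ d i) • c i) < N (c i₀) := by
  classical
  obtain ⟨p, i₁, hp₁, hlt, hle⟩ := hN.exists_poly_of_not_reduced hc h
  set μ := N (p i₁ • c i₁) with hμ
  have hμbot : ⊥ < μ := lt_of_le_of_lt bot_le hlt
  set S := Finset.univ.filter fun i => N (p i • c i) = μ with hS
  have hSmem : ∀ i, i ∈ S ↔ N (p i • c i) = μ := by simp [hS]
  have hSp : ∀ i ∈ S, p i ≠ 0 := by
    intro i hi h0
    rw [hSmem, h0, zero_smul, hN.map_zero] at hi
    exact hμbot.ne hi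
  -- Least degree among the terms of maximal length: the other leading monomials are then divisible
  -- by that of `i₀`, and the quotient relation stays polynomial.
  obtain ⟨i₀, hi₀, hmin⟩ := S.exists_min_image (fun i => (p i).natDegree) ⟨i₁, (hSmem i₁).2 rfl⟩
  have hμ₀ : μ = (((p i₀).natDegree + realLength N (c i₀) : ℝ) : WithBot ℝ) := by
    rw [← (hSmem i₀).1 hi₀, hN.poly_smul_coe (hSp i₀ hi₀) (hc i₀)]
  have hlc : (p i₀).leadingCoeff ≠ 0 := leadingCoeff_ne_zero.2 (hSp i₀ hi₀)
  refine ⟨i₀, fun i => if i ∈ S then (p i).leadingCoeff / (p i₀).leadingCoeff else 0,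
    fun i => if i ∈ S then (p i).natDegree - (p i₀).natDegree else 0, ?_, ?_, ?_, ?_⟩
  · simp [hi₀, div_self hlc]
  · simp
  · intro i hi
    have hiS : i ∈ S := by by_contra hcon; simp [hcon] at hi
    have h1 : μ = (((p i).natDegree + realLength N (c i) : ℝ) : WithBot ℝ) := by
      rw [← (hSmem i).1 hiS, hN.poly_smul_coe (hSp i hiS) (hc i)]
    rw [hμ₀, WithBot.coe_inj] at h1
    simp only [hiS, if_true]
    rw [Nat.cast_sub (hmin i hiS)]
    linarith
  · set y := ∑ i, (C (if i ∈ S then (p i).leadingCoeff / (p i₀).leadingCoeff else 0) *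
      X ^ (if i ∈ S then (p i).natDegree - (p i₀).natDegree else 0)) • c i with hy
    set m : k[X] := C (p i₀).leadingCoeff * X ^ (p i₀).natDegree with hm
    have hm0 : m ≠ 0 := by simp [hm, hSp i₀ hi₀]
    have hmdeg : m.natDegree = (p i₀).natDegree := natDegree_C_mul_X_pow _ _ hlc
    -- Up to the factor `m`, `y` is the short combination with everything except the leading
    -- monomials of the terms in `S` removed; the removed part is also shorter than `μ`.
    have hmy : m • y = ∑ i, p i • c i -
        ∑ i, (if i ∈ S then (p i).eraseLead else p i) • c i := by
      rw [hy, Finset.smul_sum, ← Finset.sum_sub_distrib]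
      refine Finset.sum_congr rfl fun i _ => ?_
      rw [smul_smul, ← sub_smul]
      congr 1
      by_cases hiS : i ∈ S
      · simp only [hiS, if_true, hm]
        rw [eq_sub_iff_add_eq.2 ((add_comm _ _).trans (p i).eraseLead_add_C_mul_X_pow) |>.symm,
          show C (p i).leadingCoeff = C (p i₀).leadingCoeff *
            C ((p i).leadingCoeff / (p i₀).leadingCoeff) by
              rw [← C_mul, mul_div_cancel₀ _ hlc],
          ← Nat.add_sub_of_le (hmin i hiS), pow_add, Nat.add_sub_cancel_left]
        ring
      · simp [hiS]
    have hlt2 : N (m • y) < μ := by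
      rw [hmy]
      refine hN.sub_lt hlt (hN.sum_lt _ _ hμbot fun i _ => ?_)
      by_cases hiS : i ∈ S
      · simp only [hiS, if_true]
        rw [← (hSmem i).1 hiS, hN.poly_smul_coe (hSp i hiS) (hc i)]
        refine hN.poly_smul_lt (hc i) fun h0 => ?_
        have := eraseLead_natDegree_lt_or_eraseLead_eq_zero (p i)
        have h1 := this.resolve_right h0
        have : ((p i).eraseLead.natDegree : ℝ) < (p i).natDegree := by exact_mod_cast h1
        linarith
      · simp only [hiS, if_false]
        exact lt_of_le_of_ne (hle i) fun h => hiS ((hSmem i).2 h)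
    by_cases hy0 : y = 0
    · rw [hy0, hN.map_zero, hN.coe_realLength (hc i₀)]; exact WithBot.bot_lt_coe _
    · rw [hN.poly_smul_coe hm0 hy0, hμ₀, WithBot.coe_lt_coe, hmdeg] at hlt2
      rw [hN.coe_realLength hy0, hN.coe_realLength (hc i₀), WithBot.coe_lt_coe]
      linarith

/-- The leading relation has coefficient 1 at `i₀`, so its value is `c i₀` plus an `A`-combination
of the other vectors. -/
theorem exists_reductionStep {n : ℕ} {c : Fin n → E} (hc : ∀ i, c i ≠ 0)
    (h : ¬ IsReducedFamily k N c) : ∃ d, IsReductionStep k N c d := by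
  classical
  obtain ⟨i₀, α, d, hα, hd, -, hlt⟩ := hN.exists_leading_relation hc h
  have hsum : ∑ i, (C (α i) * X ^ d i) • c i =
      c i₀ + ∑ i ∈ Finset.univ.erase i₀, (C (α i) * X ^ d i) • c i := by
    rw [← Finset.add_sum_erase _ _ (Finset.mem_univ i₀), hα, hd]
    simp
  refine ⟨Function.update c i₀ (∑ i, (C (α i) * X ^ d i) • c i), i₀,
    fun j hj => Function.update_of_ne hj _ _, by simpa using hlt,
    ∑ i ∈ Finset.univ.erase i₀, (C (α i) * X ^ d i) • c i, ?_, by simpa using hsum⟩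
  refine Submodule.sum_mem _ fun i hi => Submodule.smul_mem _ _ (Submodule.subset_span ?_)
  exact ⟨i, by simpa using hi, rfl⟩

-- The replaced vector occurs with coefficient 1 in its replacement, so reducedness makes the
-- replacement at least as long.
omit hN in
theorem _root_.IsReducedFamily.not_exists_reductionStep {n : ℕ} {c : Fin n → E} (hc : IsReducedFamily k N c) :
    ¬ ∃ d, IsReductionStep k N c d := by
  classical
  rintro ⟨d, i, -, hlt, α, hα, hd⟩
  obtain ⟨a, ha⟩ := exists_sum_of_mem_span_image_compl hα
  have h1 := hc.2 (Function.update (fun j => algebraMap k[X] (RatFunc k) (a j)) i 1)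
  have h2 : ∑ j, Function.update (fun j => algebraMap k[X] (RatFunc k) (a j)) i 1 j • c j =
      d i := by
    rw [← Finset.add_sum_erase _ _ (Finset.mem_univ i), hd, ← ha]
    congr 1
    · simp
    · refine Finset.sum_congr rfl fun j hj => ?_
      rw [Function.update_of_ne (Finset.ne_of_mem_erase hj), algebraMap_smul]
  rw [h2] at h1
  have h3 := Finset.le_sup (f := fun j =>
    N (Function.update (fun j => algebraMap k[X] (RatFunc k) (a j)) i 1 j • c j))
    (Finset.mem_univ i)
  rw [← h1] at h3
  simp only [Function.update_self, one_smul] at h3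
  exact absurd hlt (not_lt.2 h3)

end IsLengthFunction

end Norms

/-! ### Invariants of a reduction step: spans and determinant. -/

theorem span_range_update_add {R M : Type*} [Ring R] [AddCommGroup M] [Module R M] {ι : Type*}
    [DecidableEq ι] (b : ι → M) (i : ι) {α : M} (hα : α ∈ Submodule.span R (b '' {i}ᶜ)) :
    Submodule.span R (Set.range (Function.update b i (b i + α))) =
      Submodule.span R (Set.range b) := by
  have key : ∀ c : ι → M, (∀ j, j ≠ i → c j = b j) → b '' {i}ᶜ ⊆ Set.range c := by
    rintro c hc _ ⟨j, hj, rfl⟩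
    exact ⟨j, hc j hj⟩
  have hα1 := Submodule.span_mono (R := R) (key b fun _ _ => rfl) hα
  have hα2 := Submodule.span_mono (R := R)
    (key (Function.update b i (b i + α)) fun j hj => Function.update_of_ne hj _ _) hα
  apply le_antisymm <;> rw [Submodule.span_le] <;> rintro _ ⟨j, rfl⟩
  · by_cases hj : j = i
    · subst hj
      rw [Function.update_self]
      exact add_mem (Submodule.subset_span ⟨j, rfl⟩) hα1
    · rw [Function.update_of_ne hj]
      exact Submodule.subset_span ⟨j, rfl⟩
  · by_cases hj : j = i
    · subst hj
      have h := sub_mem (Submodule.subset_span (R := R)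
        (Set.mem_range_self (f := Function.update b j (b j + α)) j)) hα2
      rwa [Function.update_self, add_sub_cancel_right] at h
    · exact Submodule.subset_span ⟨j, Function.update_of_ne hj _ _⟩

section ReductionStep

variable {k : Type u} [Field k] {E : Type v} [AddCommGroup E] [Module k[X] E]
  [Module (RatFunc k) E] [IsScalarTower k[X] (RatFunc k) E] {N : E → WithBot ℝ} {n : ℕ}
  {c d : Fin n → E}

theorem mem_span_ratFunc_of_mem_span {s : Set E} {x : E} (hx : x ∈ Submodule.span k[X] s) :
    x ∈ Submodule.span (RatFunc k) s :=
  Submodule.span_subset_span k[X] (RatFunc k) s hx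

omit [Module (RatFunc k) E] [IsScalarTower k[X] (RatFunc k) E] in
theorem IsReductionStep.exists_eq_update (h : IsReductionStep k N c d) :
    ∃ i, ∃ α ∈ Submodule.span k[X] (c '' {i}ᶜ), d = Function.update c i (c i + α) ∧
      N (c i + α) < N (c i) := by
  obtain ⟨i, h1, h2, α, hα, h3⟩ := h
  refine ⟨i, α, hα, ?_, h3 ▸ h2⟩
  funext j
  by_cases hj : j = i
  · subst hj; simp [h3]
  · rw [Function.update_of_ne hj, h1 j hj]

omit [Module (RatFunc k) E] [IsScalarTower k[X] (RatFunc k) E] in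
theorem IsReductionStep.span_eq (h : IsReductionStep k N c d) :
    Submodule.span k[X] (Set.range d) = Submodule.span k[X] (Set.range c) := by
  obtain ⟨i, α, hα, rfl, -⟩ := h.exists_eq_update
  exact span_range_update_add c i hα

theorem IsReductionStep.span_ratFunc_eq (h : IsReductionStep k N c d) :
    Submodule.span (RatFunc k) (Set.range d) = Submodule.span (RatFunc k) (Set.range c) := by
  obtain ⟨i, α, hα, rfl, -⟩ := h.exists_eq_update
  exact span_range_update_add c i (mem_span_ratFunc_of_mem_span hα)

/-- With the determinant fixed, a loss of volume is a loss of orthogonal defect. Each summand of `α`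
contributes a determinant with a repeated vector. -/
theorem IsReductionStep.det_eq (h : IsReductionStep k N c d)
    (b : Module.Basis (Fin n) (RatFunc k) E) : b.det d = b.det c := by
  obtain ⟨i, α, hα, rfl, -⟩ := h.exists_eq_update
  obtain ⟨a, rfl⟩ := exists_sum_of_mem_span_image_compl (mem_span_ratFunc_of_mem_span hα)
  rw [AlternatingMap.map_update_add, Function.update_eq_self, AlternatingMap.map_update_sum,
    Finset.sum_eq_zero, add_zero]
  intro j hj
  rw [AlternatingMap.map_update_smul, AlternatingMap.map_update_self _ _
    (Finset.ne_of_mem_erase hj).symm, smul_zero]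

end ReductionStep

/-! ### Existence of orthonormal bases. -/

section Existence

theorem intDegree_X_zpow {k : Type u} [Field k] (z : ℤ) :
    (RatFunc.X ^ z : RatFunc k).intDegree = z := by
  have h : ∀ m : ℕ, (RatFunc.X ^ m : RatFunc k).intDegree = m := fun m => by
    rw [← RatFunc.algebraMap_X, ← map_pow, RatFunc.intDegree_polynomial, natDegree_X_pow]
  cases z with
  | ofNat m => rw [Int.ofNat_eq_natCast, zpow_natCast, h]
  | negSucc m => rw [zpow_negSucc, RatFunc.intDegree_inv, h]; rfl

variable {k : Type u} [Field k] {E : Type v} [AddCommGroup E] [Module k E] [Module k[X] E]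
  [Module (RatFunc k) E] [IsScalarTower k (RatFunc k) E] [IsScalarTower k[X] (RatFunc k) E]
  {N : E → WithBot ℝ} {n : ℕ}

-- Constants have degree 0, so taking the `k`-span does not raise the bound on the length. Thus `y`
-- lies in the larger space and not in the smaller one.
omit [IsScalarTower k[X] (RatFunc k) E] in
theorem finrank_sublevel_lt (hN : IsLengthFunction k N) {L : Submodule k[X] E}
    (hL : IsLatticeIn (k := k) N L) {x y : E} (hy : y ∈ L) (hx0 : x ≠ 0) (hy0 : y ≠ 0)
    (h : N x < N y) :
    Module.finrank k (Submodule.span k {z : E | z ∈ L ∧ N z ≤ (realLength N x : WithBot ℝ)}) <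
    Module.finrank k (Submodule.span k {z : E | z ∈ L ∧ N z ≤ (realLength N y : WithBot ℝ)}) := by
  have := hL.finite_le (realLength N y)
  have hlt := h
  rw [hN.coe_realLength hx0, hN.coe_realLength hy0, WithBot.coe_lt_coe] at hlt
  apply Submodule.finrank_lt_finrank_of_lt
  refine lt_of_le_of_ne (Submodule.span_mono fun z hz => ⟨hz.1, hz.2.trans ?_⟩) fun heq => ?_
  · exact_mod_cast hlt.le
  · have h1 : y ∈ Submodule.span k {z : E | z ∈ L ∧ N z ≤ (realLength N x : WithBot ℝ)} := by
      rw [heq]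
      exact Submodule.subset_span ⟨hy, (hN.coe_realLength hy0).le⟩
    have h2 : N y ≤ (realLength N x : WithBot ℝ) := by
      refine Submodule.span_induction (p := fun z _ => N z ≤ (realLength N x : WithBot ℝ))
        (fun z hz => hz.2) (by rw [hN.map_zero]; exact bot_le)
        (fun a b _ _ ha hb => (hN.add_le a b).trans (max_le ha hb)) (fun a z _ hz => ?_) h1
      by_cases ha : a = 0
      · rw [ha, zero_smul, hN.map_zero]; exact bot_le
      · rw [← algebraMap_smul (RatFunc k) a z, IsScalarTower.algebraMap_apply k k[X] (RatFunc k),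
          hN.smul_eq, ratDegree_algebraMap (by simpa using ha)]
        simpa using hz
    rw [hN.coe_realLength hy0, WithBot.coe_le_coe] at h2
    linarith

omit [Module k E] [Module k[X] E] [IsScalarTower k (RatFunc k) E]
  [IsScalarTower k[X] (RatFunc k) E] in
theorem linearIndependent_of_span_eq_top (b : Module.Basis (Fin n) (RatFunc k) E) {c : Fin n → E}
    (hc : Submodule.span (RatFunc k) (Set.range c) = ⊤) : LinearIndependent (RatFunc k) c :=
  linearIndependent_of_top_le_span_of_card_eq_finrank hc.ge
    (Module.finrank_eq_card_basis b).symm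

/-- Lengths are real numbers, so descent on them needs a discrete measure: the dimension of the
sublevel set of the lattice at the length of a vector. A family in the lattice that spans `E` and
minimises the sum of these dimensions admits no reduction step. -/
theorem exists_isReducedFamily (hE : IsNormedSpaceOver k N)
    (b : Module.Basis (Fin n) (RatFunc k) E) :
    ∃ c : Fin n → E, Submodule.span (RatFunc k) (Set.range c) = ⊤ ∧ IsReducedFamily k N c := by
  obtain ⟨L, hspan, hL⟩ := hE.exists_lattice
  have hN := hE.norm
  have hne : {c : Fin n → E | (∀ i, c i ∈ L) ∧
      Submodule.span (RatFunc k) (Set.range c) = ⊤}.Nonempty := by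
    let B := Module.Basis.ofSpan hspan.ge
    let B' := B.reindex (B.indexEquiv b)
    have h : Set.range B' = Set.range B := B.range_reindex _
    refine ⟨B', fun i => Module.Basis.ofSpan_subset hspan.ge ?_, B'.span_eq⟩
    exact h ▸ Set.mem_range_self i
  let φ : (Fin n → E) → ℕ := fun c => ∑ i, Module.finrank k
    (Submodule.span k {z : E | z ∈ L ∧ N z ≤ (realLength N (c i) : WithBot ℝ)})
  obtain ⟨c, ⟨hcL, hcs⟩, hmin⟩ := (measure φ).wf.has_min _ hne
  have h0 := fun i => (linearIndependent_of_span_eq_top b hcs).ne_zero i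
  refine ⟨c, hcs, ?_⟩
  by_contra hred
  obtain ⟨d, hd⟩ := hN.exists_reductionStep h0 hred
  have hds := hd.span_ratFunc_eq.trans hcs
  have hd0 := fun i => (linearIndependent_of_span_eq_top b hds).ne_zero i
  obtain ⟨i, α, hα, rfl, hlt⟩ := hd.exists_eq_update
  have hαL : α ∈ L := by
    refine Submodule.span_le.2 ?_ hα
    rintro _ ⟨j, -, rfl⟩
    exact hcL j
  refine hmin _ ⟨fun j => ?_, hds⟩ ?_
  · by_cases hj : j = i
    · subst hj; rw [Function.update_self]; exact add_mem (hcL j) hαL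
    · rw [Function.update_of_ne hj]; exact hcL j
  · have hi0 := hd0 i
    rw [Function.update_self] at hi0
    change φ _ < φ c
    refine Finset.sum_lt_sum (fun j _ => ?_) ⟨i, Finset.mem_univ i, ?_⟩
    · by_cases hj : j = i
      · subst hj
        rw [Function.update_self]
        exact (finrank_sublevel_lt hN hL (hcL j) hi0 (h0 j) hlt).le
      · rw [Function.update_of_ne hj]
    · rw [Function.update_self]
      exact finrank_sublevel_lt hN hL (hcL i) hi0 (h0 i) hlt

omit [Module k E] [Module k[X] E] [IsScalarTower k (RatFunc k) E]
  [IsScalarTower k[X] (RatFunc k) E] in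
theorem IsReducedFamily.smul_comp {ι : Type w} [Fintype ι] {c : ι → E} (hc : IsReducedFamily k N c)
    {a : ι → RatFunc k} (ha : ∀ i, a i ≠ 0) (σ : Equiv.Perm ι) :
    IsReducedFamily k N fun i => a (σ i) • c (σ i) := by
  refine ⟨fun i => smul_ne_zero (ha _) (hc.1 _), fun e => ?_⟩
  have h := hc.2 fun i => e (σ.symm i) * a i
  rw [← Equiv.sum_comp σ, ← Finset.map_univ_equiv σ, Finset.sup_map] at h
  simpa [mul_smul, Function.comp_def] using h

theorem exists_isOrthonormalBasis (hE : IsNormedSpaceOver k N)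
    (b : Module.Basis (Fin n) (RatFunc k) E) :
    ∃ b' : Module.Basis (Fin n) (RatFunc k) E, IsOrthonormalBasis N b' := by
  obtain ⟨c, hcs, hc⟩ := exists_isReducedFamily hE b
  have hN := hE.norm
  let a : Fin n → RatFunc k := fun i => RatFunc.X ^ (-⌈realLength N (c i)⌉)
  -- The exponent of `t` in `a i` is chosen to move the length of `c i` into `(-1, 0]`.
  have ha : ∀ i, a i ≠ 0 := fun i => zpow_ne_zero _ RatFunc.X_ne_zero
  have hNa : ∀ i, N (a i • c i) =
      ((realLength N (c i) - ⌈realLength N (c i)⌉ : ℝ) : WithBot ℝ) := fun i => by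
    rw [hN.smul_coe (ha i) (hc.1 i), intDegree_X_zpow, WithBot.coe_inj]
    push_cast; ring
  let σ := Tuple.sort fun i => realLength N (c i) - ⌈realLength N (c i)⌉
  let B := Module.Basis.mk (linearIndependent_of_span_eq_top b hcs) hcs.ge
  let B' := (B.unitsSMul fun i => Units.mk0 (a i) (ha i)).reindex σ.symm
  have hB : ∀ i, B' i = a (σ i) • c (σ i) := fun i => by
    simp [B', B, Module.Basis.unitsSMul_apply, Units.smul_def]
  have hB' : (B' : Fin n → E) = fun i => a (σ i) • c (σ i) := funext hB
  refine ⟨B', hB' ▸ hc.smul_comp ha σ, ?_, fun i => ?_, fun i => ?_⟩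
  · intro i j hij
    have := Tuple.monotone_sort (fun i => realLength N (c i) - ⌈realLength N (c i)⌉) hij
    simp only [hB, hNa, WithBot.coe_le_coe]
    exact this
  · rw [hB, hNa, WithBot.coe_lt_coe]
    linarith [Int.ceil_lt_add_one (realLength N (c (σ i)))]
  · rw [hB, hNa, WithBot.coe_le_coe]
    linarith [Int.le_ceil (realLength N (c (σ i)))]

end Existence

/-! ### Lengths in coordinates, Hadamard's inequality and the signature. -/

section Orthonormal

variable {k : Type u} [Field k] {E : Type v} [AddCommGroup E]
  [Module (RatFunc k) E] {N : E → WithBot ℝ} {n : ℕ}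
  {b' : Module.Basis (Fin n) (RatFunc k) E}

theorem IsReducedFamily.exists_realLength_eq (hN : IsLengthFunction k N)
    (hb : IsReducedFamily k N b') {x : E} (hx : x ≠ 0) :
    ∃ j, b'.repr x j ≠ 0 ∧ realLength N x = (b'.repr x j).intDegree + realLength N (b' j) := by
  have h := hb.2 (b'.repr x)
  rw [b'.sum_repr] at h
  have hne : (Finset.univ : Finset (Fin n)).Nonempty := by
    by_contra hcon
    rw [Finset.not_nonempty_iff_eq_empty] at hcon
    rw [hcon, Finset.sup_empty, hN.eq_bot_iff] at h
    exact hx h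
  obtain ⟨j, -, hj⟩ := Finset.exists_mem_eq_sup _ hne fun i => N (b'.repr x i • b' i)
  rw [hj] at h
  have h0 : b'.repr x j ≠ 0 := by
    intro h0
    rw [h0, zero_smul, hN.map_zero, hN.eq_bot_iff] at h
    exact hx h
  refine ⟨j, h0, ?_⟩
  rwa [hN.smul_coe h0 (hb.1 j), hN.coe_realLength hx, WithBot.coe_inj] at h

theorem IsReducedFamily.le_realLength (hN : IsLengthFunction k N)
    (hb : IsReducedFamily k N b') {x : E} {j : Fin n} (hj : b'.repr x j ≠ 0) :
    (b'.repr x j).intDegree + realLength N (b' j) ≤ realLength N x := by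
  have hx : x ≠ 0 := by rintro rfl; simp at hj
  have h := Finset.le_sup (f := fun i => N (b'.repr x i • b' i)) (Finset.mem_univ j)
  rwa [← hb.2 (b'.repr x), b'.sum_repr, hN.smul_coe hj (hb.1 j), hN.coe_realLength hx,
    WithBot.coe_le_coe] at h

theorem intDegree_sum_le {ι : Type*} (s : Finset ι) (f : ι → RatFunc k) {μ : ℝ}
    (h : ∀ i ∈ s, f i ≠ 0 → ((f i).intDegree : ℝ) ≤ μ) :
    ∑ i ∈ s, f i ≠ 0 → ((∑ i ∈ s, f i).intDegree : ℝ) ≤ μ := by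
  refine Finset.sum_induction f (fun x => x ≠ 0 → (x.intDegree : ℝ) ≤ μ) (fun x y hx hy hxy => ?_)
    (fun h => absurd rfl h) h
  by_cases hy0 : y = 0
  · subst hy0; rw [add_zero] at hxy ⊢; exact hx hxy
  by_cases hx0 : x = 0
  · subst hx0; rw [zero_add] at hxy ⊢; exact hy hxy
  have := RatFunc.intDegree_add_le hy0 hxy
  rcases le_max_iff.1 this with h1 | h1
  · exact (Int.cast_le.2 h1).trans (hx hx0)
  · exact (Int.cast_le.2 h1).trans (hy hy0)

theorem intDegree_prod {ι : Type*} (s : Finset ι) (f : ι → RatFunc k) (h : ∀ i ∈ s, f i ≠ 0) :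
    (∏ i ∈ s, f i).intDegree = ∑ i ∈ s, (f i).intDegree := by
  classical
  induction s using Finset.induction_on with
  | empty => simp
  | insert a s ha ih =>
    rw [Finset.prod_insert ha, Finset.sum_insert ha, RatFunc.intDegree_mul
      (h a (Finset.mem_insert_self _ _)) (Finset.prod_ne_zero_iff.2 fun i hi =>
        h i (Finset.mem_insert_of_mem hi)), ih fun i hi => h i (Finset.mem_insert_of_mem hi)]

theorem intDegree_units_smul (e : ℤˣ) (x : RatFunc k) : (e • x).intDegree = x.intDegree := by
  rcases Int.units_eq_one_or e with rfl | rfl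
  · rw [one_smul]
  · rw [Units.neg_smul, one_smul, RatFunc.intDegree_neg]

/-- Hadamard's inequality. -/
theorem IsReducedFamily.intDegree_det_le (hN : IsLengthFunction k N)
    (hb : IsReducedFamily k N b') (c : Fin n → E) (hc : b'.det c ≠ 0) :
    ((b'.det c).intDegree : ℝ) + ∑ j, realLength N (b' j) ≤ ∑ i, realLength N (c i) := by
  rw [← le_sub_iff_add_le]
  set M : Matrix (Fin n) (Fin n) (RatFunc k) := Matrix.of fun i j => b'.repr (c j) i with hM
  have hdet : b'.det c = M.det := b'.det_apply c
  rw [hdet, Matrix.det_apply] at hc ⊢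
  -- It suffices to bound each nonzero term of the Leibniz expansion; its factors are coordinates of
  -- the `c i`, each controlled by the length of `c i`.
  refine intDegree_sum_le _ _ (fun σ _ hσ => ?_) hc
  have h2 : ∏ i, M (σ i) i ≠ 0 := fun h => hσ (by rw [h, smul_zero])
  have h3 : ∀ i, b'.repr (c i) (σ i) ≠ 0 := fun i =>
    Finset.prod_ne_zero_iff.1 h2 i (Finset.mem_univ i)
  rw [intDegree_units_smul, intDegree_prod _ (fun i => M (σ i) i) fun i _ => h3 i,
    le_sub_iff_add_le, ← Equiv.sum_comp σ fun j => realLength N (b' j), Int.cast_sum, ← Finset.sum_add_distrib]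
  exact Finset.sum_le_sum fun i _ => hb.le_realLength hN (h3 i)

theorem det_transitionMatrix (b b' : Module.Basis (Fin n) (RatFunc k) E) :
    (transitionMatrix b b').det = b'.det b := by
  rw [Module.Basis.det_apply, ← Matrix.det_transpose]
  rfl

theorem IsOrthonormalBasis.realLength_mem (hN : IsLengthFunction k N)
    (hb : IsOrthonormalBasis N b') (j : Fin n) :
    -1 < realLength N (b' j) ∧ realLength N (b' j) ≤ 0 := by
  have h1 := hb.lower j
  have h2 := hb.upper j
  rw [hN.coe_realLength (hb.reduced.1 j)] at h1 h2
  exact ⟨WithBot.coe_lt_coe.1 h1, WithBot.coe_le_coe.1 h2⟩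

theorem eq_of_sub_eq_int {x y : ℝ} (hx : -1 < x ∧ x ≤ 0) (hy : -1 < y ∧ y ≤ 0) {z : ℤ}
    (h : x = y + z) : x = y := by
  have h1 : ((-1 : ℤ) : ℝ) < z := by push_cast; linarith
  have h2 : (z : ℝ) < (1 : ℤ) := by push_cast; linarith
  have h3 : z = 0 := by have := Int.cast_lt.1 h1; have := Int.cast_lt.1 h2; omega
  rw [h, h3]; simp

/-- Lengths of orthonormal vectors lie in an interval of length 1 that contains only one of its
endpoints, so distinct ones stay distinct modulo `ℤ`. The signature can thus be counted by real
representatives. -/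
theorem IsOrthonormalBasis.ncard_signature (hN : IsLengthFunction k N)
    (hb : IsOrthonormalBasis N b') :
    (signature N).ncard = (Finset.univ.image fun j => realLength N (b' j)).card := by
  have h : signature N = (fun ρ : ℝ => (ρ : UnitAddCircle)) ''
      (Finset.univ.image fun j => realLength N (b' j) : Finset ℝ) := by
    ext ρ
    constructor
    · rintro ⟨x, hx, rfl⟩
      obtain ⟨j, -, hj⟩ := hb.reduced.exists_realLength_eq hN hx
      refine ⟨_, by simp only [Finset.coe_image]; exact ⟨j, by simp, rfl⟩, ?_⟩
      rw [hj]
      rw [AddCircle.coe_add]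
      have : ((((b'.repr x) j).intDegree : ℝ) : UnitAddCircle) = 0 := by
        rw [AddCircle.coe_eq_zero_iff]
        exact ⟨_, by simp; rfl⟩
      rw [this, zero_add]
    · simp only [Finset.coe_image]
      rintro ⟨_, ⟨j, -, rfl⟩, rfl⟩
      exact ⟨b' j, hb.reduced.1 j, rfl⟩
  rw [h, Set.InjOn.ncard_image, Set.ncard_coe_finset]
  intro x hx y hy hxy
  simp only [Finset.coe_image] at hx hy
  obtain ⟨i, -, rfl⟩ := hx
  obtain ⟨j, -, rfl⟩ := hy
  have h2 := sub_eq_zero.2 hxy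
  rw [← AddCircle.coe_sub, AddCircle.coe_eq_zero_iff] at h2
  obtain ⟨z, hz⟩ := h2
  refine eq_of_sub_eq_int (hb.realLength_mem hN i) (hb.realLength_mem hN j) (z := z) ?_
  simp at hz
  dsimp only
  linarith

end Orthonormal

/-! ### Counting reduction steps by the index of lengths. -/

section StepCount

/-- The number of elements of `R + ℤ` that are at most `v`, up to normalization. -/
def classIndex (R : Finset ℝ) (v : ℝ) : ℤ := ∑ ρ ∈ R, (⌊v - ρ⌋ + 1)

/-- The value `w` belongs to `R + ℤ` itself, so the floor for its own class jumps strictly on the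
way from `v` to `w`. -/
theorem classIndex_lt {R : Finset ℝ} {v w : ℝ} (h : v < w) (hw : ∃ ρ ∈ R, ∃ z : ℤ, w = z + ρ) :
    classIndex R v + 1 ≤ classIndex R w := by
  obtain ⟨ρ, hρ, z, rfl⟩ := hw
  refine Int.add_one_le_iff.2 (Finset.sum_lt_sum (fun σ _ => ?_) ⟨ρ, hρ, ?_⟩)
  · have := Int.floor_le_floor (sub_le_sub_right h.le σ)
    omega
  · have h1 : ⌊v - ρ⌋ < z := Int.floor_lt.2 (by linarith)
    have h2 : ⌊(z : ℝ) + ρ - ρ⌋ = z := by rw [add_sub_cancel_right, Int.floor_intCast]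
    omega

/-- For the class of `v` the difference of the floors is exactly `⌊w - v⌋`. For each of the
remaining `R.card - 1` classes it is larger by at most 1. -/
theorem classIndex_sub_le {R : Finset ℝ} {v w : ℝ} (hv : ∃ ρ ∈ R, ∃ z : ℤ, v = z + ρ) :
    classIndex R w - classIndex R v ≤ R.card * ⌊w - v⌋ + (R.card - 1) := by
  classical
  obtain ⟨ρ, hρ, z, rfl⟩ := hv
  have h1 : classIndex R w - classIndex R (z + ρ) =
      ∑ σ ∈ R, (⌊w - σ⌋ - ⌊(z : ℝ) + ρ - σ⌋) := by
    simp only [classIndex]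
    rw [← Finset.sum_sub_distrib]
    exact Finset.sum_congr rfl fun σ _ => by ring
  have h2 : ∀ σ ∈ R, ⌊w - σ⌋ - ⌊(z : ℝ) + ρ - σ⌋ ≤
      ⌊w - (z + ρ)⌋ + (if σ = ρ then 0 else 1) := by
    intro σ _
    split_ifs with h
    · subst h
      have h3 : ⌊(z : ℝ) + σ - σ⌋ = z := by rw [add_sub_cancel_right, Int.floor_intCast]
      have h4 : w - (z + σ) = w - σ - z := by ring
      rw [h3, h4, Int.floor_sub_intCast]
      omega
    · have h5 : w - σ = ((z : ℝ) + ρ - σ) + (w - (z + ρ)) := by ring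
      have h6 := Int.le_floor_add_floor ((z : ℝ) + ρ - σ) (w - (z + ρ))
      rw [← h5] at h6
      omega
  rw [h1]
  refine (Finset.sum_le_sum h2).trans (le_of_eq ?_)
  rw [Finset.sum_add_distrib, Finset.sum_const, Finset.sum_ite, Finset.sum_const_zero, zero_add,
    Finset.sum_const, Finset.filter_ne', Finset.card_erase_of_mem hρ]
  have : 1 ≤ R.card := Finset.card_pos.2 ⟨ρ, hρ⟩
  simp [Nat.cast_sub this]

variable {k : Type u} [Field k] {E : Type v} [AddCommGroup E] [Module k[X] E]
  [Module (RatFunc k) E] [IsScalarTower k[X] (RatFunc k) E]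
  {N : E → WithBot ℝ} {n : ℕ}

omit [Module (RatFunc k) E] [IsScalarTower k[X] (RatFunc k) E] in
theorem ReductionChain.span_eq {b : Fin n → E} {m : ℕ} {c : Fin n → E}
    (h : ReductionChain k N b m c) :
    Submodule.span k[X] (Set.range c) = Submodule.span k[X] (Set.range b) := by
  induction h with
  | refl => rfl
  | step _ hs ih => exact hs.span_eq.trans ih

theorem ReductionChain.span_ratFunc_eq {b : Fin n → E} {m : ℕ} {c : Fin n → E}
    (h : ReductionChain k N b m c) :
    Submodule.span (RatFunc k) (Set.range c) = Submodule.span (RatFunc k) (Set.range b) := by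
  induction h with
  | refl => rfl
  | step _ hs ih => exact hs.span_ratFunc_eq.trans ih

theorem ReductionChain.det_eq {b : Fin n → E} {m : ℕ} {c : Fin n → E}
    (h : ReductionChain k N b m c) (b' : Module.Basis (Fin n) (RatFunc k) E) :
    b'.det c = b'.det b := by
  induction h with
  | refl => rfl
  | step _ hs ih => exact (hs.det_eq b').trans ih

theorem ReductionChain.linearIndependent {b : Module.Basis (Fin n) (RatFunc k) E} {m : ℕ}
    {c : Fin n → E} (h : ReductionChain k N b m c) : LinearIndependent (RatFunc k) c :=
  linearIndependent_of_span_eq_top b (h.span_ratFunc_eq.trans b.span_eq)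

omit [Module k[X] E] [IsScalarTower k[X] (RatFunc k) E] in
theorem IsReducedFamily.exists_class (hN : IsLengthFunction k N)
    {b' : Module.Basis (Fin n) (RatFunc k) E} (hb : IsReducedFamily k N b')
    {x : E} (hx : x ≠ 0) : ∃ ρ ∈ Finset.univ.image fun j => realLength N (b' j), ∃ z : ℤ,
      realLength N x = z + ρ := by
  obtain ⟨j, -, hj⟩ := hb.exists_realLength_eq hN hx
  exact ⟨_, Finset.mem_image_of_mem _ (Finset.mem_univ j), _, hj⟩

theorem ReductionChain.le_classIndex (hN : IsLengthFunction k N)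
    {b b' : Module.Basis (Fin n) (RatFunc k) E} (hb : IsReducedFamily k N b') {m : ℕ}
    {c : Fin n → E} (h : ReductionChain k N b m c) :
    (m : ℤ) ≤ ∑ i, (classIndex (Finset.univ.image fun j => realLength N (b' j))
        (realLength N (b i)) -
      classIndex (Finset.univ.image fun j => realLength N (b' j)) (realLength N (c i))) := by
  induction h with
  | refl => simp
  | @step m c d hc hs ih =>
    have hd := (hc.step hs).linearIndependent
    have hc := hc.linearIndependent
    obtain ⟨i, α, -, rfl, hlt⟩ := hs.exists_eq_update
    have hi := hd.ne_zero i
    rw [Function.update_self] at hi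
    rw [hN.coe_realLength hi, hN.coe_realLength (hc.ne_zero i), WithBot.coe_lt_coe] at hlt
    have hlt' := classIndex_lt hlt (hb.exists_class hN (hc.ne_zero i))
    rw [← Finset.add_sum_erase _ _ (Finset.mem_univ i)] at ih ⊢
    have h2 : ∀ j ∈ Finset.univ.erase i, Function.update c i (c i + α) j = c j := fun j hj =>
      Function.update_of_ne (Finset.ne_of_mem_erase hj) _ _
    rw [Finset.sum_congr rfl fun j hj => by rw [h2 j hj], Function.update_self]
    push_cast
    linarith

/-- This is Hadamard's inequality for `c`, with the determinant of `c` replaced by the equal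
determinant of `b`. -/
theorem orthogonalDefect_sub (hN : IsLengthFunction k N)
    (h : ∃ b' : Module.Basis (Fin n) (RatFunc k) E, IsOrthonormalBasis N b')
    {b : Module.Basis (Fin n) (RatFunc k) E} {m : ℕ}
    {c : Fin n → E} (hc : ReductionChain k N b m c) :
    ∑ i, (realLength N (b i) - realLength N (c i)) ≤ orthogonalDefect N b := by
  have hdet := hc.det_eq h.choose
  have hne : h.choose.det c ≠ 0 := by
    rw [hdet]; exact (h.choose.isUnit_det b).ne_zero
  have h1 := h.choose_spec.reduced.intDegree_det_le hN c hne
  rw [orthogonalDefect, spaceVolume, detDegree, dif_pos h, dif_pos h, det_transitionMatrix,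
    basisVolume, basisVolume, Finset.sum_sub_distrib]
  rw [hdet] at h1
  linarith

end StepCount

section StepBound

variable {k : Type u} [Field k] {E : Type v} [AddCommGroup E] [Module k E] [Module k[X] E]
  [Module (RatFunc k) E] [IsScalarTower k (RatFunc k) E] [IsScalarTower k[X] (RatFunc k) E]
  {N : E → WithBot ℝ} {n : ℕ}

theorem ReductionChain.length_le (hE : IsNormedSpaceOver k N)
    {b : Module.Basis (Fin n) (RatFunc k) E} {m : ℕ} {c : Fin n → E}
    (h : ReductionChain k N b m c) :
    (m : ℤ) ≤ ((signature N).ncard : ℤ) * ⌊orthogonalDefect N b⌋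
      + (((signature N).ncard : ℤ) - 1) * n := by
  have hN := hE.norm
  obtain ⟨b', hb'⟩ := exists_isOrthonormalBasis hE b
  rw [hb'.ncard_signature hN]
  set R := Finset.univ.image fun j => realLength N (b' j)
  have hc := h.linearIndependent
  calc (m : ℤ) ≤ ∑ i, (classIndex R (realLength N (b i)) - classIndex R (realLength N (c i))) :=
        h.le_classIndex hN hb'.reduced
    _ ≤ ∑ i, ((R.card : ℤ) * ⌊realLength N (b i) - realLength N (c i)⌋ + ((R.card : ℤ) - 1)) :=
        Finset.sum_le_sum fun i _ =>
          classIndex_sub_le (hb'.reduced.exists_class hN (hc.ne_zero i))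
    _ = (R.card : ℤ) * ∑ i, ⌊realLength N (b i) - realLength N (c i)⌋ + ((R.card : ℤ) - 1) * n := by
        rw [Finset.sum_add_distrib, ← Finset.mul_sum]
        simp only [Finset.sum_const, Finset.card_univ, Fintype.card_fin, nsmul_eq_mul]
        ring
    _ ≤ _ := by
        -- The sum of the floors is an integer below the real defect, hence below its floor.
        have h1 : ∑ i, ⌊realLength N (b i) - realLength N (c i)⌋ ≤ ⌊orthogonalDefect N b⌋ := by
          rw [Int.le_floor, Int.cast_sum]
          exact (Finset.sum_le_sum fun i _ => Int.floor_le _).trans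
            (orthogonalDefect_sub hN ⟨b', hb'⟩ h)
        have := mul_le_mul_of_nonneg_left h1 (Nat.cast_nonneg (α := ℤ) R.card)
        linarith

omit [IsScalarTower k (RatFunc k) E] in
theorem ReductionChain.not_exists_step_iff (hE : IsNormedSpaceOver k N)
    {b : Module.Basis (Fin n) (RatFunc k) E} {m : ℕ} {c : Fin n → E}
    (h : ReductionChain k N b m c) :
    (¬ ∃ d, IsReductionStep k N c d) ↔ IsReducedBasisOfSpan (k := k) N b c := by
  have hN := hE.norm
  have hc := h.linearIndependent
  refine ⟨fun hd => ⟨?_, hc.restrict_scalars' k[X], h.span_eq⟩,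
    fun hr => hr.1.not_exists_reductionStep⟩
  by_contra hred
  exact hd (hN.exists_reductionStep (fun i => hc.ne_zero i) hred)

/-- If no chain ended in a reduced basis, every chain could be prolonged, against the bound on the
length. -/
theorem exists_reductionChain (hE : IsNormedSpaceOver k N)
    (b : Module.Basis (Fin n) (RatFunc k) E) :
    ∃ (m : ℕ) (c : Fin n → E), ReductionChain k N b m c ∧
      IsReducedBasisOfSpan (k := k) N b c := by
  by_contra! hcon
  have h : ∀ m : ℕ, ∃ c, ReductionChain k N b m c := by
    intro m
    induction m with
    | zero => exact ⟨b, .refl⟩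
    | succ m ih =>
      obtain ⟨c, hc⟩ := ih
      have := hcon m c hc
      rw [← hc.not_exists_step_iff hE, not_not] at this
      obtain ⟨d, hd⟩ := this
      exact ⟨d, hc.step hd⟩
  obtain ⟨c, hc⟩ := h ((((signature N).ncard : ℤ) * ⌊orthogonalDefect N b⌋
      + (((signature N).ncard : ℤ) - 1) * n).toNat + 1)
  have := hc.length_le hE
  push_cast at this
  have := Int.self_le_toNat (((signature N).ncard : ℤ) * ⌊orthogonalDefect N b⌋
      + (((signature N).ncard : ℤ) - 1) * n)
  omega

end StepBound

/-! ### Values and costs of the counted loops. -/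

namespace Counted

theorem traverse_val {α : Type u} {β : Type v} (f : α → Counted β) (l : List α) :
    (traverse f l).val = l.map fun a => (f a).val := by
  induction l with
  | nil => rfl
  | cons a l ih => simp only [traverse, bind, pure, ih, List.map_cons]

theorem traverse_ops_le {α : Type u} {β : Type v} (f : α → Counted β) (l : List α) {B : ℕ}
    (h : ∀ a ∈ l, (f a).ops ≤ B) : (traverse f l).ops ≤ l.length * B := by
  induction l with
  | nil => simp [traverse, pure]
  | cons a l ih =>
    have h1 := ih fun b hb => h b (List.mem_cons_of_mem _ hb)
    have h2 := h a List.mem_cons_self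
    simp only [traverse, bind, pure, List.length_cons]
    rw [add_mul, one_mul]
    omega

theorem forLoop_cons {α : Type u} {σ : Type v} (f : σ → α → Counted σ) (a : α) (l : List α)
    (s : σ) : (forLoop f (a :: l) s).val = (forLoop f l (f s a).val).val ∧
      (forLoop f (a :: l) s).ops = (f s a).ops + (forLoop f l (f s a).val).ops := ⟨rfl, rfl⟩

end Counted

/-! ### Gaussian elimination: invariant and cost. -/

section Echelon

variable {k : Type u} [Field k] {ι : Type v} {κ : Type w}

theorem findPivot_none {c : κ} {l : List (EchelonRow k ι κ)} (h : (findPivot c l).val = none) :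
    ∀ x ∈ l, x.val c = 0 := by
  induction l with
  | nil => simp
  | cons a l ih =>
    by_cases ha : a.val c = 0
    · simp only [findPivot, Counted.bind, kIsZero, ha, decide_true, if_true, Counted.pure,
        Option.map_eq_none_iff] at h
      intro x hx
      rcases List.mem_cons.1 hx with rfl | hx
      · exact ha
      · exact ih h x hx
    · simp [findPivot, Counted.bind, kIsZero, ha, Counted.pure] at h

theorem findPivot_some {c : κ} {l pre post : List (EchelonRow k ι κ)} {x : EchelonRow k ι κ}
    (h : (findPivot c l).val = some (pre, x, post)) :
    l = pre ++ x :: post ∧ x.val c ≠ 0 ∧ ∀ y ∈ pre, y.val c = 0 := by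
  induction l generalizing pre with
  | nil => simp [findPivot, Counted.pure] at h
  | cons a l ih =>
    by_cases ha : a.val c = 0
    · simp only [findPivot, Counted.bind, kIsZero, ha, decide_true, if_true, Counted.pure,
        Option.map_eq_some_iff] at h
      obtain ⟨⟨pre', x', post'⟩, h1, h2⟩ := h
      simp only [Prod.mk.injEq] at h2
      obtain ⟨rfl, rfl, rfl⟩ := h2
      obtain ⟨rfl, hx, hpre⟩ := ih h1
      refine ⟨rfl, hx, fun y hy => ?_⟩
      rcases List.mem_cons.1 hy with rfl | hy
      · exact ha
      · exact hpre y hy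
    · simp only [findPivot, Counted.bind, kIsZero, ha, decide_false, Counted.pure,
        Bool.false_eq_true, if_false, Option.some.injEq, Prod.mk.injEq] at h
      obtain ⟨rfl, rfl, rfl⟩ := h
      exact ⟨rfl, ha, by simp⟩

theorem findPivot_ops_le (c : κ) (l : List (EchelonRow k ι κ)) :
    (findPivot c l).ops ≤ l.length := by
  induction l with
  | nil => simp [findPivot, Counted.pure]
  | cons a l ih =>
    by_cases ha : a.val c = 0
    · simp only [findPivot, Counted.bind, kIsZero, ha, decide_true, if_true, Counted.pure,
        List.length_cons]
      omega
    · simp [findPivot, Counted.bind, kIsZero, ha, Counted.pure]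

variable [Fintype ι] [Fintype κ]

theorem clearRow_coef (c : κ) (x : EchelonRow k ι κ) (d : k) (y : EchelonRow k ι κ) :
    (clearRow c x d y).val.coef = y.coef + (-(y.val c * d)) • x.coef := rfl

theorem clearRow_val (c : κ) (x : EchelonRow k ι κ) (d : k) (y : EchelonRow k ι κ) :
    (clearRow c x d y).val.val = y.val + (-(y.val c * d)) • x.val := rfl

theorem clearRow_ops (c : κ) (x : EchelonRow k ι κ) (d : k) (y : EchelonRow k ι κ) :
    (clearRow c x d y).ops = 2 + 2 * Fintype.card ι + 2 * Fintype.card κ := by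
  simp only [clearRow, Counted.bind, Counted.pi, kMul, kNeg, kAdd, Counted.pure,
    Finset.sum_const, Finset.card_univ, smul_eq_mul]
  ring

theorem eliminate_ops_le (cs : List κ) (done rest : List (EchelonRow k ι κ)) :
    (eliminate cs done rest).ops ≤
      cs.length * (rest.length * (4 + 2 * Fintype.card ι + 2 * Fintype.card κ)) := by
  induction cs generalizing done rest with
  | nil => simp [eliminate, Counted.pure]
  | cons c cs ih =>
    set F := 2 + 2 * Fintype.card ι + 2 * Fintype.card κ with hF
    have hF' : 4 + 2 * Fintype.card ι + 2 * Fintype.card κ = F + 2 := by omega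
    rw [hF', List.length_cons, add_mul, one_mul]
    rw [hF'] at ih
    have hfp := findPivot_ops_le c rest
    rw [eliminate, Counted.bind]
    rcases hval : (findPivot c rest).val with _ | ⟨pre, x, post⟩
    · have := ih done rest
      simp only
      have h2 : rest.length ≤ rest.length * (F + 2) := Nat.le_mul_of_pos_right _ (by omega)
      omega
    · obtain ⟨hrest, -, -⟩ := findPivot_some hval
      have hlen : rest.length = pre.length + (post.length + 1) := by rw [hrest]; simp
      have h1 := Counted.traverse_ops_le (clearRow c x (x.val c)⁻¹) post (B := F)
        fun y _ => (clearRow_ops _ _ _ _).le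
      have h2 := ih (done ++ [x]) (pre ++ (Counted.traverse (clearRow c x (x.val c)⁻¹) post).val)
      rw [Counted.traverse_val, List.length_append, List.length_map] at h2
      have h3 : cs.length * ((pre.length + post.length) * (F + 2)) ≤
          cs.length * (rest.length * (F + 2)) :=
        Nat.mul_le_mul_left _ (Nat.mul_le_mul_right _ (by omega))
      -- The two extra operations per remaining row pay for the pivot search and for the single
      -- inversion.
      have h4 : post.length * F + rest.length * 2 ≤ rest.length * (F + 2) := by
        have : post.length * F ≤ rest.length * F := Nat.mul_le_mul_right _ (by omega)
        rw [mul_add rest.length F 2]; omega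
      simp only [Counted.bind, kInv, Counted.traverse_val]
      omega

/-- The state of a row during Gaussian elimination: it is the original row `i` plus a combination
of the pivot rows with indices in `I` before `i`, and it vanishes on the columns in `D`. -/
structure IsEliminated [LT ι] (M : Matrix ι κ k) (I : Finset ι) (D : Set κ) (i : ι)
    (y : EchelonRow k ι κ) : Prop where
  coef_self : y.coef i = 1
  coef_support : ∀ j, y.coef j ≠ 0 → j = i ∨ (j ∈ I ∧ j < i)
  val_eq : y.val = Matrix.vecMul y.coef M
  val_zero : ∀ c ∈ D, y.val c = 0

/-- The invariant of Gaussian elimination. `I` is the set of pivot rows, `P` lists the remaining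
rows together with their original indices, `D` is the set of columns done so far. -/
structure EliminationInv [LT ι] (M : Matrix ι κ k) (D : Set κ) (I : Finset ι)
    (P : List (ι × EchelonRow k ι κ)) : Prop where
  rows : ∀ q ∈ P, IsEliminated M I D q.1 q.2
  sorted : (P.map Prod.fst).Pairwise (· < ·)
  mem_iff : ∀ i, i ∈ P.map Prod.fst ↔ i ∉ I
  indep : ∀ a : ι → k, (∀ i ∉ I, a i = 0) → (∀ c ∈ D, Matrix.vecMul a M c = 0) → a = 0

/-- Clearing a column adds to later rows a multiple of the pivot row only. Their coefficient vectors
therefore keep the 1 at their own index and acquire support only in pivot indices before it; this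
triangular shape is what later allows the rows of `T` to be replaced one after another. -/
theorem EliminationInv.pivot [LinearOrder ι] {M : Matrix ι κ k} {D : Set κ} {I : Finset ι}
    {P₁ P₂ : List (ι × EchelonRow k ι κ)} {i : ι} {x : EchelonRow k ι κ} {c : κ}
    (h : EliminationInv M D I (P₁ ++ (i, x) :: P₂)) (hx : x.val c ≠ 0)
    (hpre : ∀ q ∈ P₁, q.2.val c = 0) :
    EliminationInv M (insert c D) (insert i I)
      (P₁ ++ P₂.map fun q => (q.1, (clearRow c x (x.val c)⁻¹ q.2).val)) := by
  have hfst : (P₁ ++ P₂.map fun q => (q.1, (clearRow c x (x.val c)⁻¹ q.2).val)).map Prod.fst =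
      P₁.map Prod.fst ++ P₂.map Prod.fst := by simp
  have hs := h.sorted
  rw [List.map_append, List.map_cons, List.pairwise_append, List.pairwise_cons] at hs
  obtain ⟨hs₁, ⟨hs₂, hs₃⟩, hs₄⟩ := hs
  have hx' : IsEliminated M I D i x := h.rows (i, x) (by simp)
  constructor
  · intro q hq
    rcases List.mem_append.1 hq with hq | hq
    · have hq' := h.rows q (List.mem_append_left _ hq)
      exact ⟨hq'.coef_self, fun j hj => (hq'.coef_support j hj).imp_right fun h =>
          ⟨Finset.mem_insert_of_mem h.1, h.2⟩, hq'.val_eq,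
        fun d hd => (Set.mem_insert_iff.1 hd).elim (fun h => h ▸ hpre q hq) (hq'.val_zero d)⟩
    · obtain ⟨q, hqP, rfl⟩ := List.mem_map.1 hq
      have hq' := h.rows q (by simp [hqP])
      have hiq : i < q.1 := hs₂ _ (List.mem_map_of_mem hqP)
      constructor
      · dsimp only
        rw [clearRow_coef]
        -- The pivot row involves only indices up to `i`, and `i` comes before `q.1`.
        have : x.coef q.1 = 0 := by
          by_contra h0
          rcases hx'.coef_support _ h0 with h1 | h1
          · exact hiq.ne' h1
          · exact lt_asymm hiq h1.2
        simp [hq'.coef_self, this]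
      · intro j hj
        dsimp only at hj ⊢
        rw [clearRow_coef] at hj
        by_cases h0 : q.2.coef j = 0
        · have h1 : x.coef j ≠ 0 := fun h1 => hj (by simp [h0, h1])
          rcases hx'.coef_support j h1 with rfl | h2
          · exact Or.inr ⟨Finset.mem_insert_self _ _, hiq⟩
          · exact Or.inr ⟨Finset.mem_insert_of_mem h2.1, h2.2.trans hiq⟩
        · exact (hq'.coef_support j h0).imp_right fun h => ⟨Finset.mem_insert_of_mem h.1, h.2⟩
      · dsimp only
        rw [clearRow_coef, clearRow_val, Matrix.add_vecMul, Matrix.smul_vecMul, ← hq'.val_eq,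
          ← hx'.val_eq]
      · intro d hd
        dsimp only
        rw [clearRow_val]
        rcases Set.mem_insert_iff.1 hd with rfl | hd
        · simp [hx]
        · simp [hq'.val_zero d hd, hx'.val_zero d hd]
  · rw [hfst, List.pairwise_append]
    exact ⟨hs₁, hs₃, fun a ha b hb => hs₄ a ha b (List.mem_cons_of_mem _ hb)⟩
  · intro j
    have hj := h.mem_iff j
    rw [hfst]
    rw [List.map_append, List.map_cons, List.mem_append, List.mem_cons] at hj
    rw [List.mem_append, Finset.mem_insert, not_or, ← hj]
    constructor
    · rintro (h1 | h1)
      · exact ⟨(hs₄ j h1 i List.mem_cons_self).ne, Or.inl h1⟩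
      · exact ⟨(hs₂ j h1).ne', Or.inr (Or.inr h1)⟩
    · rintro ⟨h1, h2 | h2 | h2⟩
      · exact Or.inl h2
      · exact absurd h2 h1
      · exact Or.inr h2
  · intro a ha hD
    -- Subtracting this multiple removes the new index `i` from the support, so the independence
    -- known for `I` and `D` applies. The new column `c`, where `x` does not vanish, then forces `a
    -- i = 0`.
    have h1 : a - a i • x.coef = 0 := by
      refine h.indep _ (fun j hj => ?_) fun d hd => ?_
      · by_cases hji : j = i
        · subst hji; simp [hx'.coef_self]
        · have h2 : a j = 0 := ha j fun h => (Finset.mem_insert.1 h).elim hji hj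
          have h3 : x.coef j = 0 := by
            by_contra h0
            exact (hx'.coef_support j h0).elim hji fun h => hj h.1
          simp [h2, h3]
      · rw [Matrix.sub_vecMul, Matrix.smul_vecMul, ← hx'.val_eq]
        simp [hD d (Set.mem_insert_of_mem _ hd), hx'.val_zero d hd]
    have h2 := hD c (Set.mem_insert _ _)
    rw [sub_eq_zero.1 h1, Matrix.smul_vecMul, ← hx'.val_eq] at h2
    have h3 : a i = 0 := by simpa [hx] using h2
    rw [sub_eq_zero.1 h1, h3, zero_smul]

theorem eliminate_inv [LinearOrder ι] {M : Matrix ι κ k} (cs : List κ)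
    (done : List (EchelonRow k ι κ)) {D : Set κ} {I : Finset ι}
    {P : List (ι × EchelonRow k ι κ)} (h : EliminationInv M D I P) (hd : done.length = I.card) :
    ∃ I' P', EliminationInv M ({c | c ∈ cs} ∪ D) I' P' ∧
      (eliminate cs done (P.map Prod.snd)).val.2 = P'.map Prod.snd ∧
      (eliminate cs done (P.map Prod.snd)).val.1.length = I'.card := by
  induction cs generalizing done D I P with
  | nil => exact ⟨I, P, by simpa using h, rfl, hd⟩
  | cons c cs ih =>
    have hset : {d | d ∈ c :: cs} ∪ D = {d | d ∈ cs} ∪ insert c D := by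
      ext d; simp; tauto
    rw [eliminate, Counted.bind]
    rcases hval : (findPivot c (P.map Prod.snd)).val with _ | ⟨pre, x, post⟩
    · have h0 := findPivot_none hval
      rw [hset]
      refine ih done ⟨fun q hq => ?_, h.sorted, h.mem_iff, fun a ha hD => ?_⟩ hd
      · have hq' := h.rows q hq
        exact ⟨hq'.coef_self, hq'.coef_support, hq'.val_eq, fun d hd =>
          (Set.mem_insert_iff.1 hd).elim (fun h => h ▸ h0 _ (List.mem_map_of_mem hq))
            (hq'.val_zero d)⟩
      · exact h.indep a ha fun d hd => hD d (Set.mem_insert_of_mem _ hd)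
    · obtain ⟨hP, hx, hpre⟩ := findPivot_some hval
      obtain ⟨P₁, P₂', rfl, rfl, hP₂⟩ := List.map_eq_append_iff.1 hP
      obtain ⟨⟨i, x'⟩, P₂, rfl, rfl, rfl⟩ := List.map_eq_cons_iff.1 hP₂
      have hnew := h.pivot hx fun q hq => hpre _ (List.mem_map_of_mem hq)
      have hi : i ∉ I := (h.mem_iff i).1 (by simp)
      rw [hset]
      have := ih (done ++ [x']) hnew (by simp [hd, hi])
      simpa [Counted.bind, kInv, Counted.traverse_val, Function.comp_def] using this

theorem rowEchelon_spec [LinearOrder ι] [LinearOrder κ] (M : Matrix ι κ k) :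
    ∃ I P, EliminationInv M Set.univ I P ∧ (rowEchelon M).val.2 = P.map Prod.snd ∧
      (rowEchelon M).val.1.length = I.card := by
  classical
  set P : List (ι × EchelonRow k ι κ) := ((Finset.univ : Finset ι).sort (· ≤ ·)).map fun i =>
    (i, ⟨Pi.single i 1, M i⟩) with hP
  have hfst : P.map Prod.fst = (Finset.univ : Finset ι).sort (· ≤ ·) := by
    rw [hP, List.map_map]; exact List.map_id _
  have h : EliminationInv M ∅ ∅ P := by
    refine ⟨fun q hq => ?_, ?_, fun i => ?_, fun a ha _ => funext fun i => ha i (by simp)⟩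
    · obtain ⟨i, -, rfl⟩ := List.mem_map.1 hq
      refine ⟨by simp, fun j hj => Or.inl ?_, ?_, by simp⟩
      · by_contra hji
        exact hj (Pi.single_eq_of_ne hji _)
      · dsimp only
        rw [Matrix.single_one_vecMul]; rfl
    · rw [hfst]; exact Finset.sortedLT_sort _ |>.pairwise
    · rw [hfst]; simp
  have := eliminate_inv ((Finset.univ : Finset κ).sort (· ≤ ·)) [] h rfl
  have hset : ({c | c ∈ (Finset.univ : Finset κ).sort (· ≤ ·)} ∪ ∅ : Set κ) = Set.univ := by
    ext; simp
  rw [hset] at this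
  convert this using 6
  all_goals
    rw [rowEchelon, hP, List.map_map]
    congr!

theorem rowEchelon_ops_le [LinearOrder ι] [LinearOrder κ] (M : Matrix ι κ k) :
    (rowEchelon M).ops ≤ Fintype.card κ * (Fintype.card ι *
      (4 + 2 * Fintype.card ι + 2 * Fintype.card κ)) := by
  refine (eliminate_ops_le _ _ _).trans ?_
  simp

theorem lastNonzero_ops [LinearOrder ι] (p : ι → k) : (lastNonzero p).ops = Fintype.card ι := by
  simp [lastNonzero, Counted.bind, Counted.pi, kIsZero, Counted.pure]

theorem lastNonzero_val [LinearOrder ι] {p : ι → k} {i : ι} (hi : p i ≠ 0)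
    (h : ∀ j, p j ≠ 0 → j ≤ i) : (lastNonzero p).val = some i := by
  classical
  change (if h : (Finset.univ.filter fun i => decide (p i = 0) = false).Nonempty then
    some (Finset.max' _ h) else none) = some i
  rw [dif_pos ⟨i, by simpa using hi⟩, Option.some_inj]
  refine le_antisymm (Finset.max'_le _ _ _ fun j hj => h j ?_) (Finset.le_max' _ _ ?_)
  · simpa using hj
  · simpa using hi

end Echelon

/-! ### Row operations on polynomial matrices and their cost. -/

namespace Counted

theorem forLoop_val_add {α : Type u} {σ : Type v} [AddCommMonoid σ] (f : σ → α → Counted σ)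
    (g : α → σ) (h : ∀ s a, (f s a).val = s + g a) (l : List α) (s : σ) :
    (forLoop f l s).val = s + (l.map g).sum := by
  induction l generalizing s with
  | nil => simp [forLoop, pure]
  | cons a l ih => rw [(forLoop_cons f a l s).1, ih, h, List.map_cons, List.sum_cons, add_assoc]

theorem forLoop_ops_le {α : Type u} {σ : Type v} (f : σ → α → Counted σ) {B : ℕ} (l : List α)
    (h : ∀ s, ∀ a ∈ l, (f s a).ops ≤ B) (s : σ) : (forLoop f l s).ops ≤ l.length * B := by
  induction l generalizing s with
  | nil => simp [forLoop, pure]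
  | cons a l ih =>
    have h1 := ih (fun s b hb => h s b (List.mem_cons_of_mem _ hb)) (f s a).val
    have h2 := h s a List.mem_cons_self
    rw [(forLoop_cons f a l s).2, List.length_cons, add_mul, one_mul]
    omega

end Counted

section PolynomialOps

variable {k : Type u} [Field k]

theorem addScaledShift_val (p : k[X]) (c : k) (m : ℕ) (q : k[X]) :
    (addScaledShift p c m q).val = p + C c * X ^ m * q := by
  rw [addScaledShift, Counted.forLoop_val_add _ fun i => monomial (i + m) (c * q.coeff i)]
  · congr 1
    rw [← List.sum_toFinset _ List.nodup_range, List.toFinset_range]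
    conv_rhs => rw [q.as_sum_range_C_mul_X_pow, Finset.mul_sum]
    refine Finset.sum_congr rfl fun i _ => ?_
    rw [← C_mul_X_pow_eq_monomial, C_mul, pow_add]
    ring
  · intro s i
    simp only [Counted.bind, kMul, kAdd, kIsZero, Counted.pure]
    ext j
    by_cases h : s.coeff (i + m) + c * q.coeff i = 0
    · simp only [h, decide_true, if_true, coeff_erase, coeff_add, coeff_monomial]
      by_cases hj : j = i + m
      · subst hj; simp [h]
      · simp [hj, Ne.symm hj]
    · simp only [h, decide_false, Bool.false_eq_true, if_false, coeff_update_apply, coeff_add,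
        coeff_monomial]
      by_cases hj : j = i + m
      · subst hj; simp
      · simp [hj, Ne.symm hj]

theorem addScaledShift_ops_le (p : k[X]) (c : k) (m : ℕ) (q : k[X]) :
    (addScaledShift p c m q).ops ≤ (q.natDegree + 1) * 3 := by
  refine (Counted.forLoop_ops_le (B := 3) _ _ (fun s a _ => ?_) _).trans (by simp)
  simp [Counted.bind, kMul, kAdd, kIsZero, Counted.pure]

variable {n : ℕ}

theorem addScaledShiftRow_val (v : Fin n → k[X]) (c : k) (m : ℕ) (w : Fin n → k[X]) :
    (addScaledShiftRow v c m w).val = v + (C c * X ^ m) • w :=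
  funext fun j => addScaledShift_val (v j) c m (w j)

theorem addScaledShiftRow_ops_le (v : Fin n → k[X]) (c : k) (m : ℕ) (w : Fin n → k[X]) {H : ℕ}
    (h : ∀ j, (w j).natDegree ≤ H) : (addScaledShiftRow v c m w).ops ≤ n * ((H + 1) * 3) := by
  calc (addScaledShiftRow v c m w).ops = ∑ j, (addScaledShift (v j) c m (w j)).ops := rfl
    _ ≤ ∑ _j : Fin n, (H + 1) * 3 := Finset.sum_le_sum fun j _ =>
      (addScaledShift_ops_le _ _ _ _).trans (Nat.mul_le_mul_right 3 (Nat.succ_le_succ (h j)))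
    _ = n * ((H + 1) * 3) := by simp

variable {ι : Type} [Fintype ι] [LinearOrder ι]

theorem reduceRow_val (r : Fin n → ℝ) (e : ι → Fin n) (T : Matrix (Fin n) (Fin n) k[X])
    (p : ι → k) (u : ι) : (reduceRow r e T p u).val = Function.update T (e u) (T (e u) +
      ∑ j ∈ Finset.univ.filter (· < u),
        (C (p j) * X ^ (⌈rowLength r (T (e u))⌉ - ⌈rowLength r (T (e j))⌉).toNat) • T (e j)) := by
  simp only [reduceRow, Counted.bind, Counted.pure]
  congr 1
  rw [Counted.forLoop_val_add _ (fun j => (C (p j) *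
    X ^ (⌈rowLength r (T (e u))⌉ - ⌈rowLength r (T (e j))⌉).toNat) • T (e j))
    fun s j => addScaledShiftRow_val _ _ _ _,
    ← List.sum_toFinset _ (Finset.sort_nodup _ _), Finset.sort_toFinset]

theorem reduceRow_val_self (r : Fin n → ℝ) (e : ι → Fin n) (T : Matrix (Fin n) (Fin n) k[X])
    (p : ι → k) (u : ι) : (reduceRow r e T p u).val (e u) = T (e u) +
      ∑ j ∈ Finset.univ.filter (· < u),
        (C (p j) * X ^ (⌈rowLength r (T (e u))⌉ - ⌈rowLength r (T (e j))⌉).toNat) • T (e j) :=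
  (congr_fun (reduceRow_val r e T p u) _).trans (Function.update_self _ _ _)

theorem reduceRow_val_of_ne (r : Fin n → ℝ) (e : ι → Fin n) (T : Matrix (Fin n) (Fin n) k[X])
    (p : ι → k) {u : ι} {i : Fin n} (hi : i ≠ e u) : (reduceRow r e T p u).val i = T i :=
  (congr_fun (reduceRow_val r e T p u) _).trans (Function.update_of_ne hi _ _)

theorem reduceRow_ops_le (r : Fin n → ℝ) (e : ι → Fin n) (T : Matrix (Fin n) (Fin n) k[X])
    (p : ι → k) (u : ι) {H : ℕ} (h : ∀ i j, (T i j).natDegree ≤ H) :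
    (reduceRow r e T p u).ops ≤ Fintype.card ι * (n * ((H + 1) * 3)) := by
  simp only [reduceRow, Counted.bind, Counted.pure, add_zero]
  refine (Counted.forLoop_ops_le _ _
    (fun s j _ => addScaledShiftRow_ops_le _ _ _ _ fun i => h (e j) i) _).trans
    (Nat.mul_le_mul_right _ ?_)
  rw [Finset.length_sort]
  exact Finset.card_le_univ _

end PolynomialOps

/-! ### Determinants and the lattice spanned by the rows. -/

section RowSpan

variable {R : Type u} [CommRing R] {n : ℕ}

theorem det_dvd_det_of_mem_span {T T' : Matrix (Fin n) (Fin n) R}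
    (h : ∀ i, T' i ∈ Submodule.span R (Set.range T)) : T.det ∣ T'.det := by
  choose U hU using fun i => (Submodule.mem_span_range_iff_exists_fun R).1 (h i)
  have : T' = Matrix.of U * T := by
    ext i j
    rw [Matrix.mul_apply, ← hU i]
    simp
  rw [this, Matrix.det_mul]
  exact dvd_mul_left _ _

theorem det_dvd_det_of_span_eq {T T' : Matrix (Fin n) (Fin n) R}
    (h : Submodule.span R (Set.range T') = Submodule.span R (Set.range T)) : T.det ∣ T'.det :=
  det_dvd_det_of_mem_span fun i => h ▸ Submodule.subset_span (Set.mem_range_self i)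

theorem det_ne_zero_of_span_eq {T T' : Matrix (Fin n) (Fin n) R} (hT : T.det ≠ 0)
    (h : Submodule.span R (Set.range T') = Submodule.span R (Set.range T)) : T'.det ≠ 0 := by
  intro h0
  have := det_dvd_det_of_span_eq h.symm
  rw [h0, zero_dvd_iff] at this
  exact hT this

theorem row_ne_zero {T : Matrix (Fin n) (Fin n) R} (hT : T.det ≠ 0) (i : Fin n) : T i ≠ 0 :=
  fun h => hT (Matrix.det_eq_zero_of_row_eq_zero i fun j => by rw [h]; rfl)

/-- The two determinants divide each other. The degree of the determinant is thus an invariant of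
the lattice, the fixed floor below which no degree sum can fall. -/
theorem natDegree_det_eq_of_span_eq {k : Type u} [Field k] {T T' : Matrix (Fin n) (Fin n) k[X]}
    (h : Submodule.span k[X] (Set.range T') = Submodule.span k[X] (Set.range T)) :
    T'.det.natDegree = T.det.natDegree :=
  natDegree_eq_of_degree_eq (degree_eq_degree_of_associated
    (associated_of_dvd_dvd (det_dvd_det_of_span_eq h.symm) (det_dvd_det_of_span_eq h)))

end RowSpan

/-! ### Length and degree of a row. -/

section RowLength

variable {k : Type u} [Field k] {n : ℕ} {r : Fin n → ℝ} {v w : Fin n → k[X]}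

/-- The maximal degree of the coordinates of a row. -/
def rowDegree (v : Fin n → k[X]) : ℕ := Finset.univ.sup fun j => (v j).natDegree

theorem natDegree_le_rowDegree (v : Fin n → k[X]) (j : Fin n) : (v j).natDegree ≤ rowDegree v :=
  Finset.le_sup (f := fun j => (v j).natDegree) (Finset.mem_univ j)

theorem degree_map_eq {p : k[X]} (hp : p ≠ 0) (x : ℝ) :
    (p.degree.map fun d : ℕ => (d : ℝ) + x : WithBot ℝ) = ((p.natDegree + x : ℝ) : WithBot ℝ) := by
  rw [degree_eq_natDegree hp]; rfl

theorem sup_degree_eq_rowLength (hv : v ≠ 0) :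
    (Finset.univ.sup fun j => (v j).degree.map fun d : ℕ => (d : ℝ) + r j : WithBot ℝ) =
      (rowLength r v : WithBot ℝ) := by
  obtain ⟨j, hj⟩ := Function.ne_iff.1 hv
  have h := Finset.le_sup (f := fun j => ((v j).degree.map fun d : ℕ => (d : ℝ) + r j : WithBot ℝ))
    (Finset.mem_univ j)
  rw [degree_map_eq hj] at h
  obtain ⟨x, hx⟩ := WithBot.ne_bot_iff_exists.1 (ne_bot_of_le_ne_bot WithBot.coe_ne_bot h)
  rw [rowLength, ← hx]; rfl

theorem exists_rowLength_eq (r : Fin n → ℝ) (hv : v ≠ 0) :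
    ∃ j, v j ≠ 0 ∧ rowLength r v = (v j).natDegree + r j := by
  have h := sup_degree_eq_rowLength (r := r) hv
  obtain ⟨i, -⟩ := Function.ne_iff.1 hv
  obtain ⟨j, -, hj⟩ := Finset.exists_mem_eq_sup Finset.univ ⟨i, Finset.mem_univ i⟩
    fun j => ((v j).degree.map fun d : ℕ => (d : ℝ) + r j : WithBot ℝ)
  rw [h] at hj
  have h0 : v j ≠ 0 := by
    intro h0
    rw [h0] at hj
    exact WithBot.coe_ne_bot hj
  rw [degree_map_eq h0, WithBot.coe_inj] at hj
  exact ⟨j, h0, hj⟩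

theorem natDegree_add_le_rowLength (r : Fin n → ℝ) {j : Fin n} (hj : v j ≠ 0) :
    (v j).natDegree + r j ≤ rowLength r v := by
  have hv : v ≠ 0 := fun h => hj (by rw [h]; rfl)
  have h := Finset.le_sup (f := fun j => ((v j).degree.map fun d : ℕ => (d : ℝ) + r j : WithBot ℝ))
    (Finset.mem_univ j)
  rwa [degree_map_eq hj, sup_degree_eq_rowLength hv, WithBot.coe_le_coe] at h

theorem le_rowLength_of_coeff_ne_zero (r : Fin n → ℝ) {j : Fin n} {i : ℕ}
    (h : (v j).coeff i ≠ 0) : i + r j ≤ rowLength r v := by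
  have hj : v j ≠ 0 := fun h0 => h (by rw [h0, coeff_zero])
  have h1 : (i : ℝ) ≤ (v j).natDegree := by exact_mod_cast le_natDegree_of_ne_zero h
  linarith [natDegree_add_le_rowLength r hj]

theorem rowLength_lt_of_coeff (r : Fin n → ℝ) (hv : v ≠ 0) {x : ℝ}
    (h : ∀ j i, (v j).coeff i ≠ 0 → i + r j < x) : rowLength r v < x := by
  obtain ⟨j, hj, hl⟩ := exists_rowLength_eq r hv
  rw [hl]
  exact h j _ (leadingCoeff_ne_zero.2 hj)

variable (hr : ∀ j, -1 < r j ∧ r j ≤ 0)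
include hr

/-- The weights `r j` differ by less than 1, so an entry that attains the length also has maximal
degree. The length splits into a natural number and a class in `(-1, 0]`. -/
theorem exists_rowLength_eq_rowDegree (hv : v ≠ 0) :
    ∃ j, v j ≠ 0 ∧ (v j).natDegree = rowDegree v ∧ rowLength r v = rowDegree v + r j := by
  obtain ⟨j, hj, hl⟩ := exists_rowLength_eq r hv
  have h : rowDegree v ≤ (v j).natDegree := by
    refine Finset.sup_le fun i _ => ?_
    by_cases hi : v i = 0
    · rw [hi]; simp
    have h1 := natDegree_add_le_rowLength r hi
    have h2 : ((v i).natDegree : ℝ) < (v j).natDegree + 1 := by linarith [(hr i).1, (hr j).2]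
    exact Nat.lt_succ_iff.1 (by exact_mod_cast h2)
  have h' := le_antisymm (natDegree_le_rowDegree v j) h
  exact ⟨j, hj, h', by rw [hl, h']⟩

theorem ceil_rowLength (hv : v ≠ 0) : ⌈rowLength r v⌉ = rowDegree v := by
  obtain ⟨j, -, -, hl⟩ := exists_rowLength_eq_rowDegree hr hv
  rw [hl, Int.ceil_eq_iff]
  push_cast
  constructor <;> linarith [(hr j).1, (hr j).2]

theorem leadCoeffAt_rowLength (hv : v ≠ 0) (p : k[X]) :
    leadCoeffAt (rowLength r v) p = p.coeff (rowDegree v) := by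
  rw [leadCoeffAt, ceil_rowLength hr hv, Int.toNat_natCast]

theorem rowDegree_le_of_rowLength_le (hv : v ≠ 0) (hw : w ≠ 0)
    (h : rowLength r v ≤ rowLength r w) : rowDegree v ≤ rowDegree w := by
  have := Int.ceil_le_ceil h
  rw [ceil_rowLength hr hv, ceil_rowLength hr hw] at this
  exact_mod_cast this

theorem congModInt_rowLength_iff (hv : v ≠ 0) {x : ℝ} (hx : -1 < x ∧ x ≤ 0) :
    CongModInt (rowLength r v) x ↔ rowLength r v = rowDegree v + x := by
  constructor
  · rintro ⟨z, hz⟩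
    obtain ⟨j, -, -, hl⟩ := exists_rowLength_eq_rowDegree hr hv
    rw [hl]
    congr 1
    refine eq_of_sub_eq_int (hr j) hx (z := z - rowDegree v) ?_
    push_cast
    linarith
  · intro h
    exact ⟨rowDegree v, by rw [h]; push_cast; ring⟩

end RowLength

/-! ### Shortening the rows of one class. -/

section ProcessRows

variable {k : Type u} [Field k] {n : ℕ} {r : Fin n → ℝ} {ι : Type} [Fintype ι] [LinearOrder ι]
  {κ : Type} [Fintype κ] {e : ι → Fin n} {g : κ → Fin n} {x : ℝ}
  {T : Matrix (Fin n) (Fin n) k[X]} {M : Matrix ι κ k}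

/-- The rows `e i` of `T` have length `x` modulo `ℤ` and are sorted, the columns `g j` comprise
those with `r j = x`, and `M` is the matrix of the leading coefficients. -/
structure IsLeadingBlock (r : Fin n → ℝ) (T : Matrix (Fin n) (Fin n) k[X]) (x : ℝ)
    (e : ι → Fin n) (g : κ → Fin n) (M : Matrix ι κ k) : Prop where
  bounds : ∀ j, -1 < r j ∧ r j ≤ 0
  det_ne_zero : T.det ≠ 0
  bounds' : -1 < x ∧ x ≤ 0
  injective : Function.Injective e
  sorted : ∀ i j, i < j → rowLength r (T (e i)) ≤ rowLength r (T (e j))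
  rowLength_eq : ∀ i, rowLength r (T (e i)) = rowDegree (T (e i)) + x
  col_iff : ∀ j, r j = x ↔ ∃ c, g c = j
  entry : ∀ i j, M i j = (T (e i) (g j)).coeff (rowDegree (T (e i)))

/-- `T'` arises from `T` by shortening the rows `e u` for `u ∈ U`. -/
structure IsShortened (r : Fin n → ℝ) (T : Matrix (Fin n) (Fin n) k[X]) (e : ι → Fin n)
    (U : Set ι) (T' : Matrix (Fin n) (Fin n) k[X]) : Prop where
  unchanged : ∀ i, (∀ u ∈ U, e u ≠ i) → T' i = T i
  span_eq : Submodule.span k[X] (Set.range T') = Submodule.span k[X] (Set.range T)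
  lt : ∀ u ∈ U, rowLength r (T' (e u)) < rowLength r (T (e u))

omit [Fintype κ] [LinearOrder ι] [Fintype ι] in
theorem IsShortened.rowLength_le {U : Set ι} {T' : Matrix (Fin n) (Fin n) k[X]}
    (h : IsShortened r T e U T') (i : Fin n) : rowLength r (T' i) ≤ rowLength r (T i) := by
  by_cases hi : ∀ u ∈ U, e u ≠ i
  · rw [h.unchanged i hi]
  · push Not at hi
    obtain ⟨u, hu, rfl⟩ := hi
    exact (h.lt u hu).le

-- The shifts bring all participating rows to the length of row `u`. At that length only columns
-- with `r j = x` can have a coefficient, and there it is an entry of `p M`, which vanishes. The sum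
-- must be assumed nonzero because the zero row has length 0 by convention.
omit [Fintype κ] in
theorem IsLeadingBlock.rowLength_combination_lt (h : IsLeadingBlock r T x e g M) {p : ι → k}
    {u : ι} (hu : p u = 1) (hp : ∀ j, p j ≠ 0 → j ≤ u) (hM : Matrix.vecMul p M = 0)
    (h0 : T (e u) + ∑ j ∈ Finset.univ.filter (· < u),
      (C (p j) * X ^ (⌈rowLength r (T (e u))⌉ - ⌈rowLength r (T (e j))⌉).toNat) • T (e j) ≠ 0) :
    rowLength r (T (e u) + ∑ j ∈ Finset.univ.filter (· < u),
      (C (p j) * X ^ (⌈rowLength r (T (e u))⌉ - ⌈rowLength r (T (e j))⌉).toNat) • T (e j)) <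
      rowLength r (T (e u)) := by
  have hne := fun i => row_ne_zero h.det_ne_zero (e i)
  set d : ι → ℕ := fun j => rowDegree (T (e u)) - rowDegree (T (e j)) with hd
  have hdle : ∀ j, j ≤ u → rowDegree (T (e j)) ≤ rowDegree (T (e u)) := fun j hj => by
    rcases hj.eq_or_lt with rfl | hj
    · exact le_rfl
    · exact rowDegree_le_of_rowLength_le h.bounds (hne j) (hne u) (h.sorted j u hj)
  have hrow : T (e u) + ∑ j ∈ Finset.univ.filter (· < u),
      (C (p j) * X ^ (⌈rowLength r (T (e u))⌉ - ⌈rowLength r (T (e j))⌉).toNat) • T (e j) =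
      ∑ j, (C (p j) * X ^ d j) • T (e j) := by
    rw [← Finset.add_sum_erase _ _ (Finset.mem_univ u)]
    congr 1
    · simp [hd, hu]
    · have hsub : Finset.univ.filter (· < u) ⊆ Finset.univ.erase u := fun j hj => by
        simpa using (Finset.mem_filter.1 hj).2.ne
      rw [← Finset.sum_subset hsub]
      · refine Finset.sum_congr rfl fun j hj => ?_
        rw [ceil_rowLength h.bounds (hne u), ceil_rowLength h.bounds (hne j)]
        congr 3
        simp only [hd]
        omega
      · intro j hj hj'
        have : p j = 0 := by
          by_contra hpj
          exact hj' (Finset.mem_filter.2 ⟨Finset.mem_univ _,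
            lt_of_le_of_ne (hp j hpj) (Finset.ne_of_mem_erase hj)⟩)
        simp [this]
  rw [hrow] at h0 ⊢
  refine rowLength_lt_of_coeff r h0 fun j i hij => ?_
  have hcoeff : ((∑ a, (C (p a) * X ^ d a) • T (e a)) j).coeff i =
      ∑ a, p a * (if d a ≤ i then (T (e a) j).coeff (i - d a) else 0) := by
    rw [Finset.sum_apply, finsetSum_coeff]
    refine Finset.sum_congr rfl fun a _ => ?_
    rw [Pi.smul_apply, smul_eq_mul, mul_assoc, coeff_C_mul, coeff_X_pow_mul']
  rw [hcoeff] at hij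
  -- No shifted summand is longer than row `u`; only equality remains to be excluded.
  have hle : (i : ℝ) + r j ≤ rowLength r (T (e u)) := by
    obtain ⟨a, -, ha⟩ := Finset.exists_ne_zero_of_sum_ne_zero hij
    have hpa : p a ≠ 0 := left_ne_zero_of_mul ha
    have hda : d a ≤ i := by
      by_contra hcon
      simp [hcon] at ha
    rw [if_pos hda] at ha
    have h1 := le_rowLength_of_coeff_ne_zero r (right_ne_zero_of_mul ha)
    rw [h.rowLength_eq a, Nat.cast_sub hda] at h1
    have h2 : (d a : ℝ) = rowDegree (T (e u)) - rowDegree (T (e a)) := by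
      rw [hd]; exact Nat.cast_sub (hdle a (hp a hpa))
    rw [h.rowLength_eq u]
    linarith
  refine lt_of_le_of_ne hle fun heq => hij ?_
  rw [h.rowLength_eq u] at heq
  -- Equal lengths with `r j` and `x` both in `(-1, 0]` force the same class and hence the same
  -- exponent.
  have hjx : r j = x := by
    refine eq_of_sub_eq_int (h.bounds j) h.bounds' (z := rowDegree (T (e u)) - i) ?_
    push_cast
    linarith
  have hi : i = rowDegree (T (e u)) := by
    rw [hjx] at heq
    have : (i : ℝ) = rowDegree (T (e u)) := by linarith
    exact_mod_cast this
  obtain ⟨c, rfl⟩ := (h.col_iff j).1 hjx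
  have h3 := congr_fun hM c
  rw [Matrix.vecMul, dotProduct] at h3
  rw [Pi.zero_apply] at h3
  rw [← h3]
  refine Finset.sum_congr rfl fun a _ => ?_
  by_cases hpa : p a = 0
  · simp [hpa]
  have h4 := hdle a (hp a hpa)
  rw [h.entry, if_pos (by simp only [hd]; omega)]
  congr 2
  simp only [hd]
  omega

-- Besides row `u`, the relation uses only pivot rows, and these are never in `U`. So the current
-- matrix `T'` agrees with the original `T` on every row that matters, and relations computed for
-- `T` stay valid during the loop.
omit [Fintype κ] in
theorem IsLeadingBlock.reduceRow (h : IsLeadingBlock r T x e g M) {I : Finset ι} {U : Set ι}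
    (hUI : ∀ u ∈ U, u ∉ I) {T' : Matrix (Fin n) (Fin n) k[X]} (hT' : IsShortened r T e U T')
    {u : ι} (hu : u ∉ U) {y : EchelonRow k ι κ} (hy : IsEliminated M I Set.univ u y) :
    IsShortened r T e (insert u U) (reduceRow r e T' y.coef u).val := by
  have hsame : ∀ j, j ∉ U → T' (e j) = T (e j) := fun j hj =>
    hT'.unchanged _ fun v hv hvj => hj (h.injective hvj ▸ hv)
  have hspan : Submodule.span k[X] (Set.range (_root_.reduceRow r e T' y.coef u).val) =
      Submodule.span k[X] (Set.range T') := by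
    rw [reduceRow_val]
    refine span_range_update_add _ _ (Submodule.sum_mem _ fun j hj => Submodule.smul_mem _ _
      (Submodule.subset_span ⟨e j, ?_, rfl⟩))
    exact fun hje => (Finset.mem_filter.1 hj).2.ne (h.injective hje)
  refine ⟨fun i hi => ?_, hspan.trans hT'.span_eq, fun v hv => ?_⟩
  · rw [reduceRow_val_of_ne _ _ _ _ (hi u (Set.mem_insert _ _)).symm]
    exact hT'.unchanged i fun v hv => hi v (Set.mem_insert_of_mem _ hv)
  · by_cases hvu : v = u
    · subst hvu
      have hne := row_ne_zero (det_ne_zero_of_span_eq h.det_ne_zero (hspan.trans hT'.span_eq)) (e v)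
      rw [reduceRow_val_self] at hne ⊢
      have hrow : T' (e v) + ∑ j ∈ Finset.univ.filter (· < v), (C (y.coef j) *
          X ^ (⌈rowLength r (T' (e v))⌉ - ⌈rowLength r (T' (e j))⌉).toNat) • T' (e j) =
          T (e v) + ∑ j ∈ Finset.univ.filter (· < v), (C (y.coef j) *
          X ^ (⌈rowLength r (T (e v))⌉ - ⌈rowLength r (T (e j))⌉).toNat) • T (e j) := by
        rw [hsame v hu]
        congr 1
        refine Finset.sum_congr rfl fun j hj => ?_
        by_cases hyj : y.coef j = 0
        · simp [hyj]
        · rcases hy.coef_support j hyj with rfl | hj'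
          · simp at hj
          · rw [hsame j fun hjU => hUI j hjU hj'.1]
      rw [hrow] at hne ⊢
      refine h.rowLength_combination_lt hy.coef_self (fun j hj => ?_) ?_ hne
      · exact (hy.coef_support j hj).elim le_of_eq fun h => h.2.le
      · rw [← hy.val_eq]
        exact funext fun c => hy.val_zero c trivial
    · have hvU : v ∈ U := (Set.mem_insert_iff.1 hv).resolve_left hvu
      rw [reduceRow_val_of_ne _ _ _ _ fun h' => hvu (h.injective h')]
      exact hT'.lt v hvU

end ProcessRows

/-! ### Loop invariants and the list of pending classes. -/

section Loop

/-- The loop ignores the labels in the first component. They let the invariant record which rows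
have been treated, and their distinctness ensures that each row is treated once. -/
theorem Counted.forLoop_induction {α β : Type*} {σ : Type v} {f : σ → β → Counted σ}
    {Inv : σ → Set α → Prop} {B : ℕ} (P : List (α × β)) (hP : (P.map Prod.fst).Nodup)
    (step : ∀ q ∈ P, ∀ s U, q.1 ∉ U → Inv s U →
      Inv (f s q.2).val (insert q.1 U) ∧ (f s q.2).ops ≤ B)
    {U : Set α} (hU : ∀ q ∈ P, q.1 ∉ U) {s : σ} (h : Inv s U) :
    Inv (forLoop f (P.map Prod.snd) s).val ({u | u ∈ P.map Prod.fst} ∪ U) ∧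
      (forLoop f (P.map Prod.snd) s).ops ≤ P.length * B := by
  induction P generalizing U s with
  | nil => simpa [forLoop, pure] using h
  | cons q P ih =>
    rw [List.map_cons, List.nodup_cons] at hP
    obtain ⟨h1, h2⟩ := step q List.mem_cons_self s U (hU q List.mem_cons_self) h
    have hU' : ∀ p ∈ P, p.1 ∉ insert q.1 U := fun p hp hpU => by
      rcases Set.mem_insert_iff.1 hpU with h5 | h5
      · exact hP.1 (h5 ▸ List.mem_map_of_mem hp)
      · exact hU p (List.mem_cons_of_mem _ hp) h5
    obtain ⟨h3, h4⟩ := ih hP.2 (fun p hp => step p (List.mem_cons_of_mem _ hp)) hU' h1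
    rw [List.map_cons, (forLoop_cons _ _ _ _).1, (forLoop_cons _ _ _ _).2]
    refine ⟨?_, ?_⟩
    · convert h3 using 1
      ext u; simp [or_assoc]
    · rw [List.length_cons, add_mul, one_mul]; omega

theorem drop_appendPending {pos : ℕ} {vals : List ℝ} (h : pos < vals.length) (x : ℝ) :
    (appendPending pos vals x).drop (pos + 1) =
      vals.drop (pos + 1) ++ if x ∈ vals.drop (pos + 1) then [] else [x] := by
  rw [appendPending]
  split_ifs
  · simp
  · rw [List.drop_append_of_le_length h]

theorem nodup_drop_appendPending {pos : ℕ} {vals : List ℝ} (h : pos < vals.length) (x : ℝ)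
    (hnd : (vals.drop (pos + 1)).Nodup) : ((appendPending pos vals x).drop (pos + 1)).Nodup := by
  rw [drop_appendPending h]
  split_ifs with hx
  · simpa using hnd
  · refine List.nodup_append.2 ⟨hnd, List.nodup_singleton x, fun a ha b hb hab => hx ?_⟩
    rwa [← List.mem_singleton.1 hb, ← hab]

theorem mem_drop_appendPending {pos : ℕ} {vals : List ℝ} (h : pos < vals.length) {x y : ℝ} :
    y ∈ (appendPending pos vals x).drop (pos + 1) ↔ y ∈ vals.drop (pos + 1) ∨ y = x := by
  rw [drop_appendPending h]
  split_ifs with hx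
  · simp only [List.append_nil]
    exact ⟨Or.inl, fun h => h.elim id fun h => h ▸ hx⟩
  · simp

theorem length_le_appendPending (pos : ℕ) (vals : List ℝ) (x : ℝ) :
    vals.length ≤ (appendPending pos vals x).length := by
  rw [appendPending]
  split_ifs <;> simp

end Loop

/-! ### Classes of rows and the effect of one pass. -/

section Classes

variable {k : Type u} [Field k] {n : ℕ} {r : Fin n → ℝ} {T T' : Matrix (Fin n) (Fin n) k[X]}
  {ρ : ℝ}

/-- The rows of length `ρ` modulo `ℤ`. -/
def classRows (r : Fin n → ℝ) (T : Matrix (Fin n) (Fin n) k[X]) (ρ : ℝ) : Set (Fin n) :=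
  {i | rowLength r (T i) = rowDegree (T i) + ρ}

/-- The leading coefficients of the rows in `S`, in the columns with `r j = ρ`, are linearly
independent. -/
def LeadIndep (r : Fin n → ℝ) (T : Matrix (Fin n) (Fin n) k[X]) (S : Set (Fin n)) (ρ : ℝ) : Prop :=
  ∀ a : Fin n → k, (∀ i, a i ≠ 0 → i ∈ S) →
    (∀ j, r j = ρ → ∑ i, a i * (T i j).coeff (rowDegree (T i)) = 0) → a = 0

/-- The rows of length `ρ` modulo `ℤ` have independent leading coefficients. -/
def ClassIndep (r : Fin n → ℝ) (T : Matrix (Fin n) (Fin n) k[X]) (ρ : ℝ) : Prop :=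
  LeadIndep r T (classRows r T ρ) ρ

theorem LeadIndep.mono {S S' : Set (Fin n)} (h : LeadIndep r T S' ρ) (hS : S ⊆ S') :
    LeadIndep r T S ρ := fun a ha => h a fun i hi => hS (ha i hi)

theorem LeadIndep.congr {S : Set (Fin n)} (h : LeadIndep r T S ρ) (hS : ∀ i ∈ S, T' i = T i) :
    LeadIndep r T' S ρ := by
  intro a ha hj
  refine h a ha fun j hjρ => ?_
  rw [← hj j hjρ]
  refine Finset.sum_congr rfl fun i _ => ?_
  by_cases hi : a i = 0
  · simp [hi]
  · rw [hS i (ha i hi)]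

theorem ClassIndep.perm (h : ClassIndep r T ρ) (σ : Equiv.Perm (Fin n)) :
    ClassIndep r (fun i => T (σ i)) ρ := by
  intro a ha hj
  have := h (fun i => a (σ.symm i)) (fun i hi => by simpa [classRows] using ha _ hi) fun j hjρ => by
    rw [← hj j hjρ, ← Equiv.sum_comp σ]
    simp
  funext i
  simpa using congr_fun this (σ i)

theorem classIndep_perm_iff (σ : Equiv.Perm (Fin n)) :
    ClassIndep r (fun i => T (σ i)) ρ ↔ ClassIndep r T ρ :=
  ⟨fun h => by simpa using h.perm σ.symm, fun h => h.perm σ⟩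

/-- The result of processing the class `x` of a matrix with sorted rows: the rows in `U` were
shortened, and the list of pending classes has changed from `Q` to `Q'`. -/
structure IsPass (r : Fin n → ℝ) (T T' : Matrix (Fin n) (Fin n) k[X]) (x : ℝ) (Q Q' : List ℝ)
    (U : Finset (Fin n)) : Prop where
  unchanged : ∀ i ∉ U, T' i = T i
  mem_class : ∀ i ∈ U, i ∈ classRows r T x
  lt : ∀ i ∈ U, rowLength r (T' i) < rowLength r (T i)
  pending : ∀ i ∈ U, ∃ ρ ∈ Q', i ∈ classRows r T' ρ
  span_eq : Submodule.span k[X] (Set.range T') = Submodule.span k[X] (Set.range T)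
  indep : LeadIndep r T {i | i ∉ U ∧ i ∈ classRows r T x} x
  dep : U.Nonempty → ¬ ClassIndep r T x
  nodup : Q'.Nodup
  mem_range : ∀ ρ ∈ Q', ρ ∈ Set.range r
  exists_append : ∃ S, Q' = Q ++ S
  eq_of_empty : U = ∅ → (Finset.univ.filter fun j => r j = x).card ≤ (classRows r T x).ncard → Q' = Q

end Classes

/-! ### From the elimination invariant to independence and dependence of leading coefficients. -/

section Block

variable {k : Type u} [Field k] {n : ℕ} {r : Fin n → ℝ} {ι : Type} [Fintype ι] [LinearOrder ι]
  {κ : Type} [Fintype κ] {e : ι → Fin n} {g : κ → Fin n} {x : ℝ}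
  {T : Matrix (Fin n) (Fin n) k[X]} {M : Matrix ι κ k}

omit [Fintype κ] in
theorem IsLeadingBlock.leadIndep (h : IsLeadingBlock r T x e g M) {I : Finset ι}
    {P : List (ι × EchelonRow k ι κ)} (hP : EliminationInv M Set.univ I P) {S : Set (Fin n)}
    (hS : ∀ i ∈ S, ∃ j ∈ I, e j = i) : LeadIndep r T S x := by
  intro a ha hj
  have hout : ∀ i, (∀ j ∈ I, e j ≠ i) → a i = 0 := fun i hi => by
    by_contra h0
    obtain ⟨j, hj, rfl⟩ := hS i (ha i h0)
    exact hi j hj rfl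
  have h1 : (fun j => a (e j)) = 0 := by
    refine hP.indep _ (fun j hjI => hout _ fun j' hj' heq => hjI (h.injective heq ▸ hj'))
      fun c _ => ?_
    rw [← hj (g c) ((h.col_iff _).2 ⟨c, rfl⟩), Matrix.vecMul, dotProduct]
    rw [← Finset.sum_subset (Finset.subset_univ (Finset.univ.image e)),
      Finset.sum_image h.injective.injOn]
    · exact Finset.sum_congr rfl fun i _ => by rw [h.entry]
    · intro i _ hi
      rw [hout i fun j _ hji => hi (Finset.mem_image.2 ⟨j, Finset.mem_univ _, hji⟩), zero_mul]
  funext i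
  by_cases hi : ∃ j ∈ I, e j = i
  · obtain ⟨j, -, rfl⟩ := hi
    exact congr_fun h1 j
  · push Not at hi
    exact hout i hi

-- The coefficient vector of a row that never became a pivot annihilates `M` and has a 1 at that
-- row, so it is a nontrivial relation.
omit [Fintype κ] in
theorem IsLeadingBlock.not_classIndep (h : IsLeadingBlock r T x e g M) {I : Finset ι}
    {P : List (ι × EchelonRow k ι κ)} (hP : EliminationInv M Set.univ I P) {u : ι} (hu : u ∉ I) :
    ¬ ClassIndep r T x := by
  obtain ⟨q, hq, rfl⟩ := List.mem_map.1 ((hP.mem_iff u).2 hu)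
  have hy := hP.rows q hq
  intro hind
  have h0 : ∀ i, (∀ j, e j ≠ i) → Function.extend e q.2.coef 0 i = 0 := fun i hi =>
    Function.extend_apply' _ _ _ fun ⟨j, hj⟩ => hi j hj
  have := hind (Function.extend e q.2.coef 0) (fun i hi => ?_) fun j hj => ?_
  · have h1 := congr_fun this (e q.1)
    rw [h.injective.extend_apply, hy.coef_self] at h1
    exact one_ne_zero h1
  · by_contra hcon
    refine hi (h0 i fun j hj => hcon ?_)
    rw [← hj]
    exact h.rowLength_eq j
  · obtain ⟨c, rfl⟩ := (h.col_iff j).1 hj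
    have h2 : Matrix.vecMul q.2.coef M c = 0 := by rw [← hy.val_eq]; exact hy.val_zero c trivial
    rw [← h2, Matrix.vecMul, dotProduct]
    rw [← Finset.sum_subset (Finset.subset_univ (Finset.univ.image e)),
      Finset.sum_image h.injective.injOn]
    · exact Finset.sum_congr rfl fun i _ => by rw [h.entry, h.injective.extend_apply]
    · intro i _ hi
      rw [h0 i fun j hji => hi (Finset.mem_image.2 ⟨j, Finset.mem_univ _, hji⟩), zero_mul]

omit [Fintype κ] [LinearOrder ι] [Fintype ι] in
theorem IsShortened.rowDegree_le {U : Set ι} {T' : Matrix (Fin n) (Fin n) k[X]}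
    (hr : ∀ j, -1 < r j ∧ r j ≤ 0) (hT : T.det ≠ 0)
    (h : IsShortened r T e U T') (i : Fin n) : rowDegree (T' i) ≤ rowDegree (T i) :=
  rowDegree_le_of_rowLength_le hr (row_ne_zero (det_ne_zero_of_span_eq hT h.span_eq) i)
    (row_ne_zero hT i) (h.rowLength_le i)

omit [Fintype κ] [LinearOrder ι] [Fintype ι] in
theorem IsShortened.refl : IsShortened r T e ∅ T := ⟨fun _ _ => rfl, rfl, by simp⟩

omit [Fintype κ] in
/-- One reduction of a row in the loops of the algorithms. -/
theorem IsLeadingBlock.reduceRow_step (h : IsLeadingBlock r T x e g M) {I : Finset ι}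
    {P : List (ι × EchelonRow k ι κ)} (hP : EliminationInv M Set.univ I P)
    {H : ℕ} (hH : ∀ i, rowDegree (T i) ≤ H) {q : ι × EchelonRow k ι κ} (hq : q ∈ P)
    {U : Set ι} (hqU : q.1 ∉ U) (hUI : ∀ u ∈ U, u ∉ I) {T' : Matrix (Fin n) (Fin n) k[X]}
    (hT' : IsShortened r T e U T') :
    (lastNonzero q.2.coef).val = some q.1 ∧
    IsShortened r T e (insert q.1 U) (_root_.reduceRow r e T' q.2.coef q.1).val ∧
    (∀ u ∈ insert q.1 U, u ∉ I) ∧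
    (lastNonzero q.2.coef).ops + (_root_.reduceRow r e T' q.2.coef q.1).ops ≤
      Fintype.card ι + Fintype.card ι * (n * ((H + 1) * 3)) := by
  have hy := hP.rows q hq
  refine ⟨lastNonzero_val (by simp [hy.coef_self]) fun j hj =>
      (hy.coef_support j hj).elim le_of_eq fun h => h.2.le, h.reduceRow hUI hT' hqU hy,
    fun u hu => ?_, ?_⟩
  · rcases Set.mem_insert_iff.1 hu with rfl | hu
    · exact (hP.mem_iff _).1 (List.mem_map_of_mem hq)
    · exact hUI u hu
  · rw [lastNonzero_ops]
    exact Nat.add_le_add_left (reduceRow_ops_le r e T' _ _ fun i j =>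
      (natDegree_le_rowDegree _ j).trans ((hT'.rowDegree_le h.bounds h.det_ne_zero i).trans (hH i))) _

end Block

/-! ### Sorting as a permutation of the rows. -/

section SortRows

variable {k : Type u} [Field k] {n : ℕ} {r : Fin n → ℝ} {T : Matrix (Fin n) (Fin n) k[X]}

theorem exists_sortRows_eq (r : Fin n → ℝ) (T : Matrix (Fin n) (Fin n) k[X]) :
    ∃ σ : Equiv.Perm (Fin n), sortRows r T = fun i => T (σ i) := ⟨_, rfl⟩

theorem sortRows_mono {i j : Fin n} (h : i ≤ j) :
    rowLength r (sortRows r T i) ≤ rowLength r (sortRows r T j) :=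
  Tuple.monotone_sort (fun a => rowLength r (T a)) h

theorem span_sortRows : Submodule.span k[X] (Set.range (sortRows r T)) =
    Submodule.span k[X] (Set.range T) := by
  obtain ⟨σ, hσ⟩ := exists_sortRows_eq r T
  rw [hσ]
  congr 1
  exact σ.surjective.range_comp T

end SortRows

/-! ### One pass of the general algorithm. -/

section General

variable {k : Type u} [Field k] {n : ℕ} {r : Fin n → ℝ}

theorem congModInt_iff_eq {x y : ℝ} (hx : -1 < x ∧ x ≤ 0) (hy : -1 < y ∧ y ≤ 0) :
    CongModInt x y ↔ x = y :=
  ⟨fun ⟨_, hz⟩ => eq_of_sub_eq_int hx hy hz, fun h => ⟨0, by simp [h]⟩⟩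

theorem elimination_cost_le {n f m : ℕ} (hf : f ≤ n) (hm : m ≤ n) :
    m * (f * (4 + 2 * f + 2 * m)) ≤ m * (8 * n ^ 2) := by
  refine Nat.mul_le_mul_left _ ?_
  rcases Nat.eq_zero_or_pos f with rfl | h
  · simp
  · calc f * (4 + 2 * f + 2 * m) ≤ n * (8 * n) := Nat.mul_le_mul hf (by omega)
      _ = 8 * n ^ 2 := by ring

-- The set `U` consists of the non-pivot rows. The elimination is charged to the columns of the
-- class and the rest to the members of `U`, so that the two costs can be summed separately over the
-- whole run.
open Classical in
theorem generalBody_spec (hr : ∀ j, -1 < r j ∧ r j ≤ 0) (σ : GeneralState k n)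
    (hT : σ.T.det ≠ 0) (hpos : σ.pos < σ.vals.length) (hx : σ.vals.getD σ.pos 0 ∈ Set.range r)
    (hnd : (σ.vals.drop (σ.pos + 1)).Nodup)
    (hQ : ∀ ρ ∈ σ.vals.drop (σ.pos + 1), ρ ∈ Set.range r) {H : ℕ}
    (hH : ∀ i, rowDegree (σ.T i) ≤ H) :
    ∃ U : Finset (Fin n),
      IsPass r (sortRows r σ.T) (generalBody r σ).val.T (σ.vals.getD σ.pos 0)
        (σ.vals.drop (σ.pos + 1)) ((generalBody r σ).val.vals.drop (σ.pos + 1)) U ∧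
      (generalBody r σ).val.pos = σ.pos + 1 ∧
      (generalBody r σ).ops ≤
        (Finset.univ.filter fun j => r j = σ.vals.getD σ.pos 0).card * (8 * n ^ 2) +
          U.card * (n + n * (n * ((H + 1) * 3))) := by
  set x := σ.vals.getD σ.pos 0 with hxdef
  set T := sortRows r σ.T with hTdef
  have hxb : -1 < x ∧ x ≤ 0 := by obtain ⟨j, hj⟩ := hx; rw [← hj]; exact hr j
  have hT1 : T.det ≠ 0 := det_ne_zero_of_span_eq hT span_sortRows
  have hne := row_ne_zero hT1
  set M : Matrix {i : Fin n // CongModInt (rowLength r (T i)) x} {j : Fin n // CongModInt (r j) x} k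
    := fun i j => leadCoeffAt (rowLength r (T i)) (T i j) with hM
  have hblock : IsLeadingBlock r T x Subtype.val Subtype.val M := by
    refine ⟨hr, hT1, hxb, Subtype.val_injective, fun i j hij => sortRows_mono hij.le, fun i => ?_,
      fun j => ?_, fun i j => ?_⟩
    · exact (congModInt_rowLength_iff hr (hne i) hxb).1 i.2
    · rw [← congModInt_iff_eq (hr j) hxb]
      exact ⟨fun h => ⟨⟨j, h⟩, rfl⟩, fun ⟨c, hc⟩ => hc ▸ c.2⟩
    · exact leadCoeffAt_rowLength hr (hne i) _
  have hclass : ∀ i, i ∈ classRows r T x ↔ CongModInt (rowLength r (T i)) x := fun i =>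
    (congModInt_rowLength_iff hr (hne i) hxb).symm
  have hH1 : ∀ i, rowDegree (T i) ≤ H := fun i => hH _
  obtain ⟨I, P, hP, hP2, hlen⟩ := rowEchelon_spec M
  have hm : Fintype.card {j : Fin n // CongModInt (r j) x} =
      (Finset.univ.filter fun j => r j = x).card := by
    rw [Fintype.card_subtype]
    congr 1
    ext j
    simp [congModInt_iff_eq (hr j) hxb]
  have hf : Fintype.card {i : Fin n // CongModInt (rowLength r (T i)) x} =
      (classRows r T x).ncard := by
    rw [Fintype.card_subtype, ← Set.ncard_coe_finset]
    congr 1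
    ext i
    simp [hclass]
  have hfn : Fintype.card {i : Fin n // CongModInt (rowLength r (T i)) x} ≤ n :=
    (Fintype.card_subtype_le _).trans (by simp)
  have hmn : Fintype.card {j : Fin n // CongModInt (r j) x} ≤ n :=
    (Fintype.card_subtype_le _).trans (by simp)
  have hops := (rowEchelon_ops_le M).trans (elimination_cost_le hfn hmn)
  rw [hm] at hops
  have hcardI : P.length = Iᶜ.card := by
    rw [← List.length_map (f := Prod.fst), ← List.toFinset_card_of_nodup
      (hP.sorted.imp fun h => h.ne)]
    congr 1
    ext i
    simp only [List.mem_toFinset, hP.mem_iff, Finset.mem_compl]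
  by_cases hfull : (rowEchelon M).val.1.length =
      Fintype.card {i : Fin n // CongModInt (rowLength r (T i)) x}
  · have hbody : generalBody r σ = ⟨⟨T, if Fintype.card {i : Fin n // CongModInt (rowLength r (T i)) x}
        < Fintype.card {j : Fin n // CongModInt (r j) x} then appendPending σ.pos σ.vals x
        else σ.vals, σ.pos + 1⟩, (rowEchelon M).ops + 0⟩ := by
      rw [generalBody, Counted.bind]
      erw [if_pos hfull]
      rfl
    rw [hbody, hm, hf]
    -- Full rank makes every row a pivot row, so `U` is empty.
    have hI : I = Finset.univ := (Finset.card_eq_iff_eq_univ I).1 (hlen.symm.trans hfull)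
    refine ⟨∅, ⟨fun i _ => rfl, by simp, by simp, by simp, rfl, ?_, by simp, ?_, ?_, ?_, ?_⟩,
      rfl, ?_⟩
    · refine hblock.leadIndep hP fun i hi => ⟨⟨i, (hclass i).1 hi.2⟩, by simp [hI], rfl⟩
    · dsimp only
      split_ifs
      · exact nodup_drop_appendPending hpos x hnd
      · exact hnd
    · dsimp only
      split_ifs
      · exact fun ρ hρ => ((mem_drop_appendPending hpos).1 hρ).elim (hQ ρ) fun h => h ▸ hx
      · exact hQ
    · dsimp only
      split_ifs
      · exact ⟨_, drop_appendPending hpos x⟩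
      · exact ⟨[], by simp⟩
    · intro _ hle
      rw [if_neg (not_lt.2 hle)]
    · simpa using hops
  · set F := fun (τ : Matrix (Fin n) (Fin n) k[X] × List ℝ)
          (y : EchelonRow k {i : Fin n // CongModInt (rowLength r (T i)) x}
            {j : Fin n // CongModInt (r j) x}) =>
        (lastNonzero y.coef).bind fun o =>
        match o with
        | none => Counted.pure τ
        | some u =>
            (reduceRow r Subtype.val τ.1 y.coef u).bind fun T' =>
            Counted.pure (T', appendPending σ.pos τ.2
              (rowLength r (T' u.val) - ⌈rowLength r (T' u.val)⌉)) with hF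
    have hbody : generalBody r σ = ⟨⟨(Counted.forLoop F (P.map Prod.snd) (T, σ.vals)).val.1,
        (Counted.forLoop F (P.map Prod.snd) (T, σ.vals)).val.2, σ.pos + 1⟩,
        (rowEchelon M).ops + ((Counted.forLoop F (P.map Prod.snd) (T, σ.vals)).ops + 0)⟩ := by
      rw [generalBody, Counted.bind]
      erw [if_neg hfull]
      rw [← hP2]
      rfl
    -- The last clause records that the new class of each shortened row is pending; it persists
    -- because later iterations change other rows and only append to the list.
    let Inv : Matrix (Fin n) (Fin n) k[X] × List ℝ →
        Set {i : Fin n // CongModInt (rowLength r (T i)) x} → Prop := fun τ U =>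
      IsShortened r T Subtype.val U τ.1 ∧ (∀ u ∈ U, u ∉ I) ∧ σ.pos < τ.2.length ∧
      (τ.2.drop (σ.pos + 1)).Nodup ∧ (∀ ρ ∈ τ.2.drop (σ.pos + 1), ρ ∈ Set.range r) ∧
      (∃ S, τ.2.drop (σ.pos + 1) = σ.vals.drop (σ.pos + 1) ++ S) ∧
      ∀ u ∈ U, ∃ ρ ∈ τ.2.drop (σ.pos + 1), u.1 ∈ classRows r τ.1 ρ
    have hloop := Counted.forLoop_induction (f := F) (Inv := Inv)
      (B := n + n * (n * ((H + 1) * 3))) P (hP.sorted.imp fun h => h.ne) (U := ∅) (s := (T, σ.vals))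
      ?_ (by simp) ⟨IsShortened.refl, by simp, hpos, hnd, hQ, ⟨[], by simp⟩, by simp⟩
    · obtain ⟨⟨h1, -, -, h3, h4, h5, h6⟩, h7⟩ := hloop
      rw [hbody]
      have hU : ∀ u, u ∈ ({u | u ∈ P.map Prod.fst} ∪ ∅ :
          Set {i : Fin n // CongModInt (rowLength r (T i)) x}) ↔ u ∉ I := fun u => by
        rw [Set.union_empty]; exact hP.mem_iff u
      have hUmem : ∀ i, i ∈ Iᶜ.image Subtype.val ↔ ∃ u, u ∉ I ∧ u.1 = i := by simp
      refine ⟨Iᶜ.image Subtype.val, ⟨fun i hi => h1.unchanged i fun u hu hui =>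
          hi ((hUmem i).2 ⟨u, (hU u).1 hu, hui⟩), fun i hi => ?_, fun i hi => ?_, fun i hi => ?_,
          h1.span_eq, ?_, fun ⟨i, hi⟩ => ?_, h3, h4, h5, fun h0 => ?_⟩, rfl, ?_⟩
      · obtain ⟨u, -, rfl⟩ := (hUmem i).1 hi
        exact (hclass u).2 u.2
      · obtain ⟨u, hu, rfl⟩ := (hUmem i).1 hi
        exact h1.lt u ((hU u).2 hu)
      · obtain ⟨u, hu, rfl⟩ := (hUmem i).1 hi
        exact h6 u ((hU u).2 hu)
      · refine hblock.leadIndep hP fun i hi => ⟨⟨i, (hclass i).1 hi.2⟩, ?_, rfl⟩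
        by_contra hcon
        exact hi.1 ((hUmem i).2 ⟨_, hcon, rfl⟩)
      · obtain ⟨u, hu, -⟩ := (hUmem i).1 hi
        exact hblock.not_classIndep hP hu
      · exfalso
        apply hfull
        rw [Finset.image_eq_empty, Finset.compl_eq_empty_iff] at h0
        rw [hlen, h0, Finset.card_univ]
      · rw [Finset.card_image_of_injective _ Subtype.val_injective, ← hcardI]
        dsimp only
        omega
    · rintro q hq ⟨T', vals⟩ U hqU ⟨h1, h2, h3, h4, h5, ⟨S, h6⟩, h7⟩
      obtain ⟨g1, g2, g3, g4⟩ := hblock.reduceRow_step hP hH1 hq hqU h2 h1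
      set T'' := (reduceRow r Subtype.val T' q.2.coef q.1).val with hT''
      have hFq : F (T', vals) q.2 = ⟨(T'', appendPending σ.pos vals
          (rowLength r (T'' q.1.val) - ⌈rowLength r (T'' q.1.val)⌉)),
          (lastNonzero q.2.coef).ops + ((reduceRow r Subtype.val T' q.2.coef q.1).ops + 0)⟩ := by
        simp only [hF, Counted.bind, g1]
        rfl
      rw [hFq]
      have hne' := row_ne_zero (det_ne_zero_of_span_eq hT1 g2.span_eq) q.1
      obtain ⟨j, -, -, hj⟩ := exists_rowLength_eq_rowDegree hr hne'
      -- The appended value is the weight of a column attaining the new length, so the pending list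
      -- never leaves the range of `r`.
      have hval : rowLength r (T'' q.1.val) - ⌈rowLength r (T'' q.1.val)⌉ = r j := by
        rw [ceil_rowLength hr hne', hj]; push_cast; ring
      rw [hval]
      dsimp only at h3 h4 h5 h6 h7
      refine ⟨⟨g2, g3, h3.trans_le (length_le_appendPending _ _ _), ?_, ?_, ?_, ?_⟩, ?_⟩
      · exact nodup_drop_appendPending h3 _ h4
      · exact fun ρ hρ => ((mem_drop_appendPending h3).1 hρ).elim (h5 ρ) fun h => ⟨j, h.symm⟩
      · dsimp only
        rw [drop_appendPending h3, h6, List.append_assoc]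
        exact ⟨_, rfl⟩
      · intro u hu
        by_cases huq : u = q.1
        · subst huq
          exact ⟨r j, (mem_drop_appendPending h3).2 (Or.inr rfl), hj⟩
        · obtain ⟨ρ, hρ, hu'⟩ := h7 u ((Set.mem_insert_iff.1 hu).resolve_left huq)
          refine ⟨ρ, (mem_drop_appendPending h3).2 (Or.inl hρ), ?_⟩
          have : T'' u = T' u := reduceRow_val_of_ne _ _ _ _ fun h => huq (Subtype.ext h)
          simpa only [classRows, Set.mem_ofPred_eq, this] using hu'
      · have : Fintype.card {i : Fin n // CongModInt (rowLength r (T i)) x} *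
            (n * ((H + 1) * 3)) ≤ n * (n * ((H + 1) * 3)) := Nat.mul_le_mul_right _ hfn
        dsimp only at g4 ⊢
        omega

end General

/-! ### Degree sum against degree of the determinant. -/

section Hadamard

variable {k : Type u} [Field k] {n : ℕ}

/-- The sum of the degrees of the rows. -/
def degreeSum (T : Matrix (Fin n) (Fin n) k[X]) : ℕ := ∑ i, rowDegree (T i)

theorem natDegree_det_le_degreeSum (T : Matrix (Fin n) (Fin n) k[X]) :
    T.det.natDegree ≤ degreeSum T := by
  rw [Matrix.det_apply]
  refine natDegree_sum_le_of_forall_le _ _ fun σ _ => ?_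
  refine (natDegree_smul_le _ _).trans ((natDegree_prod_le _ _).trans ?_)
  rw [degreeSum, ← Equiv.sum_comp σ fun i => rowDegree (T i)]
  exact Finset.sum_le_sum fun i _ => natDegree_le_rowDegree _ _

theorem coeff_prod_sum_of_natDegree_le {ι : Type*} (s : Finset ι) (f : ι → k[X]) (d : ι → ℕ)
    (h : ∀ i ∈ s, (f i).natDegree ≤ d i) :
    (∏ i ∈ s, f i).coeff (∑ i ∈ s, d i) = ∏ i ∈ s, (f i).coeff (d i) := by
  classical
  induction s using Finset.induction_on with
  | empty => simp
  | insert a s ha ih =>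
    have h' := fun i hi => h i (Finset.mem_insert_of_mem hi)
    rw [Finset.prod_insert ha, Finset.sum_insert ha, Finset.prod_insert ha, ← ih h']
    exact coeff_mul_add_eq_of_natDegree_le (h a (Finset.mem_insert_self _ _))
      ((natDegree_prod_le _ _).trans (Finset.sum_le_sum h'))

/-- In each Leibniz term the exponent `degreeSum T` is reached only by taking from every row the
coefficient at the row degree. -/
theorem coeff_det_degreeSum (T : Matrix (Fin n) (Fin n) k[X]) :
    T.det.coeff (degreeSum T) = (Matrix.of fun i j => (T i j).coeff (rowDegree (T i))).det := by
  rw [Matrix.det_apply, Matrix.det_apply, finsetSum_coeff]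
  refine Finset.sum_congr rfl fun σ _ => ?_
  rw [coeff_smul, degreeSum, ← Equiv.sum_comp σ fun i => rowDegree (T i), coeff_prod_sum_of_natDegree_le _ _ _
    fun i _ => natDegree_le_rowDegree _ _]
  rfl

theorem degreeSum_le_natDegree_det {T : Matrix (Fin n) (Fin n) k[X]} {x : ℝ}
    (h : LeadIndep (fun _ => x) T Set.univ x) : degreeSum T ≤ T.det.natDegree := by
  refine le_natDegree_of_ne_zero ?_
  rw [coeff_det_degreeSum]
  intro h0
  obtain ⟨a, ha, ha0⟩ := Matrix.exists_vecMul_eq_zero_iff.2 h0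
  refine ha (h a (fun _ _ => trivial) fun j _ => ?_)
  exact congr_fun ha0 j

theorem degreeSum_perm (T : Matrix (Fin n) (Fin n) k[X]) (σ : Equiv.Perm (Fin n)) :
    degreeSum (fun i => T (σ i)) = degreeSum T := Equiv.sum_comp σ fun i => rowDegree (T i)

end Hadamard

/-! ### Potentials that count shortened rows and rounds. -/

section Potential

variable {k : Type u} [Field k] {n : ℕ} {r : Fin n → ℝ} {T T' : Matrix (Fin n) (Fin n) k[X]}
  {ρ x : ℝ} {Q Q' : List ℝ} {U : Finset (Fin n)}

/-- The set of classes represented by the `r j`. -/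
def classes (r : Fin n → ℝ) : Finset ℝ := Finset.univ.image r

theorem mem_classes : ρ ∈ classes r ↔ ρ ∈ Set.range r := by simp [classes]

/-- The number of columns in the class `ρ`. -/
def colCount (r : Fin n → ℝ) (ρ : ℝ) : ℕ := (Finset.univ.filter fun j => r j = ρ).card

/-- The sum of the indices of the lengths of the rows. -/
def indexSum (r : Fin n → ℝ) (T : Matrix (Fin n) (Fin n) k[X]) : ℤ :=
  ∑ i, classIndex (classes r) (rowLength r (T i))

theorem indexSum_perm (T : Matrix (Fin n) (Fin n) k[X]) (σ : Equiv.Perm (Fin n)) :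
    indexSum r (fun i => T (σ i)) = indexSum r T :=
  Equiv.sum_comp σ fun i => classIndex (classes r) (rowLength r (T i))

open Classical in
/-- The classes that are at most some class with dependent leading coefficients. -/
def dependentBelow (r : Fin n → ℝ) (T : Matrix (Fin n) (Fin n) k[X]) : Finset ℝ :=
  (classes r).filter fun ρ => ∃ ρ' ∈ classes r, ρ ≤ ρ' ∧ ¬ ClassIndep r T ρ'

theorem mem_dependentBelow : ρ ∈ dependentBelow r T ↔
    ρ ∈ classes r ∧ ∃ ρ' ∈ classes r, ρ ≤ ρ' ∧ ¬ ClassIndep r T ρ' := by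
  simp [dependentBelow]

theorem dependentBelow_perm (σ : Equiv.Perm (Fin n)) :
    dependentBelow r (fun i => T (σ i)) = dependentBelow r T := by
  ext ρ
  exact mem_dependentBelow.trans ((and_congr_right fun _ => exists_congr fun ρ' =>
    and_congr_right fun _ => and_congr_right fun _ =>
      not_congr (classIndep_perm_iff σ)).trans mem_dependentBelow.symm)

theorem card_dependentBelow_le : (dependentBelow r T).card ≤ (classes r).card := by
  classical
  exact Finset.card_filter_le _ _

/-- A bound for the number of rounds. -/
def roundBound (r : Fin n → ℝ) (T : Matrix (Fin n) (Fin n) k[X]) : ℕ :=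
  ((classes r).card + 1) * (degreeSum T - T.det.natDegree) + (dependentBelow r T).card

/-- Distinct classes have disjoint sets of columns. Hence all eliminations of one round together
cost no more than one of full width. -/
theorem sum_colCount_le {l : List ℝ} (h : l.Nodup) : (l.map (colCount r)).sum ≤ n := by
  classical
  rw [← List.sum_toFinset _ h]
  calc ∑ ρ ∈ l.toFinset, colCount r ρ
      = (Finset.univ.filter fun j => r j ∈ l.toFinset).card := by
        rw [Finset.card_eq_sum_card_fiberwise (f := r) (t := l.toFinset) (fun j hj => by simpa using hj)]
        refine Finset.sum_congr rfl fun ρ hρ => ?_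
        rw [colCount, Finset.filter_filter]
        congr 1
        ext j
        simp only [Finset.mem_filter, Finset.mem_univ, true_and]
        exact ⟨fun h => ⟨h ▸ hρ, h⟩, fun h => h.2⟩
    _ ≤ n := (Finset.card_le_univ _).trans (by simp)

theorem sum_colCount_classes : ∑ ρ ∈ classes r, colCount r ρ = n := by
  have := Finset.card_eq_sum_card_fiberwise (f := r) (s := Finset.univ) (t := classes r)
    fun j _ => by simp [classes]
  simpa [colCount] using this.symm

variable (hr : ∀ j, -1 < r j ∧ r j ≤ 0)

/-- The leading coefficients give an injective linear map from the space on the rows of the class to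
the space on its columns. -/
theorem ClassIndep.ncard_le (h : ClassIndep r T ρ) : (classRows r T ρ).ncard ≤ colCount r ρ := by
  classical
  let M : Matrix (classRows r T ρ) {j // r j = ρ} k := fun i j => (T i j).coeff (rowDegree (T i))
  have hinj : Function.Injective M.vecMulLinear := by
    rw [injective_iff_map_eq_zero]
    intro a ha
    have h0 : ∀ i, i ∉ classRows r T ρ → Function.extend Subtype.val a 0 i = 0 := fun i hi =>
      Function.extend_apply' _ _ _ fun ⟨j, hj⟩ => hi (hj ▸ j.2)
    have := h (Function.extend Subtype.val a 0)
      (fun i hi => by by_contra hcon; exact hi (h0 i hcon)) fun j hj => ?_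
    · funext i
      have h2 := congr_fun this i
      rwa [Subtype.val_injective.extend_apply] at h2
    · have h2 : Matrix.vecMul a M ⟨j, hj⟩ = 0 := congr_fun ha ⟨j, hj⟩
      rw [← h2, Matrix.vecMul, dotProduct]
      rw [← Finset.sum_subset (Finset.subset_univ
          ((Finset.univ : Finset (classRows r T ρ)).image Subtype.val)),
        Finset.sum_image Subtype.val_injective.injOn]
      · exact Finset.sum_congr rfl fun i _ => by rw [Subtype.val_injective.extend_apply]
      · intro i _ hi
        rw [h0 i fun hi' => hi (Finset.mem_image.2 ⟨⟨i, hi'⟩, Finset.mem_univ _, rfl⟩), zero_mul]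
  have := LinearMap.finrank_le_finrank_of_injective hinj
  rw [Module.finrank_fintype_fun_eq_card, Module.finrank_fintype_fun_eq_card] at this
  rwa [← Nat.card_coe_set_eq, Nat.card_eq_fintype_card, colCount, ← Fintype.card_subtype]

include hr

theorem rowLength_class (hT : T.det ≠ 0) (i : Fin n) : ∃ ρ ∈ classes r, i ∈ classRows r T ρ := by
  obtain ⟨j, -, -, hj⟩ := exists_rowLength_eq_rowDegree hr (row_ne_zero hT i)
  exact ⟨r j, by simp [classes], hj⟩

/-- Rows and columns both number `n` in total, and independence bounds rows by columns in each
class, so equality holds in every class. The algorithm then has no reason to append a class again.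
-/
theorem colCount_le_ncard (hT : T.det ≠ 0) (h : ∀ ρ ∈ classes r, ClassIndep r T ρ)
    (hx : x ∈ classes r) : colCount r x ≤ (classRows r T x).ncard := by
  classical
  by_contra! hlt
  have h1 : ∑ ρ ∈ classes r, (classRows r T ρ).ncard < ∑ ρ ∈ classes r, colCount r ρ :=
    Finset.sum_lt_sum (fun ρ hρ => (h ρ hρ).ncard_le) ⟨x, hx, hlt⟩
  rw [sum_colCount_classes] at h1
  have h2 := Finset.card_eq_sum_card_fiberwise (f := fun i => rowLength r (T i) - rowDegree (T i))
    (s := Finset.univ) (t := classes r) fun i _ => by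
      obtain ⟨ρ, hρ, hi⟩ := rowLength_class hr hT i
      have : rowLength r (T i) - rowDegree (T i) = ρ := by
        rw [show rowLength r (T i) = rowDegree (T i) + ρ from hi]; ring
      simpa [this] using hρ
  have h3 : ∀ ρ, (classRows r T ρ).ncard =
      (Finset.univ.filter fun i => rowLength r (T i) - rowDegree (T i) = ρ).card := fun ρ => by
    rw [← Set.ncard_coe_finset]
    congr 1
    ext i
    simp [classRows, sub_eq_iff_eq_add']
  simp only [h3] at h1
  rw [← h2] at h1
  simp at h1

/-- With representatives in `(-1, 0]`, each class contributes at least the row degree to the index.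
Together with the matching upper bound this translates the index sum into the degree sum, up to `s
n`. -/
theorem classIndex_ge (hT : T.det ≠ 0) (i : Fin n) :
    ((classes r).card : ℤ) * rowDegree (T i) ≤ classIndex (classes r) (rowLength r (T i)) := by
  obtain ⟨ρ, hρ, hi⟩ := rowLength_class hr hT i
  have hi : rowLength r (T i) = rowDegree (T i) + ρ := hi
  rw [classIndex, ← nsmul_eq_mul, ← Finset.sum_const]
  refine Finset.sum_le_sum fun σ hσ => ?_
  obtain ⟨a, rfl⟩ := mem_classes.1 hρ
  obtain ⟨b, rfl⟩ := mem_classes.1 hσ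
  have : ((rowDegree (T i) : ℤ) - 1 : ℤ) ≤ ⌊rowLength r (T i) - r b⌋ := by
    rw [Int.le_floor, hi]
    push_cast
    linarith [(hr a).1, (hr b).2]
  omega

theorem classIndex_le (hT : T.det ≠ 0) (i : Fin n) :
    classIndex (classes r) (rowLength r (T i)) ≤ ((classes r).card : ℤ) * (rowDegree (T i) + 1) := by
  obtain ⟨ρ, hρ, hi⟩ := rowLength_class hr hT i
  have hi : rowLength r (T i) = rowDegree (T i) + ρ := hi
  rw [classIndex, ← nsmul_eq_mul, ← Finset.sum_const]
  refine Finset.sum_le_sum fun σ hσ => ?_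
  obtain ⟨a, rfl⟩ := mem_classes.1 hρ
  obtain ⟨b, rfl⟩ := mem_classes.1 hσ
  have : ⌊rowLength r (T i) - r b⌋ < (rowDegree (T i) : ℤ) + 1 := by
    rw [Int.floor_lt, hi]
    push_cast
    linarith [(hr a).2, (hr b).1]
  omega

theorem le_indexSum (hT : T.det ≠ 0) :
    ((classes r).card : ℤ) * T.det.natDegree ≤ indexSum r T := by
  calc ((classes r).card : ℤ) * T.det.natDegree ≤ (classes r).card * degreeSum T :=
        mul_le_mul_of_nonneg_left (by exact_mod_cast natDegree_det_le_degreeSum T) (by positivity)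
    _ ≤ _ := by
        rw [degreeSum, Nat.cast_sum, Finset.mul_sum]
        exact Finset.sum_le_sum fun i _ => classIndex_ge hr hT i

theorem indexSum_le (hT : T.det ≠ 0) :
    indexSum r T ≤ ((classes r).card : ℤ) * (degreeSum T + n) := by
  refine (Finset.sum_le_sum fun i _ => classIndex_le hr hT i).trans (le_of_eq ?_)
  rw [← Finset.mul_sum, Finset.sum_add_distrib, degreeSum]
  simp

namespace IsPass

variable (h : IsPass r T T' x Q Q' U) (hT : T.det ≠ 0)
include h hT

omit hr in
theorem det_ne_zero' : T'.det ≠ 0 := det_ne_zero_of_span_eq hT h.span_eq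

theorem rowDegree_le (i : Fin n) : rowDegree (T' i) ≤ rowDegree (T i) := by
  by_cases hi : i ∈ U
  · exact rowDegree_le_of_rowLength_le hr (row_ne_zero (h.det_ne_zero' hT) i) (row_ne_zero hT i)
      (h.lt i hi).le
  · rw [h.unchanged i hi]

theorem degreeSum_le : degreeSum T' ≤ degreeSum T :=
  Finset.sum_le_sum fun i _ => h.rowDegree_le hr hT i

theorem indexSum_add_card_le : indexSum r T' + U.card ≤ indexSum r T := by
  classical
  have h1 : ∀ i, classIndex (classes r) (rowLength r (T' i)) + (if i ∈ U then 1 else 0) ≤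
      classIndex (classes r) (rowLength r (T i)) := fun i => by
    split_ifs with hi
    · obtain ⟨ρ, hρ, hi'⟩ := rowLength_class hr hT i
      exact classIndex_lt (h.lt i hi) ⟨ρ, hρ, rowDegree (T i), by exact_mod_cast hi'⟩
    · rw [h.unchanged i hi, add_zero]
  have := Finset.sum_le_sum fun i (_ : i ∈ Finset.univ) => h1 i
  rw [Finset.sum_add_distrib] at this
  simpa [indexSum] using this

-- A shortened row lands in a pending class, so a class that is not pending consists of unchanged
-- rows. For `x` these are pivot rows; any other class inherits its independence from `T`.
omit hr hT in
theorem classIndep_of_not_mem (hinv : ∀ ρ ∈ classes r, ρ ≠ x → ρ ∉ Q → ClassIndep r T ρ)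
    (hρ : ρ ∈ classes r) (hρQ : ρ ∉ Q') : ClassIndep r T' ρ := by
  have h1 : ∀ i ∈ classRows r T' ρ, i ∉ U := fun i hi hiU => by
    obtain ⟨ρ', hρ', hi'⟩ := h.pending i hiU
    have h2 : rowLength r (T' i) = rowDegree (T' i) + ρ := hi
    have h3 : rowLength r (T' i) = rowDegree (T' i) + ρ' := hi'
    have : ρ' = ρ := by linarith
    exact hρQ (this ▸ hρ')
  have h2 : ∀ i ∈ classRows r T' ρ, i ∈ classRows r T ρ := fun i hi => by
    simpa only [classRows, Set.mem_ofPred_eq, h.unchanged i (h1 i hi)] using hi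
  by_cases hx : ρ = x
  · subst hx
    exact (h.indep.mono fun i hi => ⟨h1 i hi, h2 i hi⟩).congr fun i hi => h.unchanged i (h1 i hi)
  · have hQ : ρ ∉ Q := fun hQ => by
      obtain ⟨S, hS⟩ := h.exists_append
      exact hρQ (hS ▸ List.mem_append_left _ hQ)
    exact ((hinv ρ hρ hx hQ).mono h2).congr fun i hi => h.unchanged i (h1 i hi)

variable (hd : degreeSum T' = degreeSum T)
include hd

/-- No row degree increases, so a constant degree sum keeps each of them. A shortened row must then
have moved to a class strictly below `x`. -/
theorem not_mem_of_le (hxρ : x ≤ ρ) {i : Fin n} (hi : i ∈ classRows r T' ρ) : i ∉ U := by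
  intro hiU
  have h1 : rowDegree (T' i) = rowDegree (T i) := by
    refine le_antisymm (h.rowDegree_le hr hT i) (not_lt.1 fun hlt => hd.not_lt ?_)
    exact Finset.sum_lt_sum (fun i _ => h.rowDegree_le hr hT i) ⟨i, Finset.mem_univ i, hlt⟩
  have h2 : rowLength r (T' i) = rowDegree (T' i) + ρ := hi
  have h3 : rowLength r (T i) = rowDegree (T i) + x := h.mem_class i hiU
  have h4 := h.lt i hiU
  rw [h2, h3, h1] at h4
  linarith

theorem leadIndep_unchanged (hxρ : x ≤ ρ)
    (hi : LeadIndep r T {i | i ∉ U ∧ i ∈ classRows r T ρ} ρ) : ClassIndep r T' ρ := by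
  refine (hi.mono fun i hi => ?_).congr fun i hi =>
    h.unchanged i (h.not_mem_of_le hr hT hd hxρ hi)
  have h1 := h.not_mem_of_le hr hT hd hxρ hi
  exact ⟨h1, by simpa only [classRows, Set.mem_ofPred_eq, h.unchanged i h1] using hi⟩

/-- Classes above `x` gain no rows, so a dependent one was dependent before. If a row was shortened,
`x` itself was dependent and dominates everything at or below it. -/
theorem dependentBelow_subset (hx : x ∈ classes r) : dependentBelow r T' ⊆ dependentBelow r T := by
  intro ρ hρ
  obtain ⟨hρ, ρ', hρ', hle, hdep⟩ := mem_dependentBelow.1 hρ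
  refine mem_dependentBelow.2 ⟨hρ, ?_⟩
  by_cases hU : U.Nonempty
  · rcases le_or_gt ρ' x with hx' | hx'
    · exact ⟨x, hx, hle.trans hx', h.dep hU⟩
    · refine ⟨ρ', hρ', hle, fun hind => hdep ?_⟩
      exact h.leadIndep_unchanged hr hT hd hx'.le (LeadIndep.mono hind fun i hi => hi.2)
  · have hTT : T' = T := funext fun i => h.unchanged i fun hi => hU ⟨i, hi⟩
    exact ⟨ρ', hρ', hle, hTT ▸ hdep⟩

theorem not_mem_dependentBelow (hmax : ∀ ρ ∈ classes r, x < ρ → ClassIndep r T ρ) :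
    x ∉ dependentBelow r T' := by
  intro hx
  obtain ⟨hx, ρ, hρ, hle, hdep⟩ := mem_dependentBelow.1 hx
  rcases hle.eq_or_lt with rfl | hlt
  · exact hdep (h.leadIndep_unchanged hr hT hd le_rfl h.indep)
  · exact hdep (h.leadIndep_unchanged hr hT hd hle (LeadIndep.mono (hmax ρ hρ hlt) fun i hi => hi.2))

end IsPass

-- The factor `(classes r).card + 1` outweighs any growth of `dependentBelow`, which has at most
-- `(classes r).card` elements.
omit hr in
theorem IsPass.roundBound_lt (h : IsPass r T T' x Q Q' U)
    (hd : degreeSum T' < degreeSum T) : roundBound r T' < roundBound r T := by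
  have h1 := natDegree_det_le_degreeSum T'
  have h2 := card_dependentBelow_le (r := r) (T := T')
  rw [roundBound, roundBound, natDegree_det_eq_of_span_eq h.span_eq] at *
  obtain ⟨d, hd'⟩ : ∃ d, degreeSum T - T.det.natDegree = degreeSum T' - T.det.natDegree + 1 + d :=
    ⟨degreeSum T - degreeSum T' - 1, by omega⟩
  rw [hd', mul_add, mul_add]
  have : 0 ≤ ((classes r).card + 1) * d := Nat.zero_le _
  omega

theorem IsPass.roundBound_le (h : IsPass r T T' x Q Q' U) (hT : T.det ≠ 0) (hx : x ∈ classes r) :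
    roundBound r T' ≤ roundBound r T := by
  rcases (h.degreeSum_le hr hT).lt_or_eq with hd | hd
  · exact (h.roundBound_lt hd).le
  · rw [roundBound, roundBound, natDegree_det_eq_of_span_eq h.span_eq, hd]
    exact Nat.add_le_add_left (Finset.card_le_card (h.dependentBelow_subset hr hT hd hx)) _

theorem IsPass.eq_of_roundBound_eq (h : IsPass r T T' x Q Q' U) (hT : T.det ≠ 0)
    (hx : x ∈ classes r) (heq : roundBound r T' = roundBound r T) :
    degreeSum T' = degreeSum T ∧ dependentBelow r T' = dependentBelow r T := by
  have hd : degreeSum T' = degreeSum T := by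
    rcases (h.degreeSum_le hr hT).lt_or_eq with hd | hd
    · exact absurd heq (h.roundBound_lt hd).ne
    · exact hd
  refine ⟨hd, Finset.eq_of_subset_of_card_le (h.dependentBelow_subset hr hT hd hx) ?_⟩
  rw [roundBound, roundBound, natDegree_det_eq_of_span_eq h.span_eq, hd] at heq
  omega

end Potential

/-! ### Correctness and cost of the general algorithm, round by round. -/

section GeneralRun

variable {k : Type u} [Field k] {n : ℕ} {r : Fin n → ℝ}

/-- A state of the general algorithm: every class with dependent leading coefficients is pending. -/
structure GeneralInv (r : Fin n → ℝ) (H : ℕ) (σ : GeneralState k n) (L : List ℝ) : Prop where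
  det_ne_zero : σ.T.det ≠ 0
  rowDegree_le : ∀ i, rowDegree (σ.T i) ≤ H
  drop_eq : σ.vals.drop σ.pos = L
  nodup : L.Nodup
  subset_classes : ∀ ρ ∈ L, ρ ∈ classes r
  classIndep : ∀ ρ ∈ classes r, ρ ∉ L → ClassIndep r σ.T ρ

/-- A class with dependent leading coefficients, maximal with this property. -/
def IsMaxDependent (r : Fin n → ℝ) (T : Matrix (Fin n) (Fin n) k[X]) (ρ : ℝ) : Prop :=
  ρ ∈ classes r ∧ ¬ ClassIndep r T ρ ∧ ∀ ρ' ∈ classes r, ρ < ρ' → ClassIndep r T ρ'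

theorem exists_isMaxDependent {T : Matrix (Fin n) (Fin n) k[X]}
    (h : ∃ ρ ∈ classes r, ¬ ClassIndep r T ρ) : ∃ ρ, IsMaxDependent r T ρ := by
  classical
  obtain ⟨ρ₀, h₀, h₁⟩ := h
  obtain ⟨ρ, hρ, hmax⟩ := ((classes r).filter fun ρ => ¬ ClassIndep r T ρ).exists_max_image id
    ⟨ρ₀, Finset.mem_filter.2 ⟨h₀, h₁⟩⟩
  refine ⟨ρ, (Finset.mem_filter.1 hρ).1, (Finset.mem_filter.1 hρ).2, fun ρ' hρ' hlt => ?_⟩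
  by_contra hcon
  exact absurd (hmax ρ' (Finset.mem_filter.2 ⟨hρ', hcon⟩)) (not_le.2 hlt)

theorem dependentBelow_eq_empty_iff {T : Matrix (Fin n) (Fin n) k[X]} :
    dependentBelow r T = ∅ ↔ ∀ ρ ∈ classes r, ClassIndep r T ρ := by
  rw [Finset.eq_empty_iff_forall_notMem]
  constructor
  · intro h ρ hρ
    by_contra hcon
    exact h ρ (mem_dependentBelow.2 ⟨hρ, ρ, hρ, le_rfl, hcon⟩)
  · intro h ρ hρ
    obtain ⟨-, ρ', hρ', -, hdep⟩ := mem_dependentBelow.1 hρ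
    exact hdep (h ρ' hρ')

/-- The largest dependent class is the maximum of `dependentBelow`, hence determined by that set
alone. -/
theorem IsMaxDependent.of_dependentBelow_eq {T T' : Matrix (Fin n) (Fin n) k[X]} {ρ : ℝ}
    (h : IsMaxDependent r T ρ) (heq : dependentBelow r T = dependentBelow r T') :
    IsMaxDependent r T' ρ := by
  have hmax : ∀ ρ' ∈ classes r, ρ < ρ' → ClassIndep r T' ρ' := fun ρ' hρ' hlt => by
    by_contra hcon
    have h1 : ρ' ∈ dependentBelow r T' := mem_dependentBelow.2 ⟨hρ', ρ', hρ', le_rfl, hcon⟩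
    rw [← heq] at h1
    obtain ⟨-, ρ'', hρ'', hle, hdep⟩ := mem_dependentBelow.1 h1
    exact hdep (h.2.2 ρ'' hρ'' (hlt.trans_le hle))
  have h1 : ρ ∈ dependentBelow r T := mem_dependentBelow.2 ⟨h.1, ρ, h.1, le_rfl, h.2.1⟩
  rw [heq] at h1
  obtain ⟨-, ρ', hρ', hle, hdep⟩ := mem_dependentBelow.1 h1
  rcases hle.eq_or_lt with rfl | hlt
  · exact ⟨h.1, hdep, hmax⟩
  · exact absurd (hmax ρ' hρ' hlt) hdep

/-- `v` bounds the number of rounds still needed after the pending classes `L` of the present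
round, if `S` is the list of pending classes of the next round. -/
structure RoundInv (r : Fin n → ℝ) (T : Matrix (Fin n) (Fin n) k[X]) (L S : List ℝ) (v : ℕ) :
    Prop where
  le : roundBound r T ≤ v
  mem_of_eq : roundBound r T = v → ∀ ρ, IsMaxDependent r T ρ → ρ ∈ L
  eq_nil_of_eq : roundBound r T = v → (∀ ρ ∈ classes r, ClassIndep r T ρ) → S = []

/-- A round that leaves the bound unchanged would still have its largest dependent class waiting in
the empty list, or else would have all classes independent and nothing appended. -/
theorem RoundInv.next {T : Matrix (Fin n) (Fin n) k[X]} {S : List ℝ} {v : ℕ}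
    (h : RoundInv r T [] S v) (hS : S ≠ []) : roundBound r T < v := by
  refine lt_of_le_of_ne h.le fun heq => ?_
  by_cases hind : ∀ ρ ∈ classes r, ClassIndep r T ρ
  · exact hS (h.eq_nil_of_eq heq hind)
  · push Not at hind
    obtain ⟨ρ, hρ⟩ := exists_isMaxDependent hind
    simpa using h.mem_of_eq heq ρ hρ

theorem degreeSum_sortRows (T : Matrix (Fin n) (Fin n) k[X]) :
    degreeSum (sortRows r T) = degreeSum T := degreeSum_perm T _

theorem indexSum_sortRows (T : Matrix (Fin n) (Fin n) k[X]) :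
    indexSum r (sortRows r T) = indexSum r T := indexSum_perm T _

theorem classIndep_sortRows_iff {T : Matrix (Fin n) (Fin n) k[X]} {ρ : ℝ} :
    ClassIndep r (sortRows r T) ρ ↔ ClassIndep r T ρ := classIndep_perm_iff _

theorem dependentBelow_sortRows (T : Matrix (Fin n) (Fin n) k[X]) :
    dependentBelow r (sortRows r T) = dependentBelow r T := dependentBelow_perm _

theorem roundBound_sortRows (T : Matrix (Fin n) (Fin n) k[X]) :
    roundBound r (sortRows r T) = roundBound r T := by
  rw [roundBound, roundBound, natDegree_det_eq_of_span_eq span_sortRows, degreeSum_sortRows,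
    dependentBelow_sortRows]

theorem RoundInv.sortRows {T : Matrix (Fin n) (Fin n) k[X]} {L S : List ℝ} {v : ℕ}
    (h : RoundInv r T L S v) : RoundInv r (sortRows r T) L S v := by
  have hb := roundBound_sortRows (r := r) T
  exact ⟨hb ▸ h.le, fun heq ρ hρ => h.mem_of_eq (hb ▸ heq) ρ
      (hρ.of_dependentBelow_eq (dependentBelow_sortRows T)), fun heq hind =>
      h.eq_nil_of_eq (hb ▸ heq) fun ρ hρ => classIndep_sortRows_iff.1 (hind ρ hρ)⟩

variable (hr : ∀ j, -1 < r j ∧ r j ≤ 0)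
include hr

/-- If the bound has not dropped, degree sum and `dependentBelow` are as before the pass. Processing
the largest dependent class would have removed it from that set, so this class is still waiting in
`L`. If all classes are independent, no row was shortened and the class had as many rows as columns,
so nothing was appended. -/
theorem RoundInv.pass {T T' : Matrix (Fin n) (Fin n) k[X]} {x : ℝ} {L S S' : List ℝ} {v : ℕ}
    {U : Finset (Fin n)} (h : RoundInv r T (x :: L) S v) (hT : T.det ≠ 0) (hx : x ∈ classes r)
    (hpass : IsPass r T T' x (L ++ S) (L ++ S') U) : RoundInv r T' L S' v := by
  have hle := hpass.roundBound_le hr hT hx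
  refine ⟨hle.trans h.le, fun heq ρ hρ => ?_, fun heq hind => ?_⟩ <;>
    obtain ⟨hd, hdep⟩ := hpass.eq_of_roundBound_eq hr hT hx
      (le_antisymm hle (h.le.trans heq.ge)) <;>
    have hv : roundBound r T = v := le_antisymm h.le (heq ▸ hle)
  · have hρT := hρ.of_dependentBelow_eq hdep
    refine (List.mem_cons.1 (h.mem_of_eq hv ρ hρT)).resolve_left ?_
    rintro rfl
    exact hpass.not_mem_dependentBelow hr hT hd hρT.2.2
      (mem_dependentBelow.2 ⟨hx, ρ, hx, le_rfl, hρ.2.1⟩)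
  · have hindT : ∀ ρ ∈ classes r, ClassIndep r T ρ := by
      rwa [← dependentBelow_eq_empty_iff, ← hdep, dependentBelow_eq_empty_iff]
    have hS := h.eq_nil_of_eq hv hindT
    have hU : U = ∅ := by
      by_contra hU
      exact hpass.dep (Finset.nonempty_iff_ne_empty.2 hU) (hindT x hx)
    have := hpass.eq_of_empty hU (colCount_le_ncard hr hT hindT hx)
    rw [List.append_cancel_left this, hS]

/-- One step of the general algorithm, for a state with pending classes `x :: L ++ S`. -/
theorem GeneralInv.step {H : ℕ} {σ : GeneralState k n} {x : ℝ} {L S : List ℝ} {v : ℕ}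
    (h : GeneralInv r H σ (x :: L ++ S)) (hv : RoundInv r σ.T (x :: L) S v) :
    σ.pos < σ.vals.length ∧ ∃ (S' : List ℝ) (c : ℕ),
      GeneralInv r H (generalBody r σ).val (L ++ S') ∧
      RoundInv r (generalBody r σ).val.T L S' v ∧
      Submodule.span k[X] (Set.range (generalBody r σ).val.T) =
        Submodule.span k[X] (Set.range σ.T) ∧
      indexSum r (generalBody r σ).val.T + c ≤ indexSum r σ.T ∧
      (generalBody r σ).ops ≤
        colCount r x * (8 * n ^ 2) + c * (n + n * (n * ((H + 1) * 3))) := by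
  have hpos : σ.pos < σ.vals.length := by
    by_contra hcon
    have := h.drop_eq
    rw [List.drop_eq_nil_of_le (not_lt.1 hcon)] at this
    simp at this
  have hdrop := h.drop_eq
  rw [List.drop_eq_getElem_cons hpos, List.cons_append, List.cons_eq_cons] at hdrop
  obtain ⟨hx, hdrop⟩ := hdrop
  have hx' : σ.vals.getD σ.pos 0 = x := by
    rw [List.getD_eq_getElem _ _ hpos, hx]
  have hxc : x ∈ classes r := h.subset_classes x (by simp)
  have hnd := h.nodup
  rw [List.cons_append, List.nodup_cons] at hnd
  obtain ⟨U, hpass, hp, hops⟩ := generalBody_spec hr σ h.det_ne_zero hpos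
    (hx' ▸ mem_classes.1 hxc) (hdrop ▸ hnd.2)
    (fun ρ hρ => mem_classes.1 (h.subset_classes ρ (List.mem_cons_of_mem _ (by rwa [hdrop] at hρ))))
    h.rowDegree_le
  rw [hx', hdrop] at hpass
  rw [hx'] at hops
  obtain ⟨S₁, hS₁⟩ := hpass.exists_append
  rw [hS₁, List.append_assoc] at hpass
  have hTdet : (sortRows r σ.T).det ≠ 0 := det_ne_zero_of_span_eq h.det_ne_zero span_sortRows
  refine ⟨hpos, S ++ S₁, U.card, ⟨hpass.det_ne_zero' hTdet, fun i => ?_,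
    by rw [hp, hS₁, List.append_assoc], hpass.nodup, fun ρ hρ => mem_classes.2 (hpass.mem_range ρ hρ),
    fun ρ hρ hρQ => hpass.classIndep_of_not_mem (fun ρ' hρ' hne hQ => ?_) hρ hρQ⟩,
    hv.sortRows.pass hr hTdet hxc hpass, hpass.span_eq.trans span_sortRows, ?_, hops⟩
  · exact (hpass.rowDegree_le hr hTdet i).trans (h.rowDegree_le _)
  · refine classIndep_sortRows_iff.2 (h.classIndep ρ' hρ' ?_)
    rw [List.cons_append, List.mem_cons, not_or]
    exact ⟨hne, hQ⟩
  · rw [← indexSum_sortRows σ.T]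
    exact hpass.indexSum_add_card_le hr hTdet

omit hr in
/-- The general algorithm, started in the state `σ`, is correct, with cost at most `a` plus the
cost of reducing rows. -/
def GeneralRunBound (r : Fin n → ℝ) (H : ℕ) (σ : GeneralState k n) (a : ℕ) : Prop :=
  ∃ (σ' : GeneralState k n) (c : ℕ),
    WhileRuns (fun σ : GeneralState k n => σ.pos < σ.vals.length) (generalBody r) σ σ' c ∧
    Submodule.span k[X] (Set.range σ'.T) = Submodule.span k[X] (Set.range σ.T) ∧
    (∀ ρ ∈ classes r, ClassIndep r σ'.T ρ) ∧
    (c : ℤ) ≤ (a : ℤ) + ((n + n * (n * ((H + 1) * 3)) : ℕ) : ℤ) *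
      (indexSum r σ.T - (classes r).card * σ.T.det.natDegree)

theorem GeneralInv.halt {H : ℕ} {σ : GeneralState k n} (h : GeneralInv r H σ []) (a : ℕ) :
    GeneralRunBound r H σ a := by
  refine ⟨σ, 0, .halt ?_, rfl, fun ρ hρ => h.classIndep ρ hρ (by simp), ?_⟩
  · simpa using h.drop_eq
  · have := le_indexSum hr h.det_ne_zero
    have h1 : 0 ≤ indexSum r σ.T - (classes r).card * σ.T.det.natDegree := by linarith
    rw [Nat.cast_zero]
    positivity

theorem GeneralInv.loop {H : ℕ} {σ : GeneralState k n} {x : ℝ} {L S : List ℝ} {v a : ℕ}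
    (h : GeneralInv r H σ (x :: L ++ S)) (hv : RoundInv r σ.T (x :: L) S v)
    (ih : ∀ (S' : List ℝ) (σ' : GeneralState k n), GeneralInv r H σ' (L ++ S') → RoundInv r σ'.T L S' v →
      GeneralRunBound r H σ' a) :
    GeneralRunBound r H σ (colCount r x * (8 * n ^ 2) + a) := by
  obtain ⟨hpos, S', c, h1, h2, h3, h4, h5⟩ := h.step hr hv
  obtain ⟨σ', c', hrun, hspan, hind, hc⟩ := ih S' _ h1 h2
  refine ⟨σ', _, .loop hpos hrun, hspan.trans h3, hind, ?_⟩
  rw [natDegree_det_eq_of_span_eq h3] at hc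
  generalize n + n * (n * ((H + 1) * 3)) = B at *
  have h6 := mul_le_mul_of_nonneg_left h4 (Nat.cast_nonneg (α := ℤ) B)
  have h7 := Int.ofNat_le.2 h5
  push_cast at h7 ⊢
  linarith

/-- The outer induction is over rounds, the inner one over the classes left in the present round.
Row reductions are paid from the index sum inside `GeneralRunBound`, so only eliminations appear in
the explicit term. -/
theorem generalRunBound {H : ℕ} (v : ℕ) (L S : List ℝ) (σ : GeneralState k n)
    (h : GeneralInv r H σ (L ++ S)) (hv : RoundInv r σ.T L S v) :
    GeneralRunBound r H σ (((L.map (colCount r)).sum + n * v) * (8 * n ^ 2)) := by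
  induction v generalizing L S σ with
  | zero =>
    induction L generalizing S σ with
    | nil =>
      by_cases hS : S = []
      · subst hS
        exact h.halt hr _
      · exact absurd (hv.next hS) (Nat.not_lt_zero _)
    | cons x L ih =>
      rw [List.map_cons, List.sum_cons, add_assoc, add_mul]
      exact h.loop hr hv ih
  | succ v ihv =>
    induction L generalizing S σ with
    | nil =>
      by_cases hS : S = []
      · subst hS
        exact h.halt hr _
      -- A new round begins: `S` becomes the current list, and one unit of the bound buys at most
      -- `n` columns of elimination.
      · have hlt := hv.next hS
        rw [List.nil_append] at h
        obtain ⟨σ', c', hrun, hspan, hind, hc⟩ := ihv S [] σ (by simpa using h)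
          ⟨Nat.le_of_lt_succ hlt, fun _ ρ hρ => by_contra fun hcon =>
            hρ.2.1 (h.classIndep ρ hρ.1 hcon), fun _ _ => rfl⟩
        refine ⟨σ', c', hrun, hspan, hind, hc.trans (add_le_add ?_ le_rfl)⟩
        have h1 := sum_colCount_le (r := r) h.nodup
        refine Int.ofNat_le.2 (Nat.mul_le_mul_right _ ?_)
        rw [mul_add]
        simp only [List.map_nil, List.sum_nil]
        omega
    | cons x L ih =>
      rw [List.map_cons, List.sum_cons, add_assoc, add_mul]
      exact h.loop hr hv ih

/-- The general algorithm is correct, and its cost is bounded in terms of the number `s` of classes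
and the defect `δ`, the sum of the degrees of the rows minus the degree of the determinant. -/
theorem generalReductionRuns_exists {H : ℕ} (T : Matrix (Fin n) (Fin n) k[X]) (hT : T.det ≠ 0)
    (hH : ∀ i, rowDegree (T i) ≤ H) :
    ∃ (T' : Matrix (Fin n) (Fin n) k[X]) (c : ℕ), GeneralReductionRuns r T T' c ∧
      Submodule.span k[X] (Set.range T') = Submodule.span k[X] (Set.range T) ∧
      (∀ ρ ∈ classes r, ClassIndep r T' ρ) ∧
      c ≤ n * (((classes r).card + 1) * (degreeSum T - T.det.natDegree + 1)) * (8 * n ^ 2) +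
        (n + n * (n * ((H + 1) * 3))) *
          ((classes r).card * (degreeSum T - T.det.natDegree + n)) := by
  classical
  set L := (Finset.univ.image r).sort (· ≤ ·) with hL
  have hmem : ∀ ρ, ρ ∈ L ↔ ρ ∈ classes r := fun ρ => Finset.mem_sort _
  have hnd : L.Nodup := Finset.sort_nodup _ _
  have hinv : GeneralInv r H ⟨T, L, 0⟩ (L ++ []) := by
    rw [List.append_nil]
    exact ⟨hT, hH, rfl, hnd, fun ρ hρ => (hmem ρ).1 hρ,
      fun ρ hρ hρL => absurd ((hmem ρ).2 hρ) hρL⟩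
  -- The initial list contains every class, so both equality clauses of `RoundInv` hold at the
  -- start.
  obtain ⟨⟨T', vals, pos⟩, c, hrun, hspan, hind, hc⟩ := generalRunBound hr (roundBound r T) L [] _
    hinv ⟨le_rfl, fun _ ρ hρ => (hmem ρ).2 hρ.1, fun _ _ => rfl⟩
  refine ⟨T', c, ⟨vals, pos, hrun⟩, hspan, hind, ?_⟩
  have h1 := indexSum_le hr hT
  have h2 := natDegree_det_le_degreeSum T
  obtain ⟨δ, hδ⟩ := Nat.exists_eq_add_of_le h2
  have h3 : roundBound r T ≤ ((classes r).card + 1) * δ + (classes r).card := by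
    rw [roundBound, hδ, Nat.add_sub_cancel_left]
    exact Nat.add_le_add_left card_dependentBelow_le _
  rw [hδ, Nat.add_sub_cancel_left]
  rw [hδ] at h1
  have h4 : indexSum r T - (classes r).card * T.det.natDegree ≤
      (((classes r).card * (δ + n) : ℕ) : ℤ) := by
    push_cast at h1 ⊢
    linarith
  have h5 : (L.map (colCount r)).sum + n * roundBound r T ≤
      n * (((classes r).card + 1) * (δ + 1)) := by
    calc (L.map (colCount r)).sum + n * roundBound r T
        ≤ n + n * (((classes r).card + 1) * δ + (classes r).card) :=
          Nat.add_le_add (sum_colCount_le hnd) (Nat.mul_le_mul_left _ h3)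
      _ = _ := by ring
  have h6 := mul_le_mul_of_nonneg_left h4
    (Nat.cast_nonneg (α := ℤ) (n + n * (n * ((H + 1) * 3))))
  have h7 := Nat.mul_le_mul_right (8 * n ^ 2) h5
  have h8 : (c : ℤ) ≤ ((n * (((classes r).card + 1) * (δ + 1)) * (8 * n ^ 2) : ℕ) : ℤ) +
      ((n + n * (n * ((H + 1) * 3)) : ℕ) : ℤ) * (((classes r).card * (δ + n) : ℕ) : ℤ) :=
    hc.trans (add_le_add (by exact_mod_cast h7) h6)
  exact_mod_cast h8

end GeneralRun

/-! ### The algorithm for equal weights. -/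

section UniformRun

variable {k : Type u} [Field k] {n : ℕ} {x : ℝ}

theorem rowLength_const (hx : -1 < x ∧ x ≤ 0) {v : Fin n → k[X]} (hv : v ≠ 0) :
    rowLength (fun _ => x) v = rowDegree v + x := by
  obtain ⟨j, -, -, hj⟩ := exists_rowLength_eq_rowDegree (r := fun _ => x) (fun _ => hx) hv
  exact hj

theorem isLeadingBlock_const (hx : -1 < x ∧ x ≤ 0) {T : Matrix (Fin n) (Fin n) k[X]}
    (hT : T.det ≠ 0) (hs : ∀ i j, i ≤ j → rowLength (fun _ => x) (T i) ≤ rowLength (fun _ => x) (T j)) :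
    IsLeadingBlock (fun _ => x) T x (id : Fin n → Fin n) (id : Fin n → Fin n)
      (fun i j => leadCoeffAt (rowLength (fun _ => x) (T i)) (T i j)) :=
  ⟨fun _ => hx, hT, hx, Function.injective_id, fun i j h => hs i j h.le,
    fun i => rowLength_const hx (row_ne_zero hT i), fun j => ⟨fun _ => ⟨j, rfl⟩, fun _ => rfl⟩,
    fun i _ => leadCoeffAt_rowLength (fun _ => hx) (row_ne_zero hT i) _⟩

theorem IsShortened.degreeSum_add_card_le (hx : -1 < x ∧ x ≤ 0)
    {T T' : Matrix (Fin n) (Fin n) k[X]} (hT : T.det ≠ 0) {U : Finset (Fin n)}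
    (h : IsShortened (fun _ => x) T (id : Fin n → Fin n) (U : Set (Fin n)) T') :
    degreeSum T' + U.card ≤ degreeSum T := by
  have hT' := det_ne_zero_of_span_eq hT h.span_eq
  have h1 : ∀ i, rowDegree (T' i) + (if i ∈ U then 1 else 0) ≤ rowDegree (T i) := fun i => by
    split_ifs with hi
    · have h2 := h.lt i hi
      rw [id, rowLength_const hx (row_ne_zero hT i), rowLength_const hx (row_ne_zero hT' i),
        add_lt_add_iff_right, Nat.cast_lt] at h2
      exact h2
    · exact h.rowDegree_le (fun _ => hx) hT i
  have := Finset.sum_le_sum fun i (_ : i ∈ Finset.univ) => h1 i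
  rw [Finset.sum_add_distrib] at this
  simpa [degreeSum] using this

/-- One pass of the algorithm for `K(x) ⊥ ⋯ ⊥ K(x)` either finds independent leading coefficients
or shortens some rows. -/
theorem uniformBody_spec (hx : -1 < x ∧ x ≤ 0) (σ : UniformState k n) (hT : σ.T.det ≠ 0) {H : ℕ}
    (hH : ∀ i, rowDegree (σ.T i) ≤ H) :
    ∃ c : ℕ, Submodule.span k[X] (Set.range (uniformBody x σ).val.T) =
        Submodule.span k[X] (Set.range σ.T) ∧
      (∀ i, rowDegree ((uniformBody x σ).val.T i) ≤ H) ∧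
      degreeSum (uniformBody x σ).val.T + c ≤ degreeSum σ.T ∧
      (uniformBody x σ).ops ≤ n * (8 * n ^ 2) + c * (n + n * (n * ((H + 1) * 3))) ∧
      ((uniformBody x σ).val.s < n ∧ 0 < c ∨ n ≤ (uniformBody x σ).val.s ∧
        degreeSum (uniformBody x σ).val.T ≤ (uniformBody x σ).val.T.det.natDegree) := by
  set T := sortRows (fun _ => x) σ.T with hTdef
  have hT1 : T.det ≠ 0 := det_ne_zero_of_span_eq hT span_sortRows
  set M : Matrix (Fin n) (Fin n) k := fun i j => leadCoeffAt (rowLength (fun _ => x) (T i)) (T i j)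
    with hM
  have hblock : IsLeadingBlock (fun _ => x) T x (id : Fin n → Fin n) (id : Fin n → Fin n) M :=
    isLeadingBlock_const hx hT1 fun i j h => sortRows_mono h
  have hH1 : ∀ i, rowDegree (T i) ≤ H := fun i => hH _
  have hdeg : degreeSum T = degreeSum σ.T := degreeSum_sortRows _
  obtain ⟨I, P, hP, hP2, hlen⟩ := rowEchelon_spec M
  have hops := (rowEchelon_ops_le M).trans
    (elimination_cost_le (n := n) (by simp) (by simp))
  rw [Fintype.card_fin] at hops
  have hcardI : P.length = Iᶜ.card := by
    rw [← List.length_map (f := Prod.fst), ← List.toFinset_card_of_nodup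
      (hP.sorted.imp fun h => h.ne)]
    congr 1
    ext i
    simp only [List.mem_toFinset, hP.mem_iff, Finset.mem_compl]
  by_cases hfull : (rowEchelon M).val.1.length < n
  · set F := fun (T' : Matrix (Fin n) (Fin n) k[X]) (y : EchelonRow k (Fin n) (Fin n)) =>
      (lastNonzero y.coef).bind fun o =>
      match o with
      | none => Counted.pure T'
      | some u => reduceRow (fun _ => x) id T' y.coef u with hF
    have hbody : uniformBody x σ = ⟨⟨(Counted.forLoop F (P.map Prod.snd) T).val,
        (rowEchelon M).val.1.length⟩,
        (rowEchelon M).ops + ((Counted.forLoop F (P.map Prod.snd) T).ops + 0)⟩ := by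
      rw [uniformBody, Counted.bind]
      erw [if_pos hfull]
      rw [← hP2]
      rfl
    let Inv : Matrix (Fin n) (Fin n) k[X] → Set (Fin n) → Prop := fun T' U =>
      IsShortened (fun _ => x) T (id : Fin n → Fin n) U T' ∧ ∀ u ∈ U, u ∉ I
    have hloop := Counted.forLoop_induction (f := F) (Inv := Inv)
      (B := n + n * (n * ((H + 1) * 3))) P (hP.sorted.imp fun h => h.ne) (U := ∅) (s := T)
      ?_ (by simp) ⟨IsShortened.refl, by simp⟩
    · obtain ⟨⟨h1, -⟩, h7⟩ := hloop
      rw [hbody]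
      have hU : ({u | u ∈ P.map Prod.fst} ∪ ∅ : Set (Fin n)) = (Iᶜ : Finset (Fin n)) := by
        ext u
        rw [Set.union_empty, Finset.mem_coe, Finset.mem_compl]
        exact hP.mem_iff u
      rw [hU] at h1
      refine ⟨Iᶜ.card, h1.span_eq.trans span_sortRows,
        fun i => (h1.rowDegree_le (fun _ => hx) hT1 i).trans (hH1 i),
        hdeg ▸ h1.degreeSum_add_card_le hx hT1, ?_, Or.inl ⟨hfull, ?_⟩⟩
      · rw [← hcardI]
        dsimp only
        omega
      · rw [Finset.card_compl, Fintype.card_fin]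
        omega
    · rintro q hq T' U hqU ⟨h1, h2⟩
      obtain ⟨g1, g2, g3, g4⟩ := hblock.reduceRow_step hP hH1 hq hqU h2 h1
      have hFq : F T' q.2 = ⟨(reduceRow (fun _ => x) id T' q.2.coef q.1).val,
          (lastNonzero q.2.coef).ops + (reduceRow (fun _ => x) id T' q.2.coef q.1).ops⟩ := by
        simp only [hF, Counted.bind, g1]
      rw [hFq]
      refine ⟨⟨g2, g3⟩, ?_⟩
      rwa [Fintype.card_fin] at g4
  · have hbody : uniformBody x σ = ⟨⟨T, (rowEchelon M).val.1.length⟩,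
        (rowEchelon M).ops + (0 + 0)⟩ := by
      rw [uniformBody, Counted.bind]
      erw [if_neg hfull]
      rfl
    rw [hbody]
    have hI : I = Finset.univ := by
      rw [← Finset.card_eq_iff_eq_univ, Fintype.card_fin]
      have := Finset.card_le_univ I
      rw [Fintype.card_fin] at this
      omega
    refine ⟨0, span_sortRows, hH1, hdeg.le, by simpa using hops, Or.inr ⟨not_lt.1 hfull, ?_⟩⟩
    exact degreeSum_le_natDegree_det (hblock.leadIndep hP fun i _ => ⟨i, by simp [hI], rfl⟩)

/-- Every pass of deficient rank shortens a row and so lowers the degree sum, on which the induction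
runs. The hypothesis `hs` covers a start at which the loop condition already fails, since the
initial `s` is not a computed rank. -/
theorem uniformRun_exists (hx : -1 < x ∧ x ≤ 0) {H : ℕ} (d : ℕ) (σ : UniformState k n)
    (hT : σ.T.det ≠ 0) (hH : ∀ i, rowDegree (σ.T i) ≤ H) (hd : degreeSum σ.T = d)
    (hs : n ≤ σ.s → degreeSum σ.T ≤ σ.T.det.natDegree) :
    ∃ (σ' : UniformState k n) (c : ℕ),
      WhileRuns (fun σ : UniformState k n => σ.s < n) (uniformBody x) σ σ' c ∧
      Submodule.span k[X] (Set.range σ'.T) = Submodule.span k[X] (Set.range σ.T) ∧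
      (∀ i, rowDegree (σ'.T i) ≤ H) ∧ degreeSum σ'.T ≤ σ'.T.det.natDegree ∧
      c ≤ (d + 1) * (n * (8 * n ^ 2)) + d * (n + n * (n * ((H + 1) * 3))) := by
  induction d using Nat.strong_induction_on generalizing σ with
  | _ d ih =>
    by_cases hsn : σ.s < n
    · obtain ⟨c, h1, h2, h3, h4, h5⟩ := uniformBody_spec hx σ hT hH
      generalize n + n * (n * ((H + 1) * 3)) = B at *
      generalize n * (8 * n ^ 2) = A at *
      rcases h5 with ⟨h5, h6⟩ | ⟨h5, h6⟩
      · obtain ⟨σ', c', g1, g2, g3, g4, g5⟩ := ih _ (by omega) (uniformBody x σ).val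
          (det_ne_zero_of_span_eq hT h1) h2 rfl fun h => absurd h5 (not_lt.2 h)
        refine ⟨σ', _, .loop hsn g1, g2.trans h1, g3, g4, ?_⟩
        obtain ⟨e, he⟩ := Nat.exists_eq_add_of_le h3
        rw [hd] at he
        have : d = degreeSum (uniformBody x σ).val.T + c + e := he
        -- At least one row was shortened, which pays for the elimination of this pass.
        have h7 : A * 1 ≤ A * c := Nat.mul_le_mul_left _ h6
        subst this
        nlinarith [Nat.zero_le (e * A), Nat.zero_le (e * B)]
      · refine ⟨_, _, .loop hsn (.halt (not_lt.2 h5)), h1, h2, h6, ?_⟩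
        have h7 : c * B ≤ d * B := Nat.mul_le_mul_right _ (by omega)
        have h8 : 0 ≤ d * A := Nat.zero_le _
        rw [add_mul, one_mul]
        omega
    · exact ⟨σ, 0, .halt hsn, rfl, hH, hs (not_lt.1 hsn), Nat.zero_le _⟩

/-- The loop starts with `s = 1`, so for `n ≤ 1` it never runs and the input must already be
reduced. -/
theorem degreeSum_le_natDegree_det_of_le_one (hn : n ≤ 1) (T : Matrix (Fin n) (Fin n) k[X]) :
    degreeSum T ≤ T.det.natDegree := by
  interval_cases n
  · simp [degreeSum]
  · simp [degreeSum, rowDegree]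

/-- The algorithm for `K(x) ⊥ ⋯ ⊥ K(x)` is correct. -/
theorem uniformReductionRuns_exists (hx : -1 < x ∧ x ≤ 0) {H : ℕ}
    (T : Matrix (Fin n) (Fin n) k[X]) (hT : T.det ≠ 0) (hH : ∀ i, rowDegree (T i) ≤ H) :
    ∃ (T' : Matrix (Fin n) (Fin n) k[X]) (c : ℕ), UniformReductionRuns x T T' c ∧
      Submodule.span k[X] (Set.range T') = Submodule.span k[X] (Set.range T) ∧
      (∀ i, rowDegree (T' i) ≤ H) ∧ degreeSum T' ≤ T'.det.natDegree ∧
      c ≤ (degreeSum T + 1) * (n * (8 * n ^ 2)) +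
        degreeSum T * (n + n * (n * ((H + 1) * 3))) := by
  obtain ⟨⟨T', s⟩, c, h1, h2⟩ := uniformRun_exists hx (degreeSum T) ⟨T, 1⟩ hT hH rfl
    fun h => degreeSum_le_natDegree_det_of_le_one h T
  exact ⟨T', c, ⟨s, h1⟩, h2⟩

end UniformRun

/-! ### Back to `E`: rows as coordinate vectors, and reducedness of the output. -/

section Coordinates

variable {k : Type u} [Field k] {E : Type v} [AddCommGroup E] [Module k[X] E]
  [Module (RatFunc k) E] [IsScalarTower k[X] (RatFunc k) E] {N : E → WithBot ℝ} {n : ℕ}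
  {b b' : Module.Basis (Fin n) (RatFunc k) E} {T : Matrix (Fin n) (Fin n) k[X]}

/-- The vector with the given polynomial coordinates. -/
def ofCoordinates (b' : Module.Basis (Fin n) (RatFunc k) E) : (Fin n → k[X]) →ₗ[k[X]] E :=
  Fintype.linearCombination k[X] b'

theorem ofCoordinates_apply (v : Fin n → k[X]) :
    ofCoordinates b' v = ∑ j, algebraMap k[X] (RatFunc k) (v j) • b' j := by
  rw [ofCoordinates, Fintype.linearCombination_apply]
  exact Finset.sum_congr rfl fun j _ => (algebraMap_smul _ _ _).symm

theorem rowVectors_eq (T : Matrix (Fin n) (Fin n) k[X]) (i : Fin n) :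
    rowVectors b' T i = ofCoordinates b' (T i) := (ofCoordinates_apply _).symm

theorem repr_ofCoordinates (v : Fin n → k[X]) (j : Fin n) :
    b'.repr (ofCoordinates b' v) j = algebraMap k[X] (RatFunc k) (v j) := by
  rw [ofCoordinates_apply, b'.repr_sum_self]

theorem ofCoordinates_ne_zero {v : Fin n → k[X]} (hv : v ≠ 0) : ofCoordinates b' v ≠ 0 := by
  intro h
  refine hv (funext fun j => ?_)
  have := repr_ofCoordinates (b' := b') v j
  rw [h, map_zero, Finsupp.zero_apply] at this
  exact (map_eq_zero_iff _ (RatFunc.algebraMap_injective k)).1 this.symm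

theorem realLength_ofCoordinates (hN : IsLengthFunction k N) (hb : IsReducedFamily k N b')
    {v : Fin n → k[X]} (hv : v ≠ 0) :
    realLength N (ofCoordinates b' v) = rowLength (fun j => realLength N (b' j)) v := by
  have hdeg : ∀ j, ((b'.repr (ofCoordinates b' v) j).intDegree : ℝ) = (v j).natDegree := fun j => by
    rw [repr_ofCoordinates, RatFunc.intDegree_polynomial]
    simp
  have hne : ∀ j, b'.repr (ofCoordinates b' v) j ≠ 0 ↔ v j ≠ 0 := fun j => by
    rw [repr_ofCoordinates, map_ne_zero_iff _ (RatFunc.algebraMap_injective k)]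
  refine le_antisymm ?_ ?_
  · obtain ⟨j, hj, h⟩ := hb.exists_realLength_eq hN (ofCoordinates_ne_zero (b' := b') hv)
    rw [h, hdeg]
    exact natDegree_add_le_rowLength (fun j => realLength N (b' j)) ((hne j).1 hj)
  · obtain ⟨j, hj, h⟩ := exists_rowLength_eq (fun j => realLength N (b' j)) hv
    rw [h, ← hdeg]
    exact hb.le_realLength hN ((hne j).2 hj)

/-- A non-reduced family has a leading relation. The natural shifts `d i` make lengths in it
congruent modulo `ℤ`, so it lives in a single class and gives a relation between leading
coefficients there. -/
theorem isReducedFamily_rowVectors (hN : IsLengthFunction k N) (hb : IsOrthonormalBasis N b')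
    (hT : T.det ≠ 0)
    (hind : ∀ ρ ∈ classes fun j => realLength N (b' j),
      ClassIndep (fun j => realLength N (b' j)) T ρ) :
    IsReducedFamily k N (rowVectors b' T) := by
  set r : Fin n → ℝ := fun j => realLength N (b' j) with hrdef
  have hr : ∀ j, -1 < r j ∧ r j ≤ 0 := fun j => hb.realLength_mem hN j
  have hne := row_ne_zero hT
  have hlen : ∀ i, realLength N (rowVectors b' T i) = rowLength r (T i) := fun i => by
    rw [rowVectors_eq, realLength_ofCoordinates hN hb.reduced (hne i)]
  have hne' : ∀ i, rowVectors b' T i ≠ 0 := fun i => by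
    rw [rowVectors_eq]; exact ofCoordinates_ne_zero (hne i)
  by_contra hred
  obtain ⟨i₀, α, d, hα, -, hd, hlt⟩ := hN.exists_leading_relation hne' hred
  obtain ⟨ρ, hρ, hi₀⟩ := rowLength_class hr hT i₀
  have hi₀ : rowLength r (T i₀) = rowDegree (T i₀) + ρ := hi₀
  have hρb : -1 < ρ ∧ ρ ≤ 0 := by
    obtain ⟨j, rfl⟩ := mem_classes.1 hρ
    exact hr j
  have hclass : ∀ i, α i ≠ 0 →
      i ∈ classRows r T ρ ∧ rowDegree (T i₀) = rowDegree (T i) + d i := fun i hi => by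
    have h1 := hd i hi
    rw [hlen, hlen, hi₀] at h1
    obtain ⟨ρ', hρ', hi'⟩ := rowLength_class hr hT i
    have hi' : rowLength r (T i) = rowDegree (T i) + ρ' := hi'
    obtain ⟨j, rfl⟩ := mem_classes.1 hρ'
    have h2 : r j = ρ := by
      refine eq_of_sub_eq_int (hr j) hρb (z := rowDegree (T i₀) - rowDegree (T i) - d i) ?_
      push_cast
      linarith
    rw [h2] at hi'
    refine ⟨hi', ?_⟩
    have : (rowDegree (T i₀) : ℝ) = rowDegree (T i) + d i := by linarith
    exact_mod_cast this
  set v : Fin n → k[X] := ∑ i, (C (α i) * X ^ d i) • T i with hv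
  have hsum : ∑ i, (C (α i) * X ^ d i) • rowVectors b' T i = ofCoordinates b' v := by
    rw [hv, map_sum]
    exact Finset.sum_congr rfl fun i _ => by rw [rowVectors_eq, map_smul]
  rw [hsum] at hlt
  have hzero := hind ρ hρ α (fun i hi => (hclass i hi).1) fun j hj => ?_
  · rw [hzero] at hα
    exact zero_ne_one hα
  -- In a column of class `ρ` this is the coefficient of `v` at the length of row `i₀`; a nonzero
  -- value would contradict `hlt`.
  · have hcoeff : (v j).coeff (rowDegree (T i₀)) =
        ∑ i, α i * (T i j).coeff (rowDegree (T i)) := by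
      rw [hv, Finset.sum_apply, finsetSum_coeff]
      refine Finset.sum_congr rfl fun i _ => ?_
      rw [Pi.smul_apply, smul_eq_mul, mul_assoc, coeff_C_mul]
      by_cases hi : α i = 0
      · simp [hi]
      · rw [(hclass i hi).2, coeff_X_pow_mul]
    rw [← hcoeff]
    by_contra hcon
    have hv0 : v ≠ 0 := fun h0 => hcon (by rw [h0]; simp)
    have h1 := le_rowLength_of_coeff_ne_zero r hcon
    rw [hN.coe_realLength (ofCoordinates_ne_zero hv0), hN.coe_realLength (hne' i₀), hlen,
      realLength_ofCoordinates hN hb.reduced hv0, WithBot.coe_lt_coe, hi₀] at hlt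
    rw [hj] at h1
    exact absurd hlt (not_lt.2 h1)

variable (hT : transitionMatrix b b' = T.map (algebraMap k[X] (RatFunc k)))
include hT

omit [Module k[X] E] [IsScalarTower k[X] (RatFunc k) E] in
theorem eq_rowVectors : (b : Fin n → E) = rowVectors b' T := by
  funext i
  rw [rowVectors, ← b'.sum_repr (b i)]
  refine Finset.sum_congr rfl fun j _ => ?_
  have : transitionMatrix b b' i j = algebraMap k[X] (RatFunc k) (T i j) := by rw [hT]; rfl
  rw [← this]; rfl

omit [Module k[X] E] [IsScalarTower k[X] (RatFunc k) E] in
theorem det_ne_zero_of_transitionMatrix : T.det ≠ 0 := by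
  intro h0
  have h1 := det_transitionMatrix b b'
  rw [hT] at h1
  have h2 := (algebraMap k[X] (RatFunc k)).map_det T
  rw [h0, map_zero] at h2
  have h3 : (T.map (algebraMap k[X] (RatFunc k))).det = 0 := h2.symm
  rw [h3] at h1
  exact (b'.isUnit_det b).ne_zero h1.symm

omit [Module k[X] E] [IsScalarTower k[X] (RatFunc k) E] in
theorem rowDegree_le_matrixHeight (i : Fin n) :
    rowDegree (T i) ≤ matrixHeight (transitionMatrix b b') := by
  refine Finset.sup_le fun j _ => ?_
  have h1 : ratHeight (transitionMatrix b b' i j) = (T i j).natDegree := by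
    have : transitionMatrix b b' i j = algebraMap k[X] (RatFunc k) (T i j) := by rw [hT]; rfl
    rw [this, ratHeight, RatFunc.num_algebraMap, RatFunc.denom_algebraMap, natDegree_one,
      Nat.max_zero]
  rw [← h1]
  exact (Finset.le_sup (f := fun j => ratHeight (transitionMatrix b b' i j))
    (Finset.mem_univ j)).trans (Finset.le_sup
      (f := fun i => Finset.univ.sup fun j => ratHeight (transitionMatrix b b' i j))
      (Finset.mem_univ i))

theorem isReducedBasisOfSpan_rowVectors (hN : IsLengthFunction k N) (hb : IsOrthonormalBasis N b')
    {T' : Matrix (Fin n) (Fin n) k[X]}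
    (hspan : Submodule.span k[X] (Set.range T') = Submodule.span k[X] (Set.range T))
    (hind : ∀ ρ ∈ classes fun j => realLength N (b' j),
      ClassIndep (fun j => realLength N (b' j)) T' ρ) :
    IsReducedBasisOfSpan (k := k) N b (rowVectors b' T') := by
  have hrange : ∀ T : Matrix (Fin n) (Fin n) k[X],
      Submodule.span k[X] (Set.range (rowVectors b' T)) =
        (Submodule.span k[X] (Set.range T)).map (ofCoordinates b') := fun T => by
    rw [Submodule.map_span]
    exact congrArg _ ((congrArg Set.range (funext fun i => rowVectors_eq T i)).trans
      (Set.range_comp (ofCoordinates b') (fun i => T i)))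
  have hspan' : Submodule.span k[X] (Set.range (rowVectors b' T')) =
      Submodule.span k[X] (Set.range b) := by
    rw [hrange, hspan, ← hrange, ← eq_rowVectors hT]
  have htop : Submodule.span (RatFunc k) (Set.range (rowVectors b' T')) = ⊤ := by
    rw [← top_le_iff, ← b.span_eq, Submodule.span_le]
    intro x hx
    refine mem_span_ratFunc_of_mem_span ?_
    rw [hspan']
    exact Submodule.subset_span hx
  exact ⟨isReducedFamily_rowVectors hN hb
    (det_ne_zero_of_span_eq (det_ne_zero_of_transitionMatrix hT) hspan) hind,
    (linearIndependent_of_span_eq_top b htop).restrict_scalars' k[X], hspan'⟩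

end Coordinates

/-! ### Arithmetic of the cost bounds. -/

section CostBounds

theorem rowCost_le {n H : ℕ} (hH : 1 ≤ H) : n + n * (n * ((H + 1) * 3)) ≤ 7 * (n ^ 2 * H) := by
  have h1 : n ≤ n ^ 2 * H := (Nat.le_self_pow two_ne_zero n).trans (Nat.le_mul_of_pos_right _ hH)
  have h2 : n * (n * ((H + 1) * 3)) ≤ n ^ 2 * (H * 6) := by
    rw [← mul_assoc, ← pow_two]
    exact Nat.mul_le_mul_left _ (by omega)
  linarith

/-- Eliminations give the term `n ^ 4 * H` and row reductions the term `n ^ 3 * H ^ 2`, each after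
bounding `δ + 1` and `δ + n` by `2 * (n * H)`. -/
theorem general_cost_le {n s H δ : ℕ} (hH : 1 ≤ H) (hs : 1 ≤ s) (hn : 1 ≤ n) (hδ : δ ≤ n * H) :
    n * ((s + 1) * (δ + 1)) * (8 * n ^ 2) + (n + n * (n * ((H + 1) * 3))) * (s * (δ + n)) ≤
      32 * (s * (n ^ 4 * H + n ^ 3 * H ^ 2)) := by
  have hnH : 1 ≤ n * H := Nat.mul_pos hn hH
  have hn' : n ≤ n * H := Nat.le_mul_of_pos_right _ hH
  have h1 : (s + 1) * (δ + 1) ≤ (2 * s) * (2 * (n * H)) :=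
    Nat.mul_le_mul (by omega) (by omega)
  have h2 : s * (δ + n) ≤ s * (2 * (n * H)) := Nat.mul_le_mul_left _ (by omega)
  calc _ ≤ n * ((2 * s) * (2 * (n * H))) * (8 * n ^ 2) + 7 * (n ^ 2 * H) * (s * (2 * (n * H))) :=
        Nat.add_le_add (Nat.mul_le_mul_right _ (Nat.mul_le_mul_left _ h1))
          (Nat.mul_le_mul (rowCost_le hH) h2)
    _ = 32 * (s * (n ^ 4 * H)) + 14 * (s * (n ^ 3 * H ^ 2)) := by ring
    _ ≤ _ := by rw [mul_add s]; omega

/-- The second phase starts with `δ = 0`, hence the literal zeros. With `s ≤ n` its whole cost is of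
order `n ^ 4 * H`, so the number of classes disappears from the bound. -/
theorem optimized_cost_le {n s H d : ℕ} (hH : 1 ≤ H) (hs : s ≤ n) (hn : 1 ≤ n) (hd : d ≤ n * H) :
    (d + 1) * (n * (8 * n ^ 2)) + d * (n + n * (n * ((H + 1) * 3))) +
      (n * ((s + 1) * (0 + 1)) * (8 * n ^ 2) + (n + n * (n * ((H + 1) * 3))) * (s * (0 + n))) ≤
      39 * (n ^ 4 * H) + 7 * (n ^ 3 * H ^ 2) := by
  have hnH : 1 ≤ n * H := Nat.mul_pos hn hH
  have h1 : (s + 1) * (0 + 1) ≤ 2 * n := by omega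
  have h2 : s * (0 + n) ≤ n * n := by rw [zero_add]; exact Nat.mul_le_mul_right _ hs
  have h3 : n ^ 4 ≤ n ^ 4 * H := Nat.le_mul_of_pos_right _ hH
  calc _ ≤ (2 * (n * H)) * (n * (8 * n ^ 2)) + (n * H) * (7 * (n ^ 2 * H)) +
        (n * (2 * n) * (8 * n ^ 2) + 7 * (n ^ 2 * H) * (n * n)) :=
        Nat.add_le_add (Nat.add_le_add (Nat.mul_le_mul_right _ (by omega))
          (Nat.mul_le_mul hd (rowCost_le hH)))
          (Nat.add_le_add (Nat.mul_le_mul_right _ (Nat.mul_le_mul_left _ h1))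
            (Nat.mul_le_mul (rowCost_le hH) h2))
    _ = 23 * (n ^ 4 * H) + 16 * n ^ 4 + 7 * (n ^ 3 * H ^ 2) := by ring
    _ ≤ _ := by omega

end CostBounds

/-! ### The two algorithms for a normed space. -/

section Main

variable {k : Type u} [Field k] {E : Type v} [AddCommGroup E] [Module k[X] E]
  [Module (RatFunc k) E] [IsScalarTower k[X] (RatFunc k) E] {N : E → WithBot ℝ} {n : ℕ}
  {b b' : Module.Basis (Fin n) (RatFunc k) E} {T : Matrix (Fin n) (Fin n) k[X]}

theorem degreeSum_le_mul {H : ℕ} (h : ∀ i, rowDegree (T i) ≤ H) : degreeSum T ≤ n * H :=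
  (Finset.sum_le_sum fun i _ => h i).trans (by simp)

theorem exists_generalReductionRuns (hN : IsLengthFunction k N) (hb : IsOrthonormalBasis N b')
    (hT : transitionMatrix b b' = T.map (algebraMap k[X] (RatFunc k))) :
    ∃ (T' : Matrix (Fin n) (Fin n) k[X]) (c : ℕ),
      GeneralReductionRuns (fun j => realLength N (b' j)) T T' c ∧
      IsReducedBasisOfSpan (k := k) N b (rowVectors b' T') ∧
      c ≤ 32 * ((signature N).ncard *
        (n ^ 4 * max 1 (matrixHeight (transitionMatrix b b'))
          + n ^ 3 * max 1 (matrixHeight (transitionMatrix b b')) ^ 2)) := by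
  have hdeg : ∀ i, rowDegree (T i) ≤ max 1 (matrixHeight (transitionMatrix b b')) := fun i =>
    (rowDegree_le_matrixHeight hT i).trans (le_max_right _ _)
  obtain ⟨T', c, hrun, hspan, hind, hc⟩ := generalReductionRuns_exists
    (fun j => hb.realLength_mem hN j) T (det_ne_zero_of_transitionMatrix hT) hdeg
  refine ⟨T', c, hrun, isReducedBasisOfSpan_rowVectors hT hN hb hspan hind, hc.trans ?_⟩
  rw [hb.ncard_signature hN]
  rcases Nat.eq_zero_or_pos n with rfl | hn
  · simp
  · refine general_cost_le (le_max_left _ _) ?_ hn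
      ((Nat.sub_le _ _).trans (degreeSum_le_mul hdeg))
    exact Finset.card_pos.2 ⟨_, Finset.mem_image_of_mem _ (Finset.mem_univ ⟨0, hn⟩)⟩

theorem exists_optimizedReductionRuns (hN : IsLengthFunction k N) (hb : IsOrthonormalBasis N b')
    (hT : transitionMatrix b b' = T.map (algebraMap k[X] (RatFunc k))) :
    ∃ (T' : Matrix (Fin n) (Fin n) k[X]) (c : ℕ),
      OptimizedReductionRuns (fun j => realLength N (b' j)) T T' c ∧
      IsReducedBasisOfSpan (k := k) N b (rowVectors b' T') ∧
      c ≤ 46 * (n ^ 4 * max 1 (matrixHeight (transitionMatrix b b'))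
          + n ^ 3 * max 1 (matrixHeight (transitionMatrix b b')) ^ 2) ∧
      (n ≤ matrixHeight (transitionMatrix b b') →
        c ≤ 46 * (n ^ 3 * matrixHeight (transitionMatrix b b') ^ 2)) := by
  set h := matrixHeight (transitionMatrix b b') with hh
  have hdeg : ∀ i, rowDegree (T i) ≤ max 1 h := fun i =>
    (rowDegree_le_matrixHeight hT i).trans (le_max_right _ _)
  have hdet := det_ne_zero_of_transitionMatrix hT
  obtain ⟨T₁, c₁, hrun₁, hspan₁, hdeg₁, hdet₁, hc₁⟩ := uniformReductionRuns_exists (x := 0)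
    ⟨by norm_num, le_rfl⟩ T hdet hdeg
  obtain ⟨T', c₂, hrun₂, hspan₂, hind, hc₂⟩ := generalReductionRuns_exists
    (fun j => hb.realLength_mem hN j) T₁ (det_ne_zero_of_span_eq hdet hspan₁) hdeg₁
  -- After the first phase the degree sum equals the degree of the determinant, so the defect in the
  -- second cost bound vanishes.
  rw [Nat.sub_eq_zero_of_le hdet₁] at hc₂
  have hs : (classes fun j => realLength N (b' j)).card ≤ n :=
    Finset.card_image_le.trans (by simp)
  have hc : c₁ + c₂ ≤ 39 * (n ^ 4 * max 1 h) + 7 * (n ^ 3 * max 1 h ^ 2) := by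
    refine (Nat.add_le_add hc₁ hc₂).trans ?_
    rcases Nat.eq_zero_or_pos n with rfl | hn
    · simp
    · exact optimized_cost_le (le_max_left _ _) hs hn (degreeSum_le_mul hdeg)
  refine ⟨T', c₁ + c₂, ⟨T₁, c₁, c₂, hrun₁, hrun₂, rfl⟩,
    isReducedBasisOfSpan_rowVectors hT hN hb (hspan₂.trans hspan₁) hind, hc.trans ?_, fun hn => ?_⟩
  · omega
  · rcases Nat.eq_zero_or_pos n with rfl | hn0
    · simpa using hc
    -- A positive `n ≤ h` gives `h ≥ 1`, so the maximum is `h`; then `n ^ 4 * h` is absorbed and the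
    -- constants 39 and 7 add up to 46.
    · rw [max_eq_right (Nat.le_trans hn0 hn)] at hc
      have : n ^ 4 * h ≤ n ^ 3 * h ^ 2 := by
        calc n ^ 4 * h = n ^ 3 * (n * h) := by ring
          _ ≤ n ^ 3 * (h * h) := Nat.mul_le_mul_left _ (Nat.mul_le_mul_right _ hn)
          _ = n ^ 3 * h ^ 2 := by ring
      omega

end Main

end

theorem mainTheorem4 :
    -- the number of reduction steps
    (∀ (k : Type u) [Field k] (E : Type v) [AddCommGroup E] [Module k E] [Module k[X] E]
        [Module (RatFunc k) E] [IsScalarTower k (RatFunc k) E] [IsScalarTower k[X] (RatFunc k) E]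
        (N : E → WithBot ℝ) (_ : IsNormedSpaceOver k N)
        (n : ℕ) (b : Module.Basis (Fin n) (RatFunc k) E),
        (∀ (m : ℕ) (c : Fin n → E), ReductionChain k N b m c →
          (m : ℤ) ≤ ((signature N).ncard : ℤ) * ⌊orthogonalDefect N b⌋
              + (((signature N).ncard : ℤ) - 1) * n ∧
          ((¬ ∃ d, IsReductionStep k N c d) ↔ IsReducedBasisOfSpan (k := k) N b c)) ∧
        ∃ (m : ℕ) (c : Fin n → E), ReductionChain k N b m c ∧
          IsReducedBasisOfSpan (k := k) N b c) ∧
    -- the general algorithm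
    (∃ C : ℕ, ∀ (k : Type u) [Field k] (E : Type v) [AddCommGroup E] [Module k E] [Module k[X] E]
        [Module (RatFunc k) E] [IsScalarTower k (RatFunc k) E] [IsScalarTower k[X] (RatFunc k) E]
        (N : E → WithBot ℝ) (_ : IsNormedSpaceOver k N)
        (n : ℕ) (b b' : Module.Basis (Fin n) (RatFunc k) E) (_ : IsOrthonormalBasis N b')
        (T : Matrix (Fin n) (Fin n) k[X])
        (_ : transitionMatrix b b' = T.map (algebraMap k[X] (RatFunc k))),
        ∃ (T' : Matrix (Fin n) (Fin n) k[X]) (c : ℕ),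
          GeneralReductionRuns (fun j => realLength N (b' j)) T T' c ∧
          IsReducedBasisOfSpan (k := k) N b (rowVectors b' T') ∧
          c ≤ C * ((signature N).ncard *
            (n ^ 4 * max 1 (matrixHeight (transitionMatrix b b'))
              + n ^ 3 * max 1 (matrixHeight (transitionMatrix b b')) ^ 2))) ∧
    -- the optimized algorithm
    (∃ C : ℕ, ∀ (k : Type u) [Field k] (E : Type v) [AddCommGroup E] [Module k E] [Module k[X] E]
        [Module (RatFunc k) E] [IsScalarTower k (RatFunc k) E] [IsScalarTower k[X] (RatFunc k) E]
        (N : E → WithBot ℝ) (_ : IsNormedSpaceOver k N)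
        (n : ℕ) (b b' : Module.Basis (Fin n) (RatFunc k) E) (_ : IsOrthonormalBasis N b')
        (T : Matrix (Fin n) (Fin n) k[X])
        (_ : transitionMatrix b b' = T.map (algebraMap k[X] (RatFunc k))),
        ∃ (T' : Matrix (Fin n) (Fin n) k[X]) (c : ℕ),
          OptimizedReductionRuns (fun j => realLength N (b' j)) T T' c ∧
          IsReducedBasisOfSpan (k := k) N b (rowVectors b' T') ∧
          c ≤ C * (n ^ 4 * max 1 (matrixHeight (transitionMatrix b b'))
              + n ^ 3 * max 1 (matrixHeight (transitionMatrix b b')) ^ 2) ∧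
          (n ≤ matrixHeight (transitionMatrix b b') →
            c ≤ C * (n ^ 3 * matrixHeight (transitionMatrix b b') ^ 2))) := by
  exact
    ⟨fun _ _ _ _ _ _ _ _ _ _ hE _ b =>
        ⟨fun _ _ h => ⟨h.length_le hE, h.not_exists_step_iff hE⟩, exists_reductionChain hE b⟩,
      ⟨32, fun _ _ _ _ _ _ _ _ _ _ hE _ _ _ hb _ hT =>
        exists_generalReductionRuns hE.norm hb hT⟩,
      ⟨46, fun _ _ _ _ _ _ _ _ _ _ hE _ _ _ hb _ hT =>
        exists_optimizedReductionRuns hE.norm hb hT⟩⟩
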